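/- **Definitions.** A *standard complex* (without boundary) $K$ is obtained from a closed, possibly disconnected, surface $\Sigma$ (the *preimage* of $K$) by pasting $\Sigma$ to itself generically: apart from points with one preimage, $K$ has only double lines, triple points (locally three coordinate planes in $\mathbb R^3$) and cusps (Whitney umbrellas). It is given by $\Sigma$ and the preimages of the double lines, a system of curves on $\Sigma$ pasted to each other in pairs (no embedding in a 4-manifold is given). A double line runs straight through triple points; it is closed or joins two cusps. $K$ is presented with a finite cell decomposition of $\Sigma$ into polygons such that the curves avoid the vertices, meet each edge at most once and transversally, and meet each face in arcs any two of which cross at most once. $K$ is a *surface knot of genus $g$* if $\Sigma$ is connected and orientable with $\chi(\Sigma)=2-2g$ (a sphere with $g$ handles), a *2-knot* if moreover $g=0$, and an *$n$-component surface link of total genus $g$* if $\Sigma$ is orientable with exactly $n$ connected components, whose genera have sum $g$. *Smoothing* a double line $\ell$ of $K$ means: cut $\Sigma$ along the preimage of $\ell$ and, along $\ell$, glue the two sides of the cut in one sheet to the two sides of the cut in the other sheet, in one of the two possible ways, chosen continuously along $\ell$. The other double lines remain, except that at each triple point on $\ell$ the two other lines are reconnected, each half of the one with a half of the other. The result is again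 a standard complex $K'$, whose preimage is the reglued surface. Throughout, $\ell$ is assumed to pass through each triple point at most once, and the cell decomposition is assumed to be so fine that disjoint arcs of the preimage of $\ell$ lie in different faces. **Statement.** 1. Let $K$ be a surface knot of genus $g$, and let $K'$ be obtained from $K$ by smoothing the double line $\ell$. If the preimage of $K'$ is connected and orientable, then $K'$ is a surface knot of some genus $g'\le g$. 2. (F-lemma for 2-knots.) If $K$ is a 2-knot and $\ell$ is a double line of $K$, then there is a smoothing of $\ell$ whose result $K'$ is a 2-knot. 3. Let $L$ be an $n$-component surface link of total genus $g$, and let $L'$, obtained from $L$ by smoothing the double line $\ell$, be an $n'$-component surface link of total genus $g'$. Then $$g'\le g+(n'-n).$$ -/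

import Mathlib

/-- A closed surface (compact, without boundary, possibly disconnected or non-orientable) with a
cell decomposition, given by its set `F` of flags (vertex, edge, face). The involution `τ₀`
(resp. `τ₁`, `τ₂`) moves a flag to the adjacent flag that differs only in the vertex
(resp. the edge, the face). -/
structure CellSurface (F : Type*) where
  τ₀ : F → F
  τ₁ : F → F
  τ₂ : F → F
  inv₀ : ∀ x, τ₀ (τ₀ x) = x
  inv₁ : ∀ x, τ₁ (τ₁ x) = x
  inv₂ : ∀ x, τ₂ (τ₂ x) = x
  ne₀ : ∀ x, τ₀ x ≠ x
  ne₁ : ∀ x, τ₁ x ≠ x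
  ne₂ : ∀ x, τ₂ x ≠ x
  comm₀₂ : ∀ x, τ₀ (τ₂ x) = τ₂ (τ₀ x)
  ne₀₂ : ∀ x, τ₀ (τ₂ x) ≠ x

namespace CellSurface

variable {F : Type*} (S : CellSurface F)

/-- Vertices are the classes of flags under `τ₁, τ₂`. -/
def Vertex : Type _ := Quot fun x y : F => y = S.τ₁ x ∨ y = S.τ₂ x

/-- Edges are the classes of flags under `τ₀, τ₂`. -/
def Edge : Type _ := Quot fun x y : F => y = S.τ₀ x ∨ y = S.τ₂ x

/-- Faces (each of them a polygon) are the classes of flags under `τ₀, τ₁`. -/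
def Face : Type _ := Quot fun x y : F => y = S.τ₀ x ∨ y = S.τ₁ x

/-- Connected components are the classes of flags under `τ₀, τ₁, τ₂`. -/
def Component : Type _ := Quot fun x y : F => y = S.τ₀ x ∨ y = S.τ₁ x ∨ y = S.τ₂ x

def vertex (x : F) : S.Vertex := Quot.mk _ x

def edge (x : F) : S.Edge := Quot.mk _ x

def face (x : F) : S.Face := Quot.mk _ x

def component (x : F) : S.Component := Quot.mk _ x

/-- The Euler characteristic of the whole surface. -/
noncomputable def eulerChar : ℤ :=
  (Nat.card S.Vertex : ℤ) - Nat.card S.Edge + Nat.card S.Face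

/-- The Euler characteristic of a connected component. -/
noncomputable def componentEulerChar (c : S.Component) : ℤ :=
  (Nat.card {v : S.Vertex // ∃ x, S.vertex x = v ∧ S.component x = c} : ℤ)
    - Nat.card {e : S.Edge // ∃ x, S.edge x = e ∧ S.component x = c}
    + Nat.card {f : S.Face // ∃ x, S.face x = f ∧ S.component x = c}

def Connected : Prop := Nat.card S.Component = 1

/-- An orientation is a two-colouring of the flags in which adjacent flags differ. -/
def Orientable : Prop :=
  ∃ o : F → Bool, ∀ x, o (S.τ₀ x) = !o x ∧ o (S.τ₁ x) = !o x ∧ o (S.τ₂ x) = !o x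

/-- A closed connected oriented surface of genus `g` (a sphere with `g` handles). -/
def IsConnectedOfGenus (g : ℕ) : Prop :=
  S.Connected ∧ S.Orientable ∧ S.eulerChar = 2 - 2 * (g : ℤ)

/-- A closed oriented surface with exactly `n` components, the sum of whose genera is `g`. -/
def HasComponentsAndTotalGenus (n g : ℕ) : Prop :=
  S.Orientable ∧ Nat.card S.Component = n ∧
    ∃ γ : S.Component → ℕ,
      (∀ c, S.componentEulerChar c = 2 - 2 * (γ c : ℤ)) ∧ ∑ᶠ c, γ c = g

/-- The pieces into which the faces fall when they are cut along curves that leave the face through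
the midpoints of exactly those (sides of) edges whose flags lie in `A`: the boundary of a face is
walked along (`τ₁` round a corner, `τ₀` along a side), without passing the midpoints in `A`. -/
def SamePiece (A : Set F) : F → F → Prop :=
  Relation.EqvGen fun u v => v = S.τ₁ u ∨ (u ∉ A ∧ v = S.τ₀ u)

end CellSurface

/-- A closed surface with a system of paired arcs on it. The curves formed by the arcs meet the cell
decomposition transversally: they avoid the vertices and cross an edge at most once, at its
midpoint, and in a face they form finitely many arcs.
* `double` is the set of all flags of the edges that are crossed by a curve.
* `κ` is the continuation of a curve inside a face: the arc that enters the face of `x` through the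
  edge of `x` leaves it through the edge of `κ x`, and the flags `x` and `κ x` lie on the same side
  of that arc.
* `π` is the pasting: the curve through the edge of `x`, on the side of the face of `x`, is pasted
  to the curve through the edge of `π x`, on the side of the face of `π x`. Only the pair
  `{π x, τ₀ (π x)}` matters; which of its two elements is called `π x` has no meaning.

The values of `κ` and `π` outside `double` are irrelevant. -/
structure PairedArcs (F : Type*) extends CellSurface F where
  double : Set F
  κ : F → F
  π : F → F

namespace PairedArcs

variable {F : Type*} (D : PairedArcs F)

/-- The four flags at the two ends of the arc that enters the face of `x` through the edge of `x`. -/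
def arc (x : F) : Set F := {x, D.τ₀ x, D.κ x, D.τ₀ (D.κ x)}

/-- The arcs of `x` and `y` are arcs of the same face that cross: the ends of the second lie in
different pieces of the face cut along the first. Arcs of a face cross once if their ends
interleave on its boundary, and are disjoint otherwise. -/
def Crosses (x y : F) : Prop :=
  x ∈ D.double ∧ y ∈ D.double ∧ D.face x = D.face y ∧ y ∉ D.arc x ∧
    ¬ D.SamePiece (D.arc x) y (D.κ y)

end PairedArcs

/-- A standard complex without boundary: the image of a closed surface that is pasted to itself
generically, with double lines, triple points and cusps only. It is presented by the surface (the
preimage of the complex) and the preimages of the double lines, which are pasted in pairs. -/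
structure StandardComplex (F : Type*) extends PairedArcs F where
  double_τ₀ : ∀ x ∈ double, τ₀ x ∈ double
  double_τ₂ : ∀ x ∈ double, τ₂ x ∈ double
  double_κ : ∀ x ∈ double, κ x ∈ double
  double_π : ∀ x ∈ double, π x ∈ double
  κ_κ : ∀ x ∈ double, κ (κ x) = x
  κ_τ₀ : ∀ x ∈ double, κ (τ₀ x) = τ₀ (κ x)
  κ_ne : ∀ x ∈ double, κ x ≠ x ∧ κ x ≠ τ₀ x
  κ_side : ∀ x ∈ double, toPairedArcs.SamePiece (toPairedArcs.arc x) x (κ x)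
  π_π : ∀ x ∈ double, π (π x) = x
  π_τ₀ : ∀ x ∈ double, π (τ₀ x) = τ₀ (π x)
  π_τ₂ : ∀ x ∈ double, π (τ₂ x) = τ₂ (π x)
  /-- No point of an edge is pasted to itself. -/
  π_ne : ∀ x ∈ double, π x ∉ ({x, τ₀ x, τ₂ x, τ₀ (τ₂ x)} : Set F)
  /-- Arcs are pasted to arcs. If an arc is pasted to itself, that is `π x ∈ arc x`, then its
  two halves are pasted together, and its middle point is a cusp. -/
  π_κ : ∀ x ∈ double, π (κ x) = κ (π x) ∨ π (κ x) = τ₀ (κ (π x))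
  /-- An arc crosses at most one other arc (in its face). -/
  crosses_unique : ∀ x y y', toPairedArcs.Crosses x y → toPairedArcs.Crosses x y' →
    y' ∈ toPairedArcs.arc y
  /-- Crossing arcs carry no cusps. -/
  crosses_not_cusp : ∀ x y, toPairedArcs.Crosses x y → π x ∉ toPairedArcs.arc x
  /-- Two arcs pasted together do not cross. -/
  crosses_not_paired : ∀ x, ¬ toPairedArcs.Crosses x (π x)
  /-- The crossings come in threes, the three preimages of a triple point: if `x` and `y` cross in
  one sheet, then `π x` crosses some `z` in a second sheet, and `π y` and `π z` cross in a third. -/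
  triple : ∀ x y, toPairedArcs.Crosses x y →
    ∃ z, toPairedArcs.Crosses (π x) z ∧ toPairedArcs.Crosses (π z) (π y)

namespace StandardComplex

variable {F : Type*} (K : StandardComplex F)

/-- `L` is (the set of flags of) the full preimage of one double line: all that is reached from
one point by following the curve, through edges and faces and straight through crossings, and
by passing to pasted points. -/
def IsDoubleLine (L : Set F) : Prop :=
  ∃ x ∈ K.double, L = {y | Relation.EqvGen
    (fun u v => v = K.τ₀ u ∨ v = K.τ₂ u ∨ (u ∈ K.double ∧ (v = K.κ u ∨ v = K.π u))) x y}

/-- No triple point is passed more than once by the double line `L`, that is, a triple point on `L`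
lies on just one of the branches of `L` (so no two branches of `L` cross in a sheet). -/
def PassesTriplePointsOnce (L : Set F) : Prop :=
  ∀ x ∈ L, ∀ y ∈ L, ¬ K.Crosses x y

/-- The cell decomposition is fine enough along `L`: disjoint arcs of `L` lie in different faces.
This restricts only the presentation, as a face can be subdivided between disjoint arcs. -/
def IsFineAlong (L : Set F) : Prop :=
  ∀ x ∈ L, ∀ y ∈ L, K.face x = K.face y → y ∈ K.arc x ∨ K.Crosses x y

/-- `K'` is obtained from `K` by smoothing the double line `L`: the surface is cut along
the preimage of `L`, and along `L` the two sides of one sheet are glued to the two sides of the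
other, in one of the two possible ways, the choice being continuous along `L`.

Cutting through an edge of `L` at its midpoint and gluing the half-edges to those of the
pasted edge changes `τ₀` on the flags of `L` and nothing else. The remaining double lines stay, except
at each triple point on `L`: there the two remaining lines, meeting in the third sheet, are
reconnected, each half of the one with a half of the other on the same side of the cut. -/
structure IsSmoothing (L : Set F) (K' : StandardComplex F) : Prop where
  isDoubleLine : K.IsDoubleLine L
  τ₁_eq : K'.τ₁ = K.τ₁
  τ₂_eq : K'.τ₂ = K.τ₂
  τ₀_off : ∀ x ∉ L, K'.τ₀ x = K.τ₀ x
  /-- The half-edge of `x` is glued to one of the two halves of the pasted edge. -/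
  τ₀_on : ∀ x ∈ L, K'.τ₀ x = K.π x ∨ K'.τ₀ x = K.τ₀ (K.π x)
  /-- The gluing is continuous along the line through faces. (Across edges it is so because `τ₀` and
  `τ₂` of `K'` commute.) -/
  τ₀_continuous : ∀ x ∈ L, K'.τ₀ (K.κ x) = K.κ (K'.τ₀ x)
  double_eq : K'.double = K.double \ L
  π_eq : ∀ x ∈ K'.double, K'.π x = K.π x
  /-- Away from the triple points on `L` the remaining arcs are unchanged. -/
  κ_eq : ∀ x ∈ K'.double, (∀ l ∈ L, ¬ K.Crosses l x ∧ ¬ K.Crosses l (K.π x)) → K'.κ x = K.κ x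
  /-- If an arc crosses the arc of `l ∈ L` in a sheet, its halves are continued by the halves of the
  arc that crosses `L` in the sheet pasted along `l`. -/
  κ_reconnect : ∀ x ∈ K'.double, ∀ l ∈ L, K.Crosses l x → K.Crosses (K.π l) (K'.κ x)

/-- A surface knot of genus `g`: a standard complex whose preimage is a sphere with `g` handles. -/
def IsSurfaceKnot (g : ℕ) : Prop := K.IsConnectedOfGenus g

/-- A 2-knot is a knotted sphere. -/
def IsTwoKnot : Prop := K.IsSurfaceKnot 0

/-- An `n`-component surface link of total genus `g`. -/
def IsSurfaceLink (n g : ℕ) : Prop := K.HasComponentsAndTotalGenus n g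

end StandardComplex

/-! Smoothing changes `τ₀` on the flags of the line `L` and nothing else in the cell structure.
Vertices are orbits of `τ₁, τ₂` and every edge has four flags, so both numbers stay; only the faces
met by `L` change. By fineness each of these contains a single arc of `L`, which halves it, and the
regluing joins the halves in pairs. The one exception is an arc with a cusp in its middle, whose two
halves may each be closed up to a face. Hence χ(K') ≥ χ(K) (`eulerChar_le`), and with χ = 2n − 2g
this is statement 3.

For statement 1 the change of χ must be even and χ(K') ≤ 2. The change is a quarter of the number of
flags `x` of `L` with `K'.τ₀ x = K.κ x`, and this number is divisible by 8 (`eight_dvd_card_split`):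
a double line does not have just one cusp. The bound χ ≤ 2 is a count over `ZMod 2`: on a connected
surface the coboundary has rank at least V − 1, the dual coboundary rank at least F − 1, and on an
oriented surface their ranges are orthogonal in a space of dimension E.

For statement 2, equality χ = 2 makes each of these ranges the full orthogonal complement of the
other, so every closed cochain is a coboundary. As the curves of `L` cross the boundary of each face
evenly, they separate the sphere into regions of two colours `s`. The smoothing glues regions of
different colours. The choice is then continuous, the result is connected and orientable, and 2 ≤
χ(K') ≤ 2.

It remains to show that the result is a standard complex. Crossings are handled by cut functions:
two-valued functions on flags that jump exactly at the ends of an arc, so that another arc of the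
face crosses it exactly if the function differs at its two ends. After the regluing the arcs through
triple points on `L` cross nothing, and all other arcs keep their crossings
(`not_affected_of_crosses`, `crosses_arcs_iff`), so the axioms on crossings are inherited. -/

theorem even_card_of_involution {α : Type*} (s : Finset α) (f : α → α)
    (hs : ∀ a ∈ s, f a ∈ s) (hne : ∀ a ∈ s, f a ≠ a) (hf : ∀ a ∈ s, f (f a) = a) :
    Even s.card := by
  have h := Finset.sum_involution (s := s) (f := fun _ => (1 : ZMod 2)) (fun a _ => f a)
    (fun _ _ => by decide) (fun a ha _ => hne a ha) hs hf
  simp only [Finset.sum_const, nsmul_eq_mul, mul_one] at h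
  exact (ZMod.natCast_eq_zero_iff_even).1 h

/-! ### Faces cut along chords -/

namespace CellSurface

variable {F : Type*} (S : CellSurface F)

theorem face_τ₀ (x : F) : S.face (S.τ₀ x) = S.face x := by
  symm; exact Quot.sound (Or.inl rfl)

theorem face_τ₁ (x : F) : S.face (S.τ₁ x) = S.face x := by
  symm; exact Quot.sound (Or.inr rfl)

theorem vertex_τ₁ (x : F) : S.vertex (S.τ₁ x) = S.vertex x := by
  symm; exact Quot.sound (Or.inl rfl)

theorem vertex_τ₂ (x : F) : S.vertex (S.τ₂ x) = S.vertex x := by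
  symm; exact Quot.sound (Or.inr rfl)

theorem edge_τ₀ (x : F) : S.edge (S.τ₀ x) = S.edge x := by
  symm; exact Quot.sound (Or.inl rfl)

theorem edge_τ₂ (x : F) : S.edge (S.τ₂ x) = S.edge x := by
  symm; exact Quot.sound (Or.inr rfl)

theorem component_τ₀ (x : F) : S.component (S.τ₀ x) = S.component x := by
  symm; exact Quot.sound (Or.inl rfl)

theorem component_τ₁ (x : F) : S.component (S.τ₁ x) = S.component x := by
  symm; exact Quot.sound (Or.inr (Or.inl rfl))

theorem component_τ₂ (x : F) : S.component (S.τ₂ x) = S.component x := by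
  symm; exact Quot.sound (Or.inr (Or.inr rfl))

variable {S}

theorem eq_of_face_eq {α : Type*} (f : F → α) (h₀ : ∀ x, f (S.τ₀ x) = f x)
    (h₁ : ∀ x, f (S.τ₁ x) = f x) {x y : F} (h : S.face x = S.face y) : f x = f y :=
  congrArg (Quot.lift f (by rintro a b (rfl | rfl) <;> simp [*])) h

theorem eq_of_edge_eq {α : Type*} (f : F → α) (h₀ : ∀ x, f (S.τ₀ x) = f x)
    (h₂ : ∀ x, f (S.τ₂ x) = f x) {x y : F} (h : S.edge x = S.edge y) : f x = f y :=
  congrArg (Quot.lift f (by rintro a b (rfl | rfl) <;> simp [*])) h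

theorem eq_of_vertex_eq {α : Type*} (f : F → α) (h₁ : ∀ x, f (S.τ₁ x) = f x)
    (h₂ : ∀ x, f (S.τ₂ x) = f x) {x y : F} (h : S.vertex x = S.vertex y) : f x = f y :=
  congrArg (Quot.lift f (by rintro a b (rfl | rfl) <;> simp [*])) h

theorem eq_of_component_eq {α : Type*} (f : F → α) (h₀ : ∀ x, f (S.τ₀ x) = f x)
    (h₁ : ∀ x, f (S.τ₁ x) = f x) (h₂ : ∀ x, f (S.τ₂ x) = f x) {x y : F}
    (h : S.component x = S.component y) : f x = f y :=
  congrArg (Quot.lift f (by rintro a b (rfl | rfl | rfl) <;> simp [*])) h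

theorem Connected.eq_of_invariant (hS : S.Connected) {α : Type*} (f : F → α)
    (h₀ : ∀ x, f (S.τ₀ x) = f x) (h₁ : ∀ x, f (S.τ₁ x) = f x) (h₂ : ∀ x, f (S.τ₂ x) = f x)
    (x y : F) : f x = f y :=
  eq_of_component_eq f h₀ h₁ h₂ ((Nat.card_eq_one_iff_unique.1 hS).1.elim _ _)

theorem Connected.nonempty (hS : S.Connected) : Nonempty F := by
  obtain ⟨c⟩ := (Nat.card_eq_one_iff_unique.1 hS).2
  exact ⟨(Quot.exists_rep c).choose⟩

namespace SamePiece

variable {A : Set F} {u v w : F}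

theorem refl (u : F) : S.SamePiece A u u := Relation.EqvGen.refl u

theorem symm (h : S.SamePiece A u v) : S.SamePiece A v u := Relation.EqvGen.symm _ _ h

theorem trans (h : S.SamePiece A u v) (h' : S.SamePiece A v w) : S.SamePiece A u w :=
  Relation.EqvGen.trans _ _ _ h h'

theorem step_τ₁ (u : F) : S.SamePiece A u (S.τ₁ u) := Relation.EqvGen.rel _ _ (Or.inl rfl)

theorem step_τ₀ (h : u ∉ A) : S.SamePiece A u (S.τ₀ u) :=
  Relation.EqvGen.rel _ _ (Or.inr ⟨h, rfl⟩)

theorem eq_of_invariant (h : S.SamePiece A u v) {α : Type*} (f : F → α)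
    (h₁ : ∀ x, f (S.τ₁ x) = f x) (h₀ : ∀ x ∉ A, f (S.τ₀ x) = f x) : f u = f v := by
  induction h with
  | rel a b h => rcases h with rfl | ⟨h, rfl⟩ <;> simp [*]
  | refl => rfl
  | symm _ _ _ ih => exact ih.symm
  | trans _ _ _ _ _ ih ih' => exact ih.trans ih'

theorem face_eq (h : S.SamePiece A u v) : S.face u = S.face v :=
  h.eq_of_invariant S.face S.face_τ₁ fun x _ => S.face_τ₀ x

end SamePiece

variable (S) in
/-- An orientation. -/
structure IsOrientation (o : F → Bool) : Prop where
  flip₀ : ∀ x, o (S.τ₀ x) = !o x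
  flip₁ : ∀ x, o (S.τ₁ x) = !o x
  flip₂ : ∀ x, o (S.τ₂ x) = !o x

theorem Orientable.exists_isOrientation (h : S.Orientable) : ∃ o, S.IsOrientation o :=
  let ⟨o, ho⟩ := h
  ⟨o, fun x => (ho x).1, fun x => (ho x).2.1, fun x => (ho x).2.2⟩

/-- Walking along the boundary of a face from a cut, one arrives at a cut again. -/
theorem exists_walk [Finite F] {A : Set F} (hA : ∀ u ∈ A, S.τ₀ u ∈ A) {a : F} (ha : a ∈ A) :
    ∃ (Q : Set F) (e : F), a ∈ Q ∧ e ∈ Q ∧ e ∈ A ∧ (∀ u ∈ Q, S.τ₁ u ∈ Q) ∧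
      (∀ u ∈ Q, u ∉ A → S.τ₀ u ∈ Q) ∧ (∀ u ∈ Q, u ∈ A → u = a ∨ u = e) ∧
      (∀ u ∈ Q, S.SamePiece A a u) ∧ ∀ o, S.IsOrientation o → o e = !o a := by
  classical
  let f : F → F := fun u => S.τ₀ (S.τ₁ u)
  have hf : Function.Injective f := fun u v h => by
    have := congrArg (fun w => S.τ₁ (S.τ₀ w)) h
    simpa [f, S.inv₀, S.inv₁] using this
  -- The walk is a permutation of a finite set, so it returns to `a`. Half a step before, it stands
  -- at `S.τ₀ a`, which lies in `A`.
  have hex : ∃ n, S.τ₁ (f^[n] a) ∈ A := by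
    obtain ⟨N, hN, h⟩ := Function.mem_periodicPts.1 (hf.mem_periodicPts a)
    obtain ⟨n, rfl⟩ := Nat.exists_eq_succ_of_ne_zero hN.ne'
    have h' : f (f^[n] a) = a := (Function.iterate_succ_apply' f n a).symm.trans h
    refine ⟨n, ?_⟩
    have : S.τ₁ (f^[n] a) = S.τ₀ a := by
      rw [← h']; simp only [f, S.inv₀]; rw [show S.τ₀ (S.τ₁ (f^[n] a)) = a from h']
    rw [this]; exact hA _ ha
  let n := Nat.find hex
  have hn : S.τ₁ (f^[n] a) ∈ A := Nat.find_spec hex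
  have hmin : ∀ i < n, S.τ₁ (f^[i] a) ∉ A := fun i hi => Nat.find_min hex hi
  have hstep : ∀ i, S.τ₀ (S.τ₁ (f^[i] a)) = f^[i + 1] a := fun i => by
    rw [Function.iterate_succ_apply' f]
  have hback : ∀ i, S.τ₀ (f^[i + 1] a) = S.τ₁ (f^[i] a) := fun i => by
    rw [← hstep, S.inv₀]
  have hpiece : ∀ i ≤ n, S.SamePiece A a (f^[i] a) := by
    intro i
    induction i with
    | zero => intro _; exact SamePiece.refl _
    | succ i ih =>
      intro hi
      refine ((ih (by omega)).trans (SamePiece.step_τ₁ _)).trans ?_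
      rw [← hstep]
      exact SamePiece.step_τ₀ (hmin i (by omega))
  have hcol : ∀ o, S.IsOrientation o → ∀ i, o (f^[i] a) = o a := by
    intro o ho i
    induction i with
    | zero => rfl
    | succ i ih => rw [← hstep, ho.flip₀, ho.flip₁, ih, Bool.not_not]
  refine ⟨{u | ∃ i ≤ n, u = f^[i] a ∨ u = S.τ₁ (f^[i] a)}, S.τ₁ (f^[n] a), ⟨0, by omega, .inl rfl⟩,
    ⟨n, le_rfl, .inr rfl⟩, hn, ?_, ?_, ?_, ?_, ?_⟩
  · rintro u ⟨i, hi, rfl | rfl⟩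
    · exact ⟨i, hi, .inr rfl⟩
    · exact ⟨i, hi, .inl (S.inv₁ _)⟩
  · rintro u ⟨i, hi, rfl | rfl⟩ hu
    · cases i with
      | zero => exact absurd ha hu
      | succ i => exact ⟨i, by omega, .inr (hback i)⟩
    · rcases hi.lt_or_eq with h | rfl
      · exact ⟨i + 1, h, .inl (hstep i)⟩
      · exact absurd hn hu
  · rintro u ⟨i, hi, rfl | rfl⟩ hu
    · cases i with
      | zero => exact .inl rfl
      | succ i => exact absurd (hback i ▸ hA _ hu) (hmin i (by omega))
    · rcases hi.lt_or_eq with h | rfl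
      · exact absurd hu (hmin i h)
      · exact .inr rfl
  · rintro u ⟨i, hi, rfl | rfl⟩
    · exact hpiece i hi
    · exact (hpiece i hi).trans (SamePiece.step_τ₁ _)
  · intro o ho
    rw [ho.flip₁, hcol o ho]

variable (S) in
/-- The flags at the ends of a chord that joins the sides of `a` and `b` of a face. -/
def chord (a b : F) : Set F := {a, S.τ₀ a, b, S.τ₀ b}

theorem mem_chord {a b u : F} : u ∈ S.chord a b ↔ u = a ∨ u = S.τ₀ a ∨ u = b ∨ u = S.τ₀ b :=
  Iff.rfl

theorem chord_τ₀ (a b : F) : ∀ u ∈ S.chord a b, S.τ₀ u ∈ S.chord a b := by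
  simp only [mem_chord]
  rintro u (rfl | rfl | rfl | rfl) <;> simp [S.inv₀]

theorem chord_swap (a b : F) : S.chord (S.τ₀ a) (S.τ₀ b) = S.chord a b := by
  ext u; simp only [mem_chord, S.inv₀]; tauto

theorem τ₀_mem_chord {a b u : F} : S.τ₀ u ∈ S.chord a b ↔ u ∈ S.chord a b :=
  ⟨fun h => S.inv₀ u ▸ chord_τ₀ a b _ h, chord_τ₀ a b u⟩

variable (S) in
/-- The flags `a` and `b` belong to different sides of the same face, and lie on the same side of
the chord joining these. -/
structure IsChord (o : F → Bool) (a b : F) : Prop where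
  face_eq : S.face b = S.face a
  flip : o b = !o a
  ne : b ≠ S.τ₀ a

variable (S) in
/-- The function `p` is locally constant on the faces off the cuts `A`, and jumps at `A`. -/
structure IsCut (A : Set F) (p : F → Bool) : Prop where
  inv₁ : ∀ u, p (S.τ₁ u) = p u
  jump : ∀ u ∈ A, p (S.τ₀ u) = !p u
  off : ∀ u ∉ A, p (S.τ₀ u) = p u

variable {o : F → Bool} {a b c d : F}

namespace IsChord

theorem τ₀ (ho : S.IsOrientation o) (h : S.IsChord o a b) : S.IsChord o (S.τ₀ a) (S.τ₀ b) :=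
  ⟨by rw [S.face_τ₀, S.face_τ₀, h.face_eq], by rw [ho.flip₀, ho.flip₀, h.flip],
    fun e => h.ne (by rw [← S.inv₀ b, e, S.inv₀])⟩

theorem ne' (h : S.IsChord o a b) : b ≠ a := fun e => by simpa [e] using h.flip

/-- The walk from `a` to the next cut ends at a flag of the chord oriented oppositely to `a`. Only
`S.τ₀ a` and `b` qualify, and the first is impossible. -/
theorem samePiece_and_not [Finite F] (ho : S.IsOrientation o) (h : S.IsChord o a b) :
    S.SamePiece (S.chord a b) a b ∧ ¬ S.SamePiece (S.chord a b) a (S.τ₀ a) := by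
  obtain ⟨Q, e, haQ, heQ, heA, h₁, h₀, hQA, hQ, hcol⟩ :=
    exists_walk (chord_τ₀ a b) (show a ∈ S.chord a b from .inl rfl)
  have hcol := hcol o ho
  have hb : b ∈ S.chord a b := .inr (.inr (.inl rfl))
  have he : e = b := by
    rcases mem_chord.1 heA with rfl | rfl | rfl | rfl
    · simp at hcol
    -- A walk that ends at `S.τ₀ a` closes up to the whole boundary of the face, and so cannot miss
    -- `b`.
    · exfalso
      have hcl : ∀ u ∈ Q, S.τ₀ u ∈ Q := fun u hu => by
        by_cases huA : u ∈ S.chord a b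
        · rcases hQA u hu huA with rfl | rfl
          · exact heQ
          · rwa [S.inv₀]
        · exact h₀ u hu huA
      have : (a ∈ Q) = (b ∈ Q) := eq_of_face_eq (S := S) (fun u => u ∈ Q)
        (fun x => propext ⟨fun hx => by simpa [S.inv₀] using hcl _ hx, hcl x⟩)
        (fun x => propext ⟨fun hx => by simpa [S.inv₁] using h₁ _ hx, h₁ x⟩) h.face_eq.symm
      rcases hQA b (this ▸ haQ) hb with e | e
      · exact h.ne' e
      · exact h.ne e
    · rfl
    · rw [ho.flip₀, h.flip] at hcol; simp at hcol
  subst he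
  refine ⟨hQ _ heQ, fun hs => ?_⟩
  have : (a ∈ Q) = (S.τ₀ a ∈ Q) := hs.eq_of_invariant (fun u => u ∈ Q)
    (fun x => propext ⟨fun hx => by simpa [S.inv₁] using h₁ _ hx, h₁ x⟩)
    (fun x hx => propext
      ⟨fun hx' => by simpa [S.inv₀] using h₀ _ hx' (mt τ₀_mem_chord.1 hx), fun h => h₀ x h hx⟩)
  rcases hQA _ (this ▸ haQ) (.inr (.inl rfl)) with e' | e'
  · exact S.ne₀ _ e'
  · exact h.ne e'.symm

theorem samePiece [Finite F] (ho : S.IsOrientation o) (h : S.IsChord o a b) :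
    S.SamePiece (S.chord a b) a b := (h.samePiece_and_not ho).1

theorem samePiece_τ₀ [Finite F] (ho : S.IsOrientation o) (h : S.IsChord o a b) :
    S.SamePiece (S.chord a b) (S.τ₀ a) (S.τ₀ b) := by
  simpa only [chord_swap] using (h.τ₀ ho).samePiece ho

theorem not_samePiece [Finite F] (ho : S.IsOrientation o) (h : S.IsChord o a b) :
    ¬ S.SamePiece (S.chord a b) a (S.τ₀ a) := (h.samePiece_and_not ho).2

theorem of_samePiece [Finite F] (ho : S.IsOrientation o) (h : S.SamePiece (S.chord a b) a b)
    (hne : b ≠ a) (hne' : b ≠ S.τ₀ a) : S.IsChord o a b := by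
  refine ⟨h.face_eq.symm, ?_, hne'⟩
  obtain ⟨Q, e, haQ, heQ, heA, h₁, h₀, hQA, hQ, hcol⟩ :=
    exists_walk (chord_τ₀ a b) (show a ∈ S.chord a b from .inl rfl)
  have : (a ∈ Q) = (b ∈ Q) := h.eq_of_invariant (fun u => u ∈ Q)
    (fun x => propext ⟨fun hx => by simpa [S.inv₁] using h₁ _ hx, h₁ x⟩)
    (fun x hx => propext
      ⟨fun hx' => by simpa [S.inv₀] using h₀ _ hx' (mt τ₀_mem_chord.1 hx), fun h => h₀ x h hx⟩)
  rcases hQA b (this ▸ haQ) (.inr (.inr (.inl rfl))) with e | rfl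
  · exact absurd e hne
  · exact hcol o ho

/-- The indicator function of the piece of `a` serves as the cut. -/
theorem exists_cut [Finite F] (ho : S.IsOrientation o) (h : S.IsChord o a b) :
    ∃ p, S.IsCut (S.chord a b) p ∧ p a = true ∧ ∀ u, p u = true → S.face u = S.face a := by
  classical
  have hb := h.samePiece ho
  have hn := h.not_samePiece ho
  have hb' := h.samePiece_τ₀ ho
  have hn' : ¬ S.SamePiece (S.chord a b) a (S.τ₀ b) := fun e => hn (e.trans hb'.symm)
  refine ⟨fun u => decide (S.SamePiece (S.chord a b) a u), ⟨fun u => ?_, fun u hu => ?_,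
    fun u hu => ?_⟩, by simpa using SamePiece.refl a, fun u hu => ?_⟩
  · have : S.SamePiece (S.chord a b) a (S.τ₁ u) ↔ S.SamePiece (S.chord a b) a u :=
      ⟨fun h => h.trans (SamePiece.step_τ₁ u).symm, fun h => h.trans (SamePiece.step_τ₁ u)⟩
    simp [this]
  · have hr := SamePiece.refl (S := S) (A := S.chord a b) a
    rcases mem_chord.1 hu with rfl | rfl | rfl | rfl <;> simp [*, S.inv₀]
  · have : S.SamePiece (S.chord a b) a (S.τ₀ u) ↔ S.SamePiece (S.chord a b) a u :=
      ⟨fun h => h.trans (SamePiece.step_τ₀ hu).symm, fun h => h.trans (SamePiece.step_τ₀ hu)⟩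
    simp [this]
  · exact (of_decide_eq_true hu : S.SamePiece _ _ _).face_eq.symm

end IsChord

namespace IsCut

variable {A B : Set F} {p q : F → Bool}

theorem eq_of_samePiece (hp : S.IsCut A p) {u v : F} (h : S.SamePiece A u v) : p u = p v :=
  h.eq_of_invariant p hp.inv₁ hp.off

theorem not (hp : S.IsCut A p) : S.IsCut A fun u => !p u :=
  ⟨fun u => by simp [hp.inv₁], fun u hu => by simp [hp.jump u hu],
    fun u hu => by simp [hp.off u hu]⟩

/-- A chord leaves just two pieces of its face, those of `a` and of `S.τ₀ a`, and every cut function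
tells them apart by its jump at `a`. -/
theorem samePiece_iff [Finite F] (ho : S.IsOrientation o) (h : S.IsChord o a b)
    (hp : S.IsCut (S.chord a b) p) {u v : F} (hu : S.face u = S.face a)
    (hv : S.face v = S.face a) : S.SamePiece (S.chord a b) u v ↔ p u = p v := by
  refine ⟨hp.eq_of_samePiece, fun e => ?_⟩
  have key : ∀ w, S.face w = S.face a →
      S.SamePiece (S.chord a b) a w ∨ S.SamePiece (S.chord a b) (S.τ₀ a) w := by
    intro w hw
    have hb := h.samePiece ho
    have hb' := h.samePiece_τ₀ ho
    have := eq_of_face_eq (S := S)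
      (fun w => S.SamePiece (S.chord a b) a w ∨ S.SamePiece (S.chord a b) (S.τ₀ a) w)
      (fun x => propext ?_) (fun x => propext ?_) hw
    · exact this.mpr (.inl (SamePiece.refl a))
    · by_cases hx : x ∈ S.chord a b
      · have hr := SamePiece.refl (S := S) (A := S.chord a b) a
        have hr' := SamePiece.refl (S := S) (A := S.chord a b) (S.τ₀ a)
        rcases mem_chord.1 hx with rfl | rfl | rfl | rfl <;> simp [*, S.inv₀]
      · have hs := SamePiece.step_τ₀ (S := S) hx
        exact ⟨fun h => h.imp (·.trans hs.symm) (·.trans hs.symm),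
          fun h => h.imp (·.trans hs) (·.trans hs)⟩
    · have hs := SamePiece.step_τ₁ (S := S) (A := S.chord a b) x
      exact ⟨fun h => h.imp (·.trans hs.symm) (·.trans hs.symm),
        fun h => h.imp (·.trans hs) (·.trans hs)⟩
  have hj := hp.jump a (.inl rfl)
  rcases key u hu with h1 | h1 <;> rcases key v hv with h2 | h2
  · exact h1.symm.trans h2
  · have e1 := hp.eq_of_samePiece h1
    have e2 := hp.eq_of_samePiece h2
    rw [← e1, ← e2, hj] at e; simp at e
  · have e1 := hp.eq_of_samePiece h1
    have e2 := hp.eq_of_samePiece h2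
    rw [← e1, ← e2, hj] at e; simp at e
  · exact h1.symm.trans h2

/-- If the ends of a second chord are separated by a first one, the ends of the first are separated
by the second. -/
theorem separates_symm [Finite F] (hp : S.IsCut (S.chord a b) p) (hq : S.IsCut (S.chord c d) q)
    (hc : c ∉ S.chord a b) (ha : a ∉ S.chord c d) (hb : b ∉ S.chord c d) (h : p c ≠ p d) :
    q a ≠ q b := by
  classical
  intro hqab
  have hc' : p (S.τ₀ c) = p c := hp.off c hc
  obtain ⟨u₀, hu₀, hpu₀, hqu₀⟩ : ∃ u₀, (u₀ = c ∨ u₀ = S.τ₀ c) ∧ p u₀ = p c ∧ q u₀ ≠ q a := by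
    by_cases hqc : q c = q a
    · exact ⟨S.τ₀ c, .inr rfl, hc', by rw [hq.jump c (.inl rfl), hqc]; simp⟩
    · exact ⟨c, .inl rfl, rfl, hqc⟩
  -- A parity count. If `q` agreed at `a` and `b`, the set `R` would contain no end of the first
  -- chord and only the end `u₀` of the second. Then `τ₁` pairs all flags of `R`, while `τ₀` pairs
  -- all except `u₀`.
  let R : Finset F := (Set.toFinite {u | p u = p c ∧ q u ≠ q a}).toFinset
  have hR : ∀ u, u ∈ R ↔ p u = p c ∧ q u ≠ q a := fun u => by simp [R]
  have h1 : Even R.card := even_card_of_involution R S.τ₁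
    (fun u hu => by rw [hR] at hu ⊢; rwa [hp.inv₁, hq.inv₁]) (fun u _ => S.ne₁ u)
    (fun u _ => S.inv₁ u)
  have hab : ∀ u ∈ R, u ∉ S.chord a b := fun u hu hu' => by
    rw [hR] at hu
    have e1 := hq.off a ha
    have e2 := hq.off b hb
    rcases mem_chord.1 hu' with rfl | rfl | rfl | rfl <;> simp_all
  have hcd : ∀ u ∈ R, u ∈ S.chord c d → u = u₀ := fun u hu hu' => by
    have hu2 := (hR u).1 hu
    have hqj := hq.jump c (.inl rfl)
    have : u = c ∨ u = S.τ₀ c := by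
      rcases mem_chord.1 hu' with e | e | e | e
      · exact .inl e
      · exact .inr e
      · exact absurd (e ▸ hu2.1).symm h
      · have : p (S.τ₀ u) = p u := hp.off u (hab u hu)
        rw [e, S.inv₀] at this
        rw [e] at hu2
        exact absurd (this.trans hu2.1).symm h
    rcases this with rfl | rfl <;> rcases hu₀ with rfl | rfl <;> simp_all
  have hu₀R : u₀ ∈ R := (hR _).2 ⟨hpu₀, hqu₀⟩
  have hu₀cd : u₀ ∈ S.chord c d := by
    rcases hu₀ with rfl | rfl
    · exact .inl rfl
    · exact .inr (.inl rfl)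
  have h2 : Even (R.erase u₀).card := even_card_of_involution _ S.τ₀ (fun u hu => by
      have hne := Finset.ne_of_mem_erase hu
      have huR := Finset.mem_of_mem_erase hu
      have hucd : u ∉ S.chord c d := fun e => hne (hcd u huR e)
      refine Finset.mem_erase.2 ⟨fun e => hucd ?_, ?_⟩
      · rw [← τ₀_mem_chord, e]; exact hu₀cd
      · have := (hR u).1 huR
        rw [hR, hp.off u (hab u huR), hq.off u hucd]; exact this)
    (fun u _ => S.ne₀ u) (fun u _ => S.inv₀ u)
  rw [Finset.card_erase_of_mem hu₀R] at h2
  have := Finset.card_pos.2 ⟨u₀, hu₀R⟩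
  rcases h1 with ⟨m, hm⟩
  rcases h2 with ⟨k, hk⟩
  omega

/-- Two crossing chords lie on the same side of everything that they do not meet. -/
theorem eq_of_crossing {r : F → Bool} (hr : S.IsCut B r) (hq : S.IsCut (S.chord a b) q)
    (hqB : ∀ u ∈ B, q u = false) (haB : a ∉ B) (hbB : b ∉ B) (hab : r a = r b) (hcd : r c = r d)
    (hcross : ∀ q, S.IsCut (S.chord a b) q → q c ≠ q d) : r a = r c := by
  by_contra hne
  have e1 := hr.off a haB
  have e2 := hr.off b hbB
  -- Since `q` vanishes on `B`, restricting it to the side of `a` with respect to `r` creates no new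
  -- jump. The result is again a cut along the first chord, but it vanishes at both `c` and `d`.
  refine hcross (fun u => q u && (r u == r a)) ⟨fun u => ?_, fun u hu => ?_, fun u hu => ?_⟩ ?_
  · simp [hq.inv₁, hr.inv₁]
  · have h1 : r u = r a ∧ r (S.τ₀ u) = r a := by
      rcases mem_chord.1 hu with rfl | rfl | rfl | rfl <;> simp_all [S.inv₀]
    simp [h1.1, h1.2, hq.jump u hu]
  · by_cases huB : u ∈ B
    · simp [hq.off u hu, hqB u huB]
    · simp [hq.off u hu, hr.off u huB]
  · have h1 : (r c == r a) = false := by simpa using Ne.symm hne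
    have h2 : (r d == r a) = false := by rw [← hcd]; exact h1
    simp [h1, h2]

end IsCut

end CellSurface

/-! ### Euler characteristic and homology modulo 2 -/

namespace CellSurface

variable {F : Type*} {S : CellSurface F}

instance [Finite F] : Finite S.Vertex := inferInstanceAs (Finite (Quot _))

instance [Finite F] : Finite S.Edge := inferInstanceAs (Finite (Quot _))

instance [Finite F] : Finite S.Face := inferInstanceAs (Finite (Quot _))

instance [Finite F] : Finite S.Component := inferInstanceAs (Finite (Quot _))

theorem vertex_surjective : Function.Surjective S.vertex := Quot.exists_rep

theorem edge_surjective : Function.Surjective S.edge := Quot.exists_rep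

theorem face_surjective : Function.Surjective S.face := Quot.exists_rep

theorem component_surjective : Function.Surjective S.component := Quot.exists_rep

theorem edge_eq_iff {x y : F} :
    S.edge x = S.edge y ↔ x = y ∨ x = S.τ₀ y ∨ x = S.τ₂ y ∨ x = S.τ₀ (S.τ₂ y) := by
  constructor
  · intro h
    have h0 : ∀ u v, S.τ₀ u = v ↔ u = S.τ₀ v := fun u v =>
      ⟨fun e => by rw [← e, S.inv₀], fun e => by rw [e, S.inv₀]⟩
    have h2 : ∀ u v, S.τ₂ u = v ↔ u = S.τ₂ v := fun u v =>
      ⟨fun e => by rw [← e, S.inv₂], fun e => by rw [e, S.inv₂]⟩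
    refine (eq_of_edge_eq (S := S)
      (fun u => u = y ∨ u = S.τ₀ y ∨ u = S.τ₂ y ∨ u = S.τ₀ (S.τ₂ y)) ?_ ?_ h).mpr (.inl rfl)
    · intro u
      simp only [h0, S.inv₀, eq_iff_iff]
      tauto
    · intro u
      simp only [h2, S.inv₂, ← S.comm₀₂, eq_iff_iff]
      tauto
  · rintro (rfl | rfl | rfl | rfl) <;> simp only [edge_τ₀, edge_τ₂]

/-- `τ₀` and `τ₂` generate a free action of the Klein four-group. So the number of edges depends on
the set of flags alone, and is the same before and after a smoothing. -/
theorem four_mul_card_edge [Finite F] : 4 * Nat.card S.Edge = Nat.card F := by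
  classical
  have := Fintype.ofFinite F
  have := Fintype.ofFinite S.Edge
  have h := Finset.card_eq_sum_card_fiberwise (f := S.edge) (s := Finset.univ) (t := Finset.univ)
    (fun _ _ => Finset.mem_coe.2 (Finset.mem_univ _))
  rw [Nat.card_eq_fintype_card, Nat.card_eq_fintype_card, ← Finset.card_univ (α := F), h,
    Finset.sum_const_nat (m := 4), Finset.card_univ, mul_comm]
  intro e _
  obtain ⟨y, rfl⟩ := edge_surjective e
  have : (Finset.univ.filter fun x => S.edge x = S.edge y)
      = {y, S.τ₀ y, S.τ₂ y, S.τ₀ (S.τ₂ y)} := by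
    ext x; simp [edge_eq_iff]
  have n1 := S.ne₀ y
  have n2 := S.ne₂ y
  have n3 := S.ne₀₂ y
  have n4 : S.τ₀ y ≠ S.τ₂ y := fun e => n3 (by rw [← e, S.inv₀])
  have n5 : S.τ₀ y ≠ S.τ₀ (S.τ₂ y) := fun e => n2 (by
    have := congrArg S.τ₀ e; rwa [S.inv₀, S.inv₀, eq_comm] at this)
  have n6 := S.ne₀ (S.τ₂ y)
  rw [this, Finset.card_insert_of_notMem, Finset.card_insert_of_notMem,
    Finset.card_insert_of_notMem, Finset.card_singleton]
  · simpa using n6.symm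
  · simpa using ⟨n4, n5⟩
  · simpa using ⟨n1.symm, n2.symm, n3.symm⟩

theorem sum_componentEulerChar [Finite F] : ∑ᶠ c, S.componentEulerChar c = S.eulerChar := by
  classical
  have := Fintype.ofFinite S.Component
  have aux : ∀ {V : Type _} [Finite V] (v : F → V) (_ : Function.Surjective v)
      (_ : ∀ x y, v x = v y → S.component x = S.component y),
      (∑ c, (Nat.card {w : V // ∃ x, v x = w ∧ S.component x = c} : ℤ)) = Nat.card V := by
    intro V _ v hv hc
    rw [← Nat.cast_sum, Nat.cast_inj, ← Nat.card_sigma]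
    refine Nat.card_congr ⟨fun p => p.2.1,
      fun w => ⟨S.component (hv w).choose, w, (hv w).choose, (hv w).choose_spec, rfl⟩, ?_, ?_⟩
    · rintro ⟨c, w, x, rfl, rfl⟩
      have := hc _ _ (hv (v x)).choose_spec
      exact Sigma.subtype_ext this rfl
    · intro w; rfl
  rw [finsum_eq_sum_of_fintype]
  simp only [componentEulerChar, Finset.sum_add_distrib, Finset.sum_sub_distrib, eulerChar]
  rw [aux S.vertex vertex_surjective fun x y h => eq_of_vertex_eq (S := S) _ S.component_τ₁
      S.component_τ₂ h,
    aux S.edge edge_surjective fun x y h => eq_of_edge_eq (S := S) _ S.component_τ₀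
      S.component_τ₂ h,
    aux S.face face_surjective fun x y h => eq_of_face_eq (S := S) _ S.component_τ₀
      S.component_τ₁ h]

theorem HasComponentsAndTotalGenus.eulerChar_eq [Finite F] {n g : ℕ}
    (h : S.HasComponentsAndTotalGenus n g) : S.eulerChar = 2 * (n : ℤ) - 2 * (g : ℤ) := by
  obtain ⟨-, hn, γ, hγ, hg⟩ := h
  have := Fintype.ofFinite S.Component
  rw [← sum_componentEulerChar, finsum_eq_sum_of_fintype, ← hg, ← hn, finsum_eq_sum_of_fintype]
  simp only [hγ, Finset.sum_sub_distrib, ← Finset.mul_sum]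
  rw [Finset.sum_const, Finset.card_univ, Nat.card_eq_fintype_card]
  push_cast
  ring

section Homology

variable (S) in
/-- The coboundary, with coefficients modulo 2. -/
noncomputable def coboundary : (S.Vertex → ZMod 2) →ₗ[ZMod 2] (S.Edge → ZMod 2) where
  toFun h e := h (S.vertex (edge_surjective e).choose) + h (S.vertex (S.τ₀ (edge_surjective e).choose))
  map_add' h h' := by ext; simp only [Pi.add_apply]; ring
  map_smul' r h := by ext; simp only [Pi.smul_apply, smul_eq_mul, RingHom.id_apply]; ring

theorem coboundary_edge (h : S.Vertex → ZMod 2) (x : F) :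
    S.coboundary h (S.edge x) = h (S.vertex x) + h (S.vertex (S.τ₀ x)) :=
  eq_of_edge_eq (S := S) (fun x => h (S.vertex x) + h (S.vertex (S.τ₀ x)))
    (fun x => by rw [S.inv₀, add_comm])
    (fun x => by rw [S.comm₀₂, vertex_τ₂, vertex_τ₂]) (edge_surjective (S.edge x)).choose_spec

variable (S) in
/-- The coboundary of the dual cell decomposition, with coefficients modulo 2. -/
noncomputable def dualCoboundary : (S.Face → ZMod 2) →ₗ[ZMod 2] (S.Edge → ZMod 2) where
  toFun h e := h (S.face (edge_surjective e).choose) + h (S.face (S.τ₂ (edge_surjective e).choose))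
  map_add' h h' := by ext; simp only [Pi.add_apply]; ring
  map_smul' r h := by ext; simp only [Pi.smul_apply, smul_eq_mul, RingHom.id_apply]; ring

theorem dualCoboundary_edge (h : S.Face → ZMod 2) (x : F) :
    S.dualCoboundary h (S.edge x) = h (S.face x) + h (S.face (S.τ₂ x)) :=
  eq_of_edge_eq (S := S) (fun x => h (S.face x) + h (S.face (S.τ₂ x)))
    (fun x => by rw [← S.comm₀₂, face_τ₀, face_τ₀])
    (fun x => by rw [S.inv₂, add_comm]) (edge_surjective (S.edge x)).choose_spec

theorem eq_of_add_eq_zero_mod_two {a b : ZMod 2} (h : a + b = 0) : b = a :=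
  (CharTwo.add_eq_zero.1 h).symm

theorem finrank_le_one_of_constant {V : Type*} [Nonempty V] (W : Submodule (ZMod 2) (V → ZMod 2))
    (hW : ∀ h ∈ W, ∀ u v, h u = h v) : Module.finrank (ZMod 2) W ≤ 1 := by
  classical
  by_cases hbot : W = ⊥
  · rw [hbot, finrank_bot]; exact Nat.zero_le _
  obtain ⟨w, hw, hw0⟩ := (Submodule.ne_bot_iff W).1 hbot
  refine finrank_le_one ⟨w, hw⟩ fun w' => ?_
  obtain ⟨v⟩ := ‹Nonempty V›
  have hwv : w v ≠ 0 := fun e => hw0 (funext fun u => (hW w hw u v).trans e)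
  refine ⟨w'.1 v * (w v)⁻¹, Subtype.ext (funext fun u => ?_)⟩
  simp only [SetLike.mk_smul_mk, Pi.smul_apply, smul_eq_mul]
  rw [hW w hw u v, hW w'.1 w'.2 u v, mul_assoc, inv_mul_cancel₀ hwv, mul_one]

-- An edge carries two positively oriented flags, `y` and `S.τ₀ (S.τ₂ y)`, one on each of its two
-- sides. This turns a sum over edges into a sum along the oriented boundaries of faces.
open Classical in
theorem sum_mul_dualCoboundary [Fintype F] [Fintype S.Edge] {o : F → Bool} (ho : S.IsOrientation o)
    (c : S.Edge → ZMod 2) (a : S.Face → ZMod 2) :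
    ∑ e, S.dualCoboundary a e * c e =
      ∑ x : F with o x = true, a (S.face x) * c (S.edge x) := by
  rw [← Finset.sum_fiberwise_of_maps_to (g := S.edge) (t := Finset.univ)
    (fun _ _ => Finset.mem_univ _)]
  refine Finset.sum_congr rfl fun e _ => ?_
  obtain ⟨y, rfl, hy⟩ : ∃ y, S.edge y = e ∧ o y = true := by
    obtain ⟨y, rfl⟩ := edge_surjective e
    cases h : o y
    · exact ⟨S.τ₀ y, edge_τ₀ .., by rw [ho.flip₀, h]; rfl⟩
    · exact ⟨y, rfl, h⟩
  have : ((Finset.univ.filter fun x => o x = true).filter fun x => S.edge x = S.edge y)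
      = {y, S.τ₀ (S.τ₂ y)} := by
    ext x
    simp only [Finset.mem_filter, Finset.mem_univ, true_and, edge_eq_iff, Finset.mem_insert,
      Finset.mem_singleton]
    constructor
    · rintro ⟨h, rfl | rfl | rfl | rfl⟩
      · exact .inl rfl
      · rw [ho.flip₀, hy] at h; cases h
      · rw [ho.flip₂, hy] at h; cases h
      · exact .inr rfl
    · rintro (rfl | rfl)
      · exact ⟨hy, .inl rfl⟩
      · exact ⟨by rw [ho.flip₀, ho.flip₂, hy]; rfl, .inr (.inr (.inr rfl))⟩
  rw [this, Finset.sum_pair (S.ne₀₂ y).symm, dualCoboundary_edge, face_τ₀, edge_τ₀, edge_τ₂]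
  ring

-- The boundary of a face is a closed walk: `τ₀ ∘ τ₁` permutes the positively oriented flags and
-- matches the first vertex of each side with the last vertex of a neighbouring side, so everything
-- cancels modulo 2.
open Classical in
theorem sum_dualCoboundary_mul_coboundary [Fintype F] [Fintype S.Edge] {o : F → Bool}
    (ho : S.IsOrientation o) (h : S.Vertex → ZMod 2) (a : S.Face → ZMod 2) :
    ∑ e, S.dualCoboundary a e * S.coboundary h e = 0 := by
  rw [sum_mul_dualCoboundary ho]
  simp only [coboundary_edge, mul_add, Finset.sum_add_distrib]
  rw [CharTwo.add_eq_zero]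
  refine Finset.sum_bij' (fun x _ => S.τ₀ (S.τ₁ x)) (fun x _ => S.τ₁ (S.τ₀ x)) ?_ ?_ ?_ ?_ ?_
  · intro x hx; simpa [ho.flip₀, ho.flip₁] using hx
  · intro x hx; simpa [ho.flip₀, ho.flip₁] using hx
  · intro x _; simp [S.inv₀, S.inv₁]
  · intro x _; simp [S.inv₀, S.inv₁]
  · intro x _; rw [face_τ₀, face_τ₁, S.inv₀, vertex_τ₁]

variable [Finite F]

/-- On a connected surface the kernel of the coboundary contains constants only. -/
theorem card_vertex_le_finrank_range (hS : S.Connected) :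
    Nat.card S.Vertex ≤ Module.finrank (ZMod 2) (LinearMap.range S.coboundary) + 1 := by
  have := Fintype.ofFinite S.Vertex
  obtain ⟨x₀⟩ := hS.nonempty
  have : Nonempty S.Vertex := ⟨S.vertex x₀⟩
  have h := LinearMap.finrank_range_add_finrank_ker S.coboundary
  have h1 := finrank_le_one_of_constant (LinearMap.ker S.coboundary) fun h hh u v => by
    obtain ⟨x, rfl⟩ := vertex_surjective u
    obtain ⟨y, rfl⟩ := vertex_surjective v
    refine hS.eq_of_invariant (fun x => h (S.vertex x)) (fun x => ?_) (fun x => by rw [vertex_τ₁])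
      (fun x => by rw [vertex_τ₂]) x y
    exact eq_of_add_eq_zero_mod_two (by rw [← coboundary_edge, LinearMap.mem_ker.1 hh]; rfl)
  rw [Module.finrank_pi, ← Nat.card_eq_fintype_card] at h
  omega

theorem card_face_le_finrank_range (hS : S.Connected) :
    Nat.card S.Face ≤ Module.finrank (ZMod 2) (LinearMap.range S.dualCoboundary) + 1 := by
  have := Fintype.ofFinite S.Face
  obtain ⟨x₀⟩ := hS.nonempty
  have : Nonempty S.Face := ⟨S.face x₀⟩
  have h := LinearMap.finrank_range_add_finrank_ker S.dualCoboundary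
  have h1 := finrank_le_one_of_constant (LinearMap.ker S.dualCoboundary) fun h hh u v => by
    obtain ⟨x, rfl⟩ := face_surjective u
    obtain ⟨y, rfl⟩ := face_surjective v
    refine hS.eq_of_invariant (fun x => h (S.face x)) (fun x => by rw [face_τ₀])
      (fun x => by rw [face_τ₁]) (fun x => ?_) x y
    exact eq_of_add_eq_zero_mod_two (by rw [← dualCoboundary_edge, LinearMap.mem_ker.1 hh]; rfl)
  rw [Module.finrank_pi, ← Nat.card_eq_fintype_card] at h
  omega

open Classical in
theorem finrank_orthogonal_dualCoboundary [Fintype S.Edge] :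
    Module.finrank (ZMod 2) (LinearMap.range S.dualCoboundary) +
      Module.finrank (ZMod 2) (LinearMap.BilinForm.orthogonal
        (dotProductBilin (ZMod 2) (ZMod 2)) (LinearMap.range S.dualCoboundary)) =
      Nat.card S.Edge := by
  have h := LinearMap.BilinForm.finrank_add_finrank_orthogonal'
    (B := dotProductBilin (m := S.Edge) (A := ZMod 2) (ZMod 2) (ZMod 2))
    (LinearMap.range S.dualCoboundary)
  have hker : LinearMap.ker (dotProductBilin (m := S.Edge) (A := ZMod 2) (ZMod 2) (ZMod 2)) = ⊥ := by
    refine LinearMap.ker_eq_bot'.2 fun v hv => funext fun e => ?_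
    have := LinearMap.congr_fun hv (Pi.single e 1)
    simpa [dotProductBilin] using this
  rw [hker, inf_bot_eq, finrank_bot, add_zero, Module.finrank_pi,
    ← Nat.card_eq_fintype_card] at h
  exact h

open Classical in
theorem range_coboundary_le [Fintype S.Edge] {o : F → Bool} (ho : S.IsOrientation o) :
    LinearMap.range S.coboundary ≤ LinearMap.BilinForm.orthogonal
        (dotProductBilin (ZMod 2) (ZMod 2)) (LinearMap.range S.dualCoboundary) := by
  have := Fintype.ofFinite F
  rintro _ ⟨h, rfl⟩ _ ⟨a, rfl⟩
  exact sum_dualCoboundary_mul_coboundary ho h a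

/-- The genus of a closed connected oriented surface is not negative. -/
theorem eulerChar_le_two (hS : S.Connected) (hor : S.Orientable) : S.eulerChar ≤ 2 := by
  obtain ⟨o, ho⟩ := hor.exists_isOrientation
  have := Fintype.ofFinite S.Edge
  have h1 := card_vertex_le_finrank_range hS
  have h2 := card_face_le_finrank_range hS
  have h3 := finrank_orthogonal_dualCoboundary (S := S)
  have h4 := Submodule.finrank_mono (range_coboundary_le ho)
  rw [eulerChar]
  omega

open Classical in
/-- On a sphere every closed cochain is a coboundary. -/
theorem exists_coboundary_eq [Fintype F] (hS : S.Connected) (hχ : S.eulerChar = 2) {o : F → Bool}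
    (ho : S.IsOrientation o) (c : S.Edge → ZMod 2)
    (hc : ∀ a : S.Face → ZMod 2, ∑ x : F with o x = true, a (S.face x) * c (S.edge x) = 0) :
    ∃ h, S.coboundary h = c := by
  have := Fintype.ofFinite S.Edge
  have h1 := card_vertex_le_finrank_range hS
  have h2 := card_face_le_finrank_range hS
  have h3 := finrank_orthogonal_dualCoboundary (S := S)
  have h4 := Submodule.eq_of_le_of_finrank_le (range_coboundary_le ho)
    (by rw [eulerChar] at hχ; omega)
  have hc' : c ∈ LinearMap.range S.coboundary := by
    rw [h4]
    rintro _ ⟨a, rfl⟩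
    exact (sum_mul_dualCoboundary ho c a).trans (hc a)
  exact hc'

/-- A system of closed curves on a sphere, given by chords of the faces, separates it into regions
that can be coloured with two colours. -/
theorem exists_cut_of_chords (hS : S.Connected) (hχ : S.eulerChar = 2) {o : F → Bool}
    (ho : S.IsOrientation o) (L : Set F) (κ : F → F) (h₀ : ∀ x ∈ L, S.τ₀ x ∈ L)
    (h₂ : ∀ x ∈ L, S.τ₂ x ∈ L) (hκL : ∀ x ∈ L, κ x ∈ L) (hκκ : ∀ x ∈ L, κ (κ x) = x)
    (hκτ : ∀ x ∈ L, κ (S.τ₀ x) = S.τ₀ (κ x)) (hκ : ∀ x ∈ L, S.IsChord o x (κ x)) :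
    ∃ s, S.IsCut L s ∧ ∀ u, s (S.τ₂ u) = s u := by
  classical
  have := Fintype.ofFinite F
  have hL : ∀ x, ((edge_surjective (S.edge x)).choose ∈ L) = (x ∈ L) := fun x =>
    eq_of_edge_eq (S := S) (fun u => u ∈ L)
      (fun u => propext ⟨fun h => by simpa [S.inv₀] using h₀ _ h, h₀ u⟩)
      (fun u => propext ⟨fun h => by simpa [S.inv₂] using h₂ _ h, h₂ u⟩)
      (edge_surjective (S.edge x)).choose_spec
  obtain ⟨h, hh⟩ := exists_coboundary_eq hS hχ ho
    (fun e => if (edge_surjective e).choose ∈ L then 1 else 0) (fun a => by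
      simp only [hL, mul_ite, mul_one, mul_zero]
      rw [← Finset.sum_filter]
      -- The cochain is closed because the sides of a face crossed by `L` are paired by the arcs.
      -- The flag `κ x` has the opposite orientation, and `τ₀` corrects this.
      refine Finset.sum_involution (fun x _ => S.τ₀ (κ x)) ?_ ?_ ?_ ?_
      · intro x hx
        have hx := (Finset.mem_filter.1 hx).2
        rw [face_τ₀, (hκ x hx).face_eq]; exact CharTwo.add_self_eq_zero _
      · intro x hx _ e
        have hx := (Finset.mem_filter.1 hx).2
        exact (hκ x hx).ne (by rw [← e, S.inv₀, e])
      · intro x hx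
        obtain ⟨hx1, hx⟩ := Finset.mem_filter.1 hx
        refine Finset.mem_filter.2 ⟨?_, h₀ _ (hκL x hx)⟩
        simpa [ho.flip₀, (hκ x hx).flip] using hx1
      · intro x hx
        have hx := (Finset.mem_filter.1 hx).2
        rw [hκτ _ (hκL x hx), S.inv₀, hκκ x hx])
  have hx : ∀ x, h (S.vertex x) + h (S.vertex (S.τ₀ x)) = if x ∈ L then 1 else 0 := fun x => by
    rw [← coboundary_edge, hh]; simp only [hL]
  have key : ∀ a b : ZMod 2, (a + b = 1 → (decide (b = 0) = !decide (a = 0))) ∧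
      (a + b = 0 → decide (b = 0) = decide (a = 0)) := by decide
  -- The curves avoid the vertices, so a flag takes the colour of its vertex, and the colour changes
  -- along exactly those edges that `L` crosses.
  refine ⟨fun x => decide (h (S.vertex x) = 0), ⟨fun u => by rw [vertex_τ₁], fun u hu => ?_,
    fun u hu => ?_⟩, fun u => by simp only [vertex_τ₂]⟩
  · exact (key _ _).1 ((hx u).trans (if_pos hu))
  · exact (key _ _).2 ((hx u).trans (if_neg hu))

end Homology

end CellSurface

/-! ### Systems of arcs, their crossings, and double lines -/

theorem CellSurface.IsChord.eq_of_samePiece {F : Type*} [Finite F] {S : CellSurface F}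
    {o : F → Bool} {a b u : F} (ho : S.IsOrientation o) (h : S.IsChord o a b)
    (hu : u ∈ S.chord a b) (hs : S.SamePiece (S.chord a b) a u) : u = a ∨ u = b := by
  have hn := h.not_samePiece ho
  rcases hu with rfl | rfl | rfl | rfl
  · exact .inl rfl
  · exact absurd hs hn
  · exact .inr rfl
  · exact absurd (hs.trans (h.samePiece_τ₀ ho).symm) hn

namespace PairedArcs

variable {F : Type*} {D : PairedArcs F} {o : F → Bool} {x y z u : F}

variable (D) in
/-- The arcs are chords of the faces of an oriented surface. -/
structure IsChordSystem (o : F → Bool) : Prop where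
  orient : D.IsOrientation o
  double_τ₀ : ∀ x ∈ D.double, D.τ₀ x ∈ D.double
  double_κ : ∀ x ∈ D.double, D.κ x ∈ D.double
  κ_κ : ∀ x ∈ D.double, D.κ (D.κ x) = x
  κ_τ₀ : ∀ x ∈ D.double, D.κ (D.τ₀ x) = D.τ₀ (D.κ x)
  chord : ∀ x ∈ D.double, D.IsChord o x (D.κ x)

theorem mem_arc : u ∈ D.arc x ↔ u = x ∨ u = D.τ₀ x ∨ u = D.κ x ∨ u = D.τ₀ (D.κ x) := Iff.rfl

theorem self_mem_arc : x ∈ D.arc x := .inl rfl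

namespace IsChordSystem

variable (h : D.IsChordSystem o)
include h

theorem arc_τ₀ (hx : x ∈ D.double) : D.arc (D.τ₀ x) = D.arc x := by
  ext u; simp only [mem_arc, h.κ_τ₀ x hx, D.inv₀]; tauto

theorem arc_κ (hx : x ∈ D.double) : D.arc (D.κ x) = D.arc x := by
  ext u; simp only [mem_arc, h.κ_κ x hx]; tauto

theorem arc_eq (hx : x ∈ D.double) (hy : y ∈ D.arc x) : D.arc y = D.arc x := by
  rcases hy with rfl | rfl | rfl | rfl
  · rfl
  · exact h.arc_τ₀ hx
  · exact h.arc_κ hx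
  · rw [h.arc_τ₀ (h.double_κ x hx), h.arc_κ hx]

theorem arc_comm (hx : x ∈ D.double) (hy : y ∈ D.arc x) : x ∈ D.arc y := by
  rw [h.arc_eq hx hy]; exact self_mem_arc

theorem arc_subset (hx : x ∈ D.double) : D.arc x ⊆ D.double := by
  rintro y (rfl | rfl | rfl | rfl)
  · exact hx
  · exact h.double_τ₀ _ hx
  · exact h.double_κ _ hx
  · exact h.double_τ₀ _ (h.double_κ _ hx)

theorem face_eq_of_mem_arc (hx : x ∈ D.double) (hy : y ∈ D.arc x) : D.face y = D.face x := by
  rcases hy with rfl | rfl | rfl | rfl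
  · rfl
  · exact D.face_τ₀ _
  · exact (h.chord x hx).face_eq
  · exact (D.face_τ₀ _).trans (h.chord x hx).face_eq

theorem κ_mem_arc (hx : x ∈ D.double) (hy : y ∈ D.arc x) : D.κ y ∈ D.arc x := by
  rw [← h.arc_eq hx hy]; exact .inr (.inr (.inl rfl))

variable [Finite F]

theorem exists_cut (hx : x ∈ D.double) :
    ∃ p, D.IsCut (D.arc x) p ∧ p x = true ∧ ∀ u, p u = true → D.face u = D.face x :=
  (h.chord x hx).exists_cut h.orient

theorem cut_κ_eq {p : F → Bool} (hx : x ∈ D.double) (hp : D.IsCut (D.arc x) p) :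
    ∀ u ∈ D.arc x, p (D.κ u) = p u := by
  have e : p x = p (D.κ x) := hp.eq_of_samePiece ((h.chord x hx).samePiece h.orient)
  have j := hp.jump
  rintro u (rfl | rfl | rfl | rfl)
  · exact e.symm
  · rw [h.κ_τ₀ x hx, j _ (.inr (.inr (.inl rfl))), j _ (.inl rfl), e]
  · rw [h.κ_κ x hx, e]
  · rw [h.κ_τ₀ _ (h.double_κ x hx), h.κ_κ x hx, j _ (.inr (.inr (.inl rfl))), j _ (.inl rfl), e]

/-- Any cut function along the arc of `x` decides what crosses it, so later `p` may be chosen or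
constructed to suit the situation. -/
theorem crosses_iff {p : F → Bool} (hx : x ∈ D.double) (hy : y ∈ D.double)
    (hp : D.IsCut (D.arc x) p) :
    D.Crosses x y ↔ D.face x = D.face y ∧ p y ≠ p (D.κ y) := by
  constructor
  · rintro ⟨-, -, hf, -, hs⟩
    refine ⟨hf, fun e => hs ?_⟩
    exact (hp.samePiece_iff h.orient (h.chord x hx) hf.symm
      ((h.chord y hy).face_eq.trans hf.symm)).2 e
  · rintro ⟨hf, hne⟩
    exact ⟨hx, hy, hf, fun e => hne (h.cut_κ_eq hx hp y e).symm, fun e => hne (hp.eq_of_samePiece e)⟩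

theorem crosses_symm (hc : D.Crosses x y) : D.Crosses y x := by
  obtain ⟨hx, hy, hf, hyx, -⟩ := id hc
  obtain ⟨p, hp, -, -⟩ := h.exists_cut hx
  obtain ⟨q, hq, -, -⟩ := h.exists_cut hy
  have hxy : x ∉ D.arc y := fun e => hyx (h.arc_comm hy e)
  refine (h.crosses_iff hy hx hq).2 ⟨hf.symm, ?_⟩
  refine hp.separates_symm hq hyx hxy (fun e => hxy ?_) ((h.crosses_iff hx hy hp).1 hc).2
  simpa only [h.κ_κ x hx] using h.κ_mem_arc hy e

omit [Finite F] in
theorem crosses_left (hy : y ∈ D.arc x) (hc : D.Crosses x z) : D.Crosses y z := by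
  obtain ⟨h1, h2, h3, h4, h5⟩ := hc
  rw [← h.arc_eq h1 hy] at h4 h5
  exact ⟨h.arc_subset h1 hy, h2, (h.face_eq_of_mem_arc h1 hy).trans h3, h4, h5⟩

theorem crosses_right (hz : z ∈ D.arc y) (hc : D.Crosses x y) : D.Crosses x z :=
  h.crosses_symm (h.crosses_left hz (h.crosses_symm hc))

end IsChordSystem

end PairedArcs

namespace StandardComplex

variable {F : Type*} {K : StandardComplex F} {o : F → Bool} {L : Set F} {x y u : F}

theorem isChordSystem [Finite F] (ho : K.IsOrientation o) : K.IsChordSystem o where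
  orient := ho
  double_τ₀ := K.double_τ₀
  double_κ := K.double_κ
  κ_κ := K.κ_κ
  κ_τ₀ := K.κ_τ₀
  chord x hx := CellSurface.IsChord.of_samePiece ho (K.κ_side x hx) (K.κ_ne x hx).1 (K.κ_ne x hx).2

namespace IsDoubleLine

theorem nonempty (hL : K.IsDoubleLine L) : L.Nonempty := by
  obtain ⟨x, -, rfl⟩ := hL
  exact ⟨x, Relation.EqvGen.refl x⟩

theorem τ₀_mem (hL : K.IsDoubleLine L) (hx : x ∈ L) : K.τ₀ x ∈ L := by
  obtain ⟨a, -, rfl⟩ := hL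
  exact Relation.EqvGen.trans _ _ _ hx (Relation.EqvGen.rel _ _ (.inl rfl))

theorem τ₂_mem (hL : K.IsDoubleLine L) (hx : x ∈ L) : K.τ₂ x ∈ L := by
  obtain ⟨a, -, rfl⟩ := hL
  exact Relation.EqvGen.trans _ _ _ hx (Relation.EqvGen.rel _ _ (.inr (.inl rfl)))

theorem subset (hL : K.IsDoubleLine L) : L ⊆ K.double := by
  obtain ⟨a, ha, rfl⟩ := hL
  intro y hy
  have : a ∈ K.double ↔ y ∈ K.double := by
    clear ha
    induction hy with
    | rel u v huv =>
      rcases huv with rfl | rfl | ⟨hu, rfl | rfl⟩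
      · exact ⟨K.double_τ₀ u, fun h => K.inv₀ u ▸ K.double_τ₀ _ h⟩
      · exact ⟨K.double_τ₂ u, fun h => K.inv₂ u ▸ K.double_τ₂ _ h⟩
      · exact iff_of_true hu (K.double_κ u hu)
      · exact iff_of_true hu (K.double_π u hu)
    | refl => rfl
    | symm _ _ _ ih => exact ih.symm
    | trans _ _ _ _ _ ih ih' => exact ih.trans ih'
  exact this.1 ha

theorem κ_mem (hL : K.IsDoubleLine L) (hx : x ∈ L) : K.κ x ∈ L := by
  have hd := hL.subset hx
  obtain ⟨a, -, rfl⟩ := hL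
  exact Relation.EqvGen.trans _ _ _ hx (Relation.EqvGen.rel _ _ (.inr (.inr ⟨hd, .inl rfl⟩)))

theorem π_mem (hL : K.IsDoubleLine L) (hx : x ∈ L) : K.π x ∈ L := by
  have hd := hL.subset hx
  obtain ⟨a, -, rfl⟩ := hL
  exact Relation.EqvGen.trans _ _ _ hx (Relation.EqvGen.rel _ _ (.inr (.inr ⟨hd, .inr rfl⟩)))

/-- A double line is a single class under the four moves, so a quantity preserved by each of them
along the line is constant on it. This turns local alternatives, such as whether the gluing reverses
the orientation, into global ones. -/
theorem eq_of_invariant (hL : K.IsDoubleLine L) {α : Type*} (f : F → α)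
    (h₀ : ∀ u ∈ L, f (K.τ₀ u) = f u) (h₂ : ∀ u ∈ L, f (K.τ₂ u) = f u)
    (hκ : ∀ u ∈ L, f (K.κ u) = f u) (hπ : ∀ u ∈ L, f (K.π u) = f u)
    (hx : x ∈ L) (hy : y ∈ L) : f x = f y := by
  have hL' := hL
  obtain ⟨a, -, rfl⟩ := hL'
  have key : ∀ u v, Relation.EqvGen
      (fun u v => v = K.τ₀ u ∨ v = K.τ₂ u ∨ (u ∈ K.double ∧ (v = K.κ u ∨ v = K.π u))) u v →
      Relation.EqvGen
      (fun u v => v = K.τ₀ u ∨ v = K.τ₂ u ∨ (u ∈ K.double ∧ (v = K.κ u ∨ v = K.π u))) a u →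
      f u = f v := by
    intro u v huv
    induction huv with
    | rel u v huv =>
      intro hu
      rcases huv with rfl | rfl | ⟨-, rfl | rfl⟩
      · exact (h₀ u hu).symm
      · exact (h₂ u hu).symm
      · exact (hκ u hu).symm
      · exact (hπ u hu).symm
    | refl => exact fun _ => rfl
    | symm _ _ h ih => exact fun hu => (ih (Relation.EqvGen.trans _ _ _ hu h.symm)).symm
    | trans _ _ _ h _ ih ih' => exact fun hu => (ih hu).trans (ih' (Relation.EqvGen.trans _ _ _ hu h))
  exact (key a x hx (Relation.EqvGen.refl a)).symm.trans (key a y hy (Relation.EqvGen.refl a))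

end IsDoubleLine

theorem mem_arc_of_face_eq (hp : K.PassesTriplePointsOnce L) (hf : K.IsFineAlong L) (hx : x ∈ L)
    (hy : y ∈ L) (h : K.face y = K.face x) : y ∈ K.arc x :=
  (hf x hx y hy h.symm).resolve_right (hp x hx y hy)

end StandardComplex

/-! ### Counting faces: the Euler characteristic under smoothing -/

theorem Finset.card_image_congr_ker {α β γ : Type*} [DecidableEq β] [DecidableEq γ] (s : Finset α)
    (f : α → β) (g : α → γ) (h : ∀ x ∈ s, ∀ y ∈ s, f x = f y ↔ g x = g y) :
    (s.image f).card = (s.image g).card := by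
  have h1 : s.image f = (s.image fun x => (f x, g x)).image Prod.fst := by
    rw [Finset.image_image]; rfl
  have h2 : s.image g = (s.image fun x => (f x, g x)).image Prod.snd := by
    rw [Finset.image_image]; rfl
  have key : ∀ a ∈ s.image (fun x => (f x, g x)), ∀ b ∈ s.image (fun x => (f x, g x)),
      a.1 = b.1 ↔ a.2 = b.2 := by
    intro a ha b hb
    obtain ⟨x, hx, rfl⟩ := Finset.mem_image.1 ha
    obtain ⟨y, hy, rfl⟩ := Finset.mem_image.1 hb
    exact h x hx y hy
  rw [h1, h2, Finset.card_image_of_injOn fun a ha b hb e => Prod.ext e ((key a ha b hb).1 e),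
    Finset.card_image_of_injOn fun a ha b hb e => Prod.ext ((key a ha b hb).2 e) e]

/-- A finite set with a free action of the Klein four-group. -/
theorem four_dvd_card {α : Type*} [DecidableEq α] (s : Finset α) (f g : α → α)
    (hf : ∀ x ∈ s, f x ∈ s) (hg : ∀ x ∈ s, g x ∈ s) (hff : ∀ x ∈ s, f (f x) = x)
    (hgg : ∀ x ∈ s, g (g x) = x) (hfg : ∀ x ∈ s, f (g x) = g (f x)) (hfx : ∀ x ∈ s, f x ≠ x)
    (hgx : ∀ x ∈ s, g x ≠ x) (hfgx : ∀ x ∈ s, f x ≠ g x) : 4 ∣ s.card := by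
  let c : α → Finset α := fun x => {x, f x, g x, f (g x)}
  have hc : ∀ x ∈ s, ∀ y ∈ s, c y = c x ↔ y ∈ c x := by
    intro x hx y hy
    refine ⟨fun e => e ▸ by simp [c], fun h => ?_⟩
    have h1 := hf x hx
    have h2 := hg x hx
    simp only [c, Finset.mem_insert, Finset.mem_singleton] at h
    ext u
    rcases h with rfl | rfl | rfl | rfl
    · rfl
    · simp only [c, Finset.mem_insert, Finset.mem_singleton, hff x hx, ← hfg x hx, hff _ h2]; tauto
    · simp only [c, Finset.mem_insert, Finset.mem_singleton, hgg x hx]; tauto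
    · simp only [c, Finset.mem_insert, Finset.mem_singleton, hff _ h2, ← hfg _ h2, hgg x hx,
        hff x hx]
      tauto
  rw [Finset.card_eq_sum_card_image c s]
  refine Finset.dvd_sum fun t ht => ?_
  obtain ⟨x, hx, rfl⟩ := Finset.mem_image.1 ht
  have : s.filter (fun y => c y = c x) = c x := by
    ext y
    rw [Finset.mem_filter]
    refine ⟨fun h => (hc x hx y h.1).1 h.2, fun h => ?_⟩
    have hy : y ∈ s := by
      simp only [c, Finset.mem_insert, Finset.mem_singleton] at h
      rcases h with rfl | rfl | rfl | rfl
      · exact hx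
      · exact hf x hx
      · exact hg x hx
      · exact hf _ (hg x hx)
    exact ⟨hy, (hc x hx y hy).2 h⟩
  rw [this]
  have n1 := hfx x hx
  have n2 := hgx x hx
  have n3 := hfgx x hx
  have n4 : f (g x) ≠ x := fun e => n3 (by rw [← hff _ (hg x hx), e])
  have n5 : f (g x) ≠ f x := fun e => n2 (by rw [← hff _ (hg x hx), e, hff x hx])
  have n6 := hfx _ (hg x hx)
  rw [Finset.card_insert_of_notMem, Finset.card_insert_of_notMem, Finset.card_insert_of_notMem,
    Finset.card_singleton]
  · simpa using n6.symm
  · simpa using ⟨n3, n5.symm⟩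
  · simpa using ⟨n1.symm, n2.symm, n4.symm⟩

namespace CellSurface

variable {F : Type*} {S S' : CellSurface F}

open Classical in
theorem card_face_eq_add [Fintype F] (L : Finset F) : Nat.card S.Face =
    ((Finset.univ.filter fun x => ∀ l ∈ L, S.face l ≠ S.face x).image S.face).card +
      (L.image S.face).card := by
  have := Fintype.ofFinite S.Face
  rw [← Finset.card_union_of_disjoint, Nat.card_eq_fintype_card, ← Finset.card_univ]
  · congr 1
    ext f
    obtain ⟨x, rfl⟩ := face_surjective f
    simp only [Finset.mem_univ, Finset.mem_union, Finset.mem_image, Finset.mem_filter, true_and,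
      true_iff]
    by_cases h : ∃ l ∈ L, S.face l = S.face x
    · exact .inr h
    · push Not at h
      exact .inl ⟨x, h, rfl⟩
  · rw [Finset.disjoint_left]
    rintro f hf hf'
    obtain ⟨x, hx, rfl⟩ := Finset.mem_image.1 hf
    obtain ⟨l, hl, e⟩ := Finset.mem_image.1 hf'
    exact (Finset.mem_filter.1 hx).2 l hl e

/-- On a face without flags of `L` the two surfaces have the same involutions, and the new `τ₀`
cannot enter it from outside, as it preserves `L`. -/
theorem face_eq_iff_of_forall_ne {L : Set F} (h₁ : S'.τ₁ = S.τ₁) (h₀ : ∀ x ∉ L, S'.τ₀ x = S.τ₀ x)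
    (hL' : ∀ x ∈ L, S'.τ₀ x ∈ L) {x : F} (hx : ∀ l ∈ L, S.face l ≠ S.face x) (y : F) :
    S.face y = S.face x ↔ S'.face y = S'.face x := by
  have hx' : ∀ u, S.face u = S.face x → u ∉ L := fun u hu hl => hx u hl hu
  constructor
  · intro h
    refine (eq_of_face_eq (S := S) (fun u => S.face u = S.face x → S'.face u = S'.face x)
      (fun u => ?_) (fun u => ?_) h).mpr (fun _ => rfl) h
    · rw [face_τ₀]
      refine forall_congr fun hu => ?_
      rw [← h₀ u (hx' u hu), face_τ₀]
    · rw [face_τ₁, ← h₁, face_τ₁]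
  · intro h
    refine (eq_of_face_eq (S := S') (fun u => S.face u = S.face x)
      (fun u => propext ⟨fun hu => ?_, fun hu => ?_⟩) (fun u => ?_) h).mpr rfl
    · have : u ∉ L := fun hl => hx' _ hu (hL' u hl)
      rwa [h₀ u this, face_τ₀] at hu
    · rwa [h₀ u (hx' u hu), face_τ₀]
    · rw [h₁, face_τ₁]

open Classical in
theorem card_image_face_filter_eq [Fintype F] {L : Finset F} (h₁ : S'.τ₁ = S.τ₁)
    (h₀ : ∀ x ∉ L, S'.τ₀ x = S.τ₀ x) (hL : ∀ x ∈ L, S.τ₀ x ∈ L) (hL' : ∀ x ∈ L, S'.τ₀ x ∈ L) :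
    ((Finset.univ.filter fun x => ∀ l ∈ L, S.face l ≠ S.face x).image S.face).card =
      ((Finset.univ.filter fun x => ∀ l ∈ L, S'.face l ≠ S'.face x).image S'.face).card := by
  have key : ∀ x, (∀ l ∈ L, S.face l ≠ S.face x) → ∀ y,
      S.face y = S.face x ↔ S'.face y = S'.face x := fun x hx =>
    face_eq_iff_of_forall_ne (L := ↑L) h₁ (by simpa using h₀) (by simpa using hL') (by simpa using hx)
  have key' : ∀ x, (∀ l ∈ L, S'.face l ≠ S'.face x) → ∀ y,
      S'.face y = S'.face x ↔ S.face y = S.face x := fun x hx =>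
    face_eq_iff_of_forall_ne (L := ↑L) h₁.symm (by simpa using fun x hx => (h₀ x hx).symm)
      (by simpa using hL) (by simpa using hx)
  have e : (Finset.univ.filter fun x => ∀ l ∈ L, S.face l ≠ S.face x) =
      Finset.univ.filter fun x => ∀ l ∈ L, S'.face l ≠ S'.face x := by
    ext x
    simp only [Finset.mem_filter, Finset.mem_univ, true_and]
    exact ⟨fun h l hl e => h l hl ((key x h l).2 e), fun h l hl e => h l hl ((key' x h l).2 e)⟩
  rw [← e]
  refine Finset.card_image_congr_ker _ _ _ fun x _ y hy => ?_
  exact key y (Finset.mem_filter.1 hy).2 x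

end CellSurface

namespace StandardComplex

variable {F : Type*} {K K' : StandardComplex F} {o : F → Bool} {L : Set F} {x y u : F}

namespace IsSmoothing

theorem τ₀_mem (hs : K.IsSmoothing L K') (hx : x ∈ L) : K'.τ₀ x ∈ L := by
  have := hs.isDoubleLine.π_mem hx
  rcases hs.τ₀_on x hx with e | e <;> rw [e]
  · exact this
  · exact hs.isDoubleLine.τ₀_mem this

theorem τ₀_ne (hs : K.IsSmoothing L K') (hx : x ∈ L) :
    K'.τ₀ x ≠ K.τ₀ x := by
  have h := K.π_ne x (hs.isDoubleLine.subset hx)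
  simp only [Set.mem_insert_iff, Set.mem_singleton_iff, not_or] at h
  rcases hs.τ₀_on x hx with e | e <;> rw [e]
  · exact h.2.1
  · intro e'
    exact h.1 (by rw [← K.inv₀ (K.π x), e', K.inv₀])

/-- If one half of an edge is glued to one half of the pasted edge, then, `K'.τ₀` being injective,
the remaining halves are glued to each other. -/
theorem τ₀_τ₀ (hs : K.IsSmoothing L K') (hx : x ∈ L) :
    K'.τ₀ (K.τ₀ x) = K.τ₀ (K'.τ₀ x) := by
  have hx' := hs.isDoubleLine.τ₀_mem hx
  have hne : K'.τ₀ (K.τ₀ x) ≠ K'.τ₀ x := fun e => K.ne₀ x (by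
    have := congrArg K'.τ₀ e; rwa [K'.inv₀, K'.inv₀] at this)
  have hπ := K.π_τ₀ x (hs.isDoubleLine.subset hx)
  have h1 := hs.τ₀_on x hx
  have h2 := hs.τ₀_on _ hx'
  rw [hπ, K.inv₀] at h2
  rcases h1 with e | e <;> rcases h2 with e' | e' <;> rw [e, e'] at hne ⊢
  · exact absurd rfl hne
  · exact absurd rfl hne
  · exact (K.inv₀ _).symm

theorem vertex_eq (hs : K.IsSmoothing L K') : K'.Vertex = K.Vertex := by
  simp only [CellSurface.Vertex, hs.τ₁_eq, hs.τ₂_eq]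

-- The half of the face of `x` between `x` and `K.κ x` meets `L` at these two ends only, so the
-- regluing leaves it in one piece.
open CellSurface in
theorem face_κ (hs : K.IsSmoothing L K') (hp : K.PassesTriplePointsOnce L)
    (hf : K.IsFineAlong L) (hx : x ∈ L) : K'.face (K.κ x) = K'.face x := by
  have hside := K.κ_side x (hs.isDoubleLine.subset hx)
  refine ((hside.eq_of_invariant
    (fun u => K.face u = K.face x → K'.face u = K'.face x) (fun u => ?_) (fun u hu => ?_)).mp
      (fun _ => rfl)) hside.face_eq.symm
  · rw [face_τ₁, ← hs.τ₁_eq, face_τ₁]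
  · rw [face_τ₀]
    refine forall_congr fun hux => ?_
    have : u ∉ L := fun hul => hu (mem_arc_of_face_eq hp hf hx hul hux)
    rw [← hs.τ₀_off u this, face_τ₀]

open Classical in
theorem card_face_add [Fintype F] (hs : K.IsSmoothing L K') :
    Nat.card K'.Face + (L.toFinset.image K.face).card =
      Nat.card K.Face + (L.toFinset.image K'.face).card := by
  have hL := hs.isDoubleLine
  rw [CellSurface.card_face_eq_add (S := K.toCellSurface) L.toFinset,
    CellSurface.card_face_eq_add (S := K'.toCellSurface) L.toFinset,
    CellSurface.card_image_face_filter_eq (S := K.toCellSurface) (S' := K'.toCellSurface) hs.τ₁_eq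
      (by simpa using hs.τ₀_off) (by simpa using fun x => hL.τ₀_mem)
      (by simpa using fun x => hs.τ₀_mem)]
  omega

theorem card_vertex_eq (hs : K.IsSmoothing L K') : Nat.card K'.Vertex = Nat.card K.Vertex := by
  rw [hs.vertex_eq]

variable [Finite F]

-- The halves of faces bounded by the arcs at `x` and at `K'.τ₀ x` together form a set closed under
-- the new involutions: `K'.τ₀` exchanges their ends because it commutes with `K.κ` on `L`. So a new
-- face contains at most four flags of `L`.
open CellSurface in
theorem mem_of_face_eq (hs : K.IsSmoothing L K') (hp : K.PassesTriplePointsOnce L)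
    (hf : K.IsFineAlong L) (ho : K.IsOrientation o) (hx : x ∈ L) (hy : y ∈ L)
    (h : K'.face y = K'.face x) :
    y = x ∨ y = K.κ x ∨ y = K'.τ₀ x ∨ y = K.κ (K'.τ₀ x) := by
  have hL := hs.isDoubleLine
  have hC := isChordSystem ho
  have hm := hs.τ₀_mem hx
  have hxd := hL.subset hx
  have hmd := hL.subset hm
  have harc : ∀ {a}, a ∈ L → K.arc a ⊆ L := by
    rintro a ha u (rfl | rfl | rfl | rfl)
    · exact ha
    · exact hL.τ₀_mem ha
    · exact hL.κ_mem ha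
    · exact hL.τ₀_mem (hL.κ_mem ha)
  have hend : ∀ {a u}, a ∈ L → u ∈ L → K.SamePiece (K.arc a) a u → u = a ∨ u = K.κ a :=
    fun {a u} ha hu hau => (hC.chord a (hL.subset ha)).eq_of_samePiece ho
      (mem_arc_of_face_eq hp hf ha hu hau.face_eq.symm) hau
  have hκ : ∀ {a}, a ∈ L → K.SamePiece (K.arc a) a (K.κ a) := fun {a} ha =>
    K.κ_side a (hL.subset ha)
  let R : F → Prop := fun u =>
    K.SamePiece (K.arc x) x u ∨ K.SamePiece (K.arc (K'.τ₀ x)) (K'.τ₀ x) u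
  have hR : ∀ u, R u → R (K'.τ₀ u) := by
    intro u hu
    by_cases hul : u ∈ L
    · rcases hu with hu | hu <;> rcases hend (by assumption) hul hu with rfl | rfl
      · exact .inr (SamePiece.refl _)
      · rw [hs.τ₀_continuous x hx]; exact .inr (hκ hm)
      · rw [K'.inv₀]; exact .inl (SamePiece.refl _)
      · rw [hs.τ₀_continuous _ hm, K'.inv₀]; exact .inl (hκ hx)
    · rw [hs.τ₀_off u hul]
      exact hu.imp (·.trans (SamePiece.step_τ₀ fun e => hul (harc hx e)))
        (·.trans (SamePiece.step_τ₀ fun e => hul (harc hm e)))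
  have hR1 : ∀ u, R u → R (K'.τ₁ u) := by
    intro u hu
    rw [hs.τ₁_eq]
    exact hu.imp (·.trans (SamePiece.step_τ₁ _)) (·.trans (SamePiece.step_τ₁ _))
  have hRy : R y := (eq_of_face_eq (S := K'.toCellSurface) R
    (fun u => propext ⟨fun hu => K'.inv₀ u ▸ hR _ hu, hR u⟩)
    (fun u => propext ⟨fun hu => K'.inv₁ u ▸ hR1 _ hu, hR1 u⟩) h).mpr (.inl (SamePiece.refl _))
  rcases hRy with hy' | hy'
  · exact (hend hx hy hy').imp_right .inl
  · exact .inr (.inr (hend hm hy hy'))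

-- A face met by `L` contains exactly one arc of `L`, with four distinct end flags.
open Classical in
theorem four_mul_card_image_face [Fintype F] (hL : K.IsDoubleLine L)
    (hp : K.PassesTriplePointsOnce L) (hf : K.IsFineAlong L) (ho : K.IsOrientation o) :
    4 * (L.toFinset.image K.face).card = L.toFinset.card := by
  rw [Finset.card_eq_sum_card_image K.face, Finset.sum_const_nat (m := 4), mul_comm]
  intro f hf'
  obtain ⟨x, hx, rfl⟩ := Finset.mem_image.1 hf'
  rw [Set.mem_toFinset] at hx
  have hC := isChordSystem ho
  have hxd := hL.subset hx
  have hch := hC.chord x hxd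
  have : L.toFinset.filter (fun y => K.face y = K.face x) = {x, K.τ₀ x, K.κ x, K.τ₀ (K.κ x)} := by
    ext y
    simp only [Finset.mem_filter, Set.mem_toFinset, Finset.mem_insert, Finset.mem_singleton]
    constructor
    · rintro ⟨hy, e⟩
      exact mem_arc_of_face_eq hp hf hx hy e
    · intro h
      refine ⟨?_, hC.face_eq_of_mem_arc hxd h⟩
      rcases h with rfl | rfl | rfl | rfl
      · exact hx
      · exact hL.τ₀_mem hx
      · exact hL.κ_mem hx
      · exact hL.τ₀_mem (hL.κ_mem hx)
  have n1 := K.ne₀ x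
  have n2 := hch.ne'
  have n3 : x ≠ K.τ₀ (K.κ x) := fun e => hch.ne (by conv_rhs => rw [e, K.inv₀])
  have n4 := hch.ne
  have n5 : K.τ₀ x ≠ K.τ₀ (K.κ x) := fun e => n2 (by rw [← K.inv₀ (K.κ x), ← e, K.inv₀])
  have n6 := K.ne₀ (K.κ x)
  rw [this, Finset.card_insert_of_notMem, Finset.card_insert_of_notMem,
    Finset.card_insert_of_notMem, Finset.card_singleton]
  · simpa using n6.symm
  · simpa using ⟨n4.symm, n5⟩
  · simpa using ⟨n1.symm, n2.symm, n3⟩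

theorem card_edge_eq : Nat.card K'.Edge = Nat.card K.Edge := by
  have h := CellSurface.four_mul_card_edge (S := K.toCellSurface)
  have h' := CellSurface.four_mul_card_edge (S := K'.toCellSurface)
  omega

/-- Smoothing does not decrease the Euler characteristic. -/
theorem eulerChar_le (hs : K.IsSmoothing L K') (hp : K.PassesTriplePointsOnce L)
    (hf : K.IsFineAlong L) (ho : K.IsOrientation o) : K.eulerChar ≤ K'.eulerChar := by
  classical
  have := Fintype.ofFinite F
  have h1 := card_face_add hs
  have h2 := four_mul_card_image_face hs.isDoubleLine hp hf ho
  have h3 : L.toFinset.card ≤ 4 * (L.toFinset.image K'.face).card := by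
    refine Finset.card_le_mul_card_image _ _ fun f hf' => ?_
    obtain ⟨x, hx, rfl⟩ := Finset.mem_image.1 hf'
    rw [Set.mem_toFinset] at hx
    refine (Finset.card_le_card (t := {x, K.κ x, K'.τ₀ x, K.κ (K'.τ₀ x)}) fun y hy => ?_).trans
      Finset.card_le_four
    obtain ⟨hy, e⟩ := Finset.mem_filter.1 hy
    rw [Set.mem_toFinset] at hy
    simpa using hs.mem_of_face_eq hp hf ho hx hy e
  have h4 := hs.card_vertex_eq
  have h5 := card_edge_eq (K := K) (K' := K')
  rw [CellSurface.eulerChar, CellSurface.eulerChar]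
  omega

open Classical in
/-- A smoothing turns an even number of cusps into pairs of faces. -/
theorem eight_dvd_card_split [Fintype F] (hs : K.IsSmoothing L K') (ho : K.IsOrientation o) :
    8 ∣ (L.toFinset.filter fun x => K'.τ₀ x = K.κ x).card := by
  have hL := hs.isDoubleLine
  have hC := isChordSystem ho
  by_cases hne : ∃ l ∈ L, K'.τ₀ l = K.κ l
  swap
  · push Not at hne
    rw [Finset.filter_false_of_mem fun x hx => hne x (Set.mem_toFinset.1 hx)]
    simp
  obtain ⟨l, hl, hlκ⟩ := hne
  -- At `l` the gluing reverses the orientation, because `K.κ` does. Whether it does so is constant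
  -- along the line.
  have hflip : ∀ x ∈ L, o (K'.τ₀ x) = !o x := by
    intro x hx
    have key := hL.eq_of_invariant (fun x => xor (o (K'.τ₀ x)) (o x)) (fun u hu => ?_)
      (fun u hu => ?_) (fun u hu => ?_) (fun u hu => ?_) hx hl
    · simp only [hlκ, (hC.chord l (hL.subset hl)).flip] at key
      revert key
      cases o (K'.τ₀ x) <;> cases o x <;> simp
    · simp only [hs.τ₀_τ₀ hu, ho.flip₀]; simp
    · have : K'.τ₀ (K.τ₂ u) = K.τ₂ (K'.τ₀ u) := by rw [← hs.τ₂_eq, K'.comm₀₂]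
      simp only [this, ho.flip₂]; simp
    · simp only [hs.τ₀_continuous u hu, (hC.chord _ (hL.subset hu)).flip,
        (hC.chord _ (hL.subset (hs.τ₀_mem hu))).flip]
      simp
    · rcases hs.τ₀_on u hu with e | e
      · simp only [← e, K'.inv₀]; rw [Bool.xor_comm]
      · have e' : K.π u = K.τ₀ (K'.τ₀ u) := by rw [e, K.inv₀]
        simp only [e', hs.τ₀_τ₀ (hs.τ₀_mem hu), K'.inv₀, ho.flip₀]
        cases o (K'.τ₀ u) <;> cases o u <;> rfl
  have pp : ∀ x ∈ L, K.τ₀ (K'.τ₀ (K.τ₀ (K'.τ₀ x))) = x := fun x hx => by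
    rw [hs.τ₀_τ₀ (hs.τ₀_mem hx), K'.inv₀, K.inv₀]
  have pne : ∀ x ∈ L, K.τ₀ (K'.τ₀ x) ≠ x := fun x hx e =>
    hs.τ₀_ne hx (by conv_rhs => rw [← e, K.inv₀])
  -- On the positively oriented flags of `L`, the maps `K.τ₀ ∘ K.τ₂` and `K.τ₀ ∘ K'.τ₀` generate a
  -- free Klein four-group. By `hflip` the second preserves the orientation.
  have h1 : 4 ∣ (L.toFinset.filter fun x => o x = true).card := by
    refine four_dvd_card _ (fun x => K.τ₀ (K.τ₂ x)) (fun x => K.τ₀ (K'.τ₀ x)) ?_ ?_ ?_ ?_ ?_ ?_ ?_ ?_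
    all_goals
      intro x hx
      obtain ⟨hx, hox⟩ := Finset.mem_filter.1 hx
      rw [Set.mem_toFinset] at hx
    · simpa [ho.flip₀, ho.flip₂, hox] using hL.τ₀_mem (hL.τ₂_mem hx)
    · simpa [ho.flip₀, hflip x hx, hox] using hL.τ₀_mem (hs.τ₀_mem hx)
    · rw [K.comm₀₂, K.inv₀, K.inv₂]
    · exact pp x hx
    · rw [hs.τ₀_τ₀ (hL.τ₂_mem hx), K.inv₀, ← K.comm₀₂, K.inv₀, ← hs.τ₂_eq, K'.comm₀₂]
    · exact K.ne₀₂ x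
    · exact pne x hx
    · intro e
      have : K.τ₂ x = K'.τ₀ x := by rw [← K.inv₀ (K.τ₂ x), e, K.inv₀]
      exact K'.ne₀₂ x (by rw [hs.τ₂_eq, this, K'.inv₀])
  -- Here the group is generated by `K.τ₀ ∘ K.κ` and `K.τ₀ ∘ K'.τ₀`. These two coincide exactly at
  -- the flags left out, so the action is free.
  have h2 : 4 ∣ ((L.toFinset.filter fun x => o x = true).filter
      fun x => ¬ K'.τ₀ x = K.κ x).card := by
    refine four_dvd_card _ (fun x => K.τ₀ (K.κ x)) (fun x => K.τ₀ (K'.τ₀ x)) ?_ ?_ ?_ ?_ ?_ ?_ ?_ ?_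
    all_goals
      intro x hx
      obtain ⟨hx, hxκ⟩ := Finset.mem_filter.1 hx
      obtain ⟨hx, hox⟩ := Finset.mem_filter.1 hx
      rw [Set.mem_toFinset] at hx
      have hxd := hL.subset hx
      have hκd := K.double_κ x hxd
      have hκL := hL.κ_mem hx
      have hpL := hs.τ₀_mem hx
    · have : ¬ K'.τ₀ (K.τ₀ (K.κ x)) = K.κ (K.τ₀ (K.κ x)) := fun e => hxκ (by
        rw [hs.τ₀_τ₀ hκL, K.κ_τ₀ _ hκd, K.κ_κ x hxd, hs.τ₀_continuous x hx] at e
        have := congrArg K.τ₀ e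
        rw [K.inv₀, K.inv₀] at this
        exact (K.κ_κ _ (hL.subset hpL)).symm.trans (congrArg K.κ this))
      simpa [ho.flip₀, (hC.chord x hxd).flip, hox, this] using hL.τ₀_mem hκL
    · have : ¬ K'.τ₀ (K.τ₀ (K'.τ₀ x)) = K.κ (K.τ₀ (K'.τ₀ x)) := fun e => hxκ (by
        rw [hs.τ₀_τ₀ hpL, K'.inv₀, K.κ_τ₀ _ (hL.subset hpL)] at e
        have := congrArg K.τ₀ e
        rw [K.inv₀, K.inv₀] at this
        exact (K.κ_κ _ (hL.subset hpL)).symm.trans (congrArg K.κ this.symm))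
      simpa [ho.flip₀, hflip x hx, hox, this] using hL.τ₀_mem hpL
    · rw [K.κ_τ₀ _ hκd, K.κ_κ x hxd, K.inv₀]
    · exact pp x hx
    · rw [hs.τ₀_τ₀ hκL, K.inv₀, K.κ_τ₀ _ (hL.subset hpL), K.inv₀, hs.τ₀_continuous x hx]
    · exact fun e => (K.κ_ne x hxd).2 (by conv_rhs => rw [← e, K.inv₀])
    · exact pne x hx
    · exact fun e => hxκ (by rw [← K.inv₀ (K.κ x), e, K.inv₀])
  have h3 := Finset.card_filter_add_card_filter_not (s := L.toFinset.filter fun x => o x = true)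
    fun x => K'.τ₀ x = K.κ x
  have h4 := Finset.card_filter_add_card_filter_not
    (s := L.toFinset.filter fun x => K'.τ₀ x = K.κ x) fun x => o x = true
  have h5 : ((L.toFinset.filter fun x => K'.τ₀ x = K.κ x).filter fun x => ¬ o x = true).card =
      ((L.toFinset.filter fun x => K'.τ₀ x = K.κ x).filter fun x => o x = true).card := by
    have hm : ∀ x, x ∈ L → K'.τ₀ x = K.κ x → K'.τ₀ (K.τ₀ x) = K.κ (K.τ₀ x) := fun x hx e => by
      rw [hs.τ₀_τ₀ hx, e, K.κ_τ₀ x (hL.subset hx)]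
    refine Finset.card_bij' (fun x _ => K.τ₀ x) (fun x _ => K.τ₀ x) ?_ ?_ ?_ ?_
    all_goals
      intro x hx
      obtain ⟨hx, hox⟩ := Finset.mem_filter.1 hx
      obtain ⟨hx, hxκ⟩ := Finset.mem_filter.1 hx
      rw [Set.mem_toFinset] at hx
    · simpa [ho.flip₀, hm x hx hxκ, hL.τ₀_mem hx] using hox
    · simpa [ho.flip₀, hm x hx hxκ, hL.τ₀_mem hx] using hox
    · exact K.inv₀ x
    · exact K.inv₀ x
  have h6 : ((L.toFinset.filter fun x => o x = true).filter fun x => K'.τ₀ x = K.κ x) =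
      (L.toFinset.filter fun x => K'.τ₀ x = K.κ x).filter fun x => o x = true :=
    Finset.filter_comm _ _ _
  rw [h6] at h3
  omega

/-- Smoothing a double line of an oriented surface changes the Euler characteristic by an even
number. -/
theorem even_eulerChar_sub (hs : K.IsSmoothing L K') (hp : K.PassesTriplePointsOnce L)
    (hf : K.IsFineAlong L) (ho : K.IsOrientation o) : Even (K'.eulerChar - K.eulerChar) := by
  classical
  have := Fintype.ofFinite F
  have hL := hs.isDoubleLine
  have hC := isChordSystem ho
  have h1 := card_face_add hs
  have h2 := four_mul_card_image_face hs.isDoubleLine hp hf ho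
  have h4 := hs.card_vertex_eq
  have h5 := card_edge_eq (K := K) (K' := K')
  have h8 := hs.eight_dvd_card_split ho
  have hadd := Finset.card_filter_add_card_filter_not (s := L.toFinset) fun x => K'.τ₀ x = K.κ x
  have hmem : ∀ {x y}, x ∈ L → y ∈ L → (K'.face y = K'.face x ↔
      y = x ∨ y = K.κ x ∨ y = K'.τ₀ x ∨ y = K.κ (K'.τ₀ x)) := by
    intro x y hx hy
    refine ⟨hs.mem_of_face_eq hp hf ho hx hy, ?_⟩
    rintro (rfl | rfl | rfl | rfl)
    · rfl
    · exact hs.face_κ hp hf hx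
    · exact K'.face_τ₀ x
    · exact (hs.face_κ hp hf (hs.τ₀_mem hx)).trans (K'.face_τ₀ x)
  have hsplit : ∀ {x}, x ∈ L → K'.τ₀ x = K.κ x → ∀ y ∈ L, K'.face y = K'.face x →
      y = x ∨ y = K.κ x := by
    intro x hx e y hy hyx
    have := (hmem hx hy).1 hyx
    rw [e, K.κ_κ x (hL.subset hx)] at this
    tauto
  have hsplit' : ∀ {x}, x ∈ L → K'.τ₀ x = K.κ x → ∀ y ∈ L, K'.face y = K'.face x →
      K'.τ₀ y = K.κ y := by
    intro x hx e y hy hyx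
    rcases hsplit hx e y hy hyx with rfl | rfl
    · exact e
    · rw [hs.τ₀_continuous x hx, e]
  -- A new face meeting `L` contains two flags of `L` if they satisfy `K'.τ₀ x = K.κ x`, and four
  -- otherwise. Old faces meeting `L` contain four, so the gain in faces is a quarter of the number
  -- of flags of the first kind, which is even by `h8`.
  have hs2 : 2 * ((L.toFinset.filter fun x => K'.τ₀ x = K.κ x).image K'.face).card =
      (L.toFinset.filter fun x => K'.τ₀ x = K.κ x).card := by
    rw [Finset.card_eq_sum_card_image K'.face (L.toFinset.filter _),
      Finset.sum_const_nat (m := 2), mul_comm]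
    intro f hf'
    obtain ⟨x, hx, rfl⟩ := Finset.mem_image.1 hf'
    simp only [Finset.mem_filter, Set.mem_toFinset] at hx
    have : (L.toFinset.filter fun x => K'.τ₀ x = K.κ x).filter (fun y => K'.face y = K'.face x) =
        {x, K.κ x} := by
      ext y
      simp only [Finset.mem_filter, Set.mem_toFinset, Finset.mem_insert, Finset.mem_singleton]
      refine ⟨fun h => hsplit hx.1 hx.2 y h.1.1 h.2, fun h => ?_⟩
      have hy : y ∈ L := by
        rcases h with rfl | rfl
        · exact hx.1
        · exact hL.κ_mem hx.1
      have hyx := (hmem hx.1 hy).2 (h.imp_right .inl)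
      exact ⟨⟨hy, hsplit' hx.1 hx.2 y hy hyx⟩, hyx⟩
    rw [this, Finset.card_pair (hC.chord x (hL.subset hx.1)).ne'.symm]
  have hs4 : 4 * ((L.toFinset.filter fun x => ¬ K'.τ₀ x = K.κ x).image K'.face).card =
      (L.toFinset.filter fun x => ¬ K'.τ₀ x = K.κ x).card := by
    rw [Finset.card_eq_sum_card_image K'.face (L.toFinset.filter _),
      Finset.sum_const_nat (m := 4), mul_comm]
    intro f hf'
    obtain ⟨x, hx, rfl⟩ := Finset.mem_image.1 hf'
    simp only [Finset.mem_filter, Set.mem_toFinset] at hx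
    obtain ⟨hx, hxκ⟩ := hx
    have hpx := hs.τ₀_mem hx
    have : (L.toFinset.filter fun x => ¬ K'.τ₀ x = K.κ x).filter
        (fun y => K'.face y = K'.face x) = {x, K.κ x, K'.τ₀ x, K.κ (K'.τ₀ x)} := by
      ext y
      simp only [Finset.mem_filter, Set.mem_toFinset, Finset.mem_insert, Finset.mem_singleton]
      refine ⟨fun h => (hmem hx h.1.1).1 h.2, fun h => ?_⟩
      have hy : y ∈ L := by
        rcases h with rfl | rfl | rfl | rfl
        · exact hx
        · exact hL.κ_mem hx
        · exact hpx
        · exact hL.κ_mem hpx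
      have hyx := (hmem hx hy).2 h
      exact ⟨⟨hy, fun e => hxκ (hsplit' hy e x hx hyx.symm)⟩, hyx⟩
    have n1 := (hC.chord x (hL.subset hx)).ne'
    have n2 := K'.ne₀ x
    have n3 : K.κ (K'.τ₀ x) ≠ x := fun e => hxκ (by rw [← K.κ_κ _ (hL.subset hpx), e])
    have n4 : K.κ x ≠ K.κ (K'.τ₀ x) := fun e => n2 (by
      rw [← K.κ_κ _ (hL.subset hpx), ← e, K.κ_κ _ (hL.subset hx)])
    have n5 := (hC.chord _ (hL.subset hpx)).ne'
    rw [this, Finset.card_insert_of_notMem, Finset.card_insert_of_notMem,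
      Finset.card_insert_of_notMem, Finset.card_singleton]
    · simpa using n5.symm
    · simpa using ⟨Ne.symm hxκ, n4⟩
    · simpa using ⟨n1.symm, n2.symm, n3.symm⟩
  have himg : (L.toFinset.image K'.face).card =
      ((L.toFinset.filter fun x => K'.τ₀ x = K.κ x).image K'.face).card +
      ((L.toFinset.filter fun x => ¬ K'.τ₀ x = K.κ x).image K'.face).card := by
    rw [← Finset.card_union_of_disjoint, ← Finset.image_union, Finset.filter_union_filter_not_eq]
    rw [Finset.disjoint_left]
    rintro f hf1 hf2
    obtain ⟨x, hx, rfl⟩ := Finset.mem_image.1 hf1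
    obtain ⟨y, hy, e⟩ := Finset.mem_image.1 hf2
    simp only [Finset.mem_filter, Set.mem_toFinset] at hx hy
    exact hy.2 (hsplit' hx.1 hx.2 y hy.1 e)
  rw [CellSurface.eulerChar, CellSurface.eulerChar, h4, h5]
  rw [even_iff_two_dvd]
  omega

end IsSmoothing

theorem exists_isSurfaceKnot_of_isSmoothing [Finite F] {g : ℕ} (hK : K.IsSurfaceKnot g)
    (hs : K.IsSmoothing L K') (hp : K.PassesTriplePointsOnce L) (hf : K.IsFineAlong L)
    (hc : K'.Connected) (hor : K'.Orientable) : ∃ g' : ℕ, K'.IsSurfaceKnot g' ∧ g' ≤ g := by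
  obtain ⟨-, hKor, hχ⟩ := hK
  obtain ⟨o, ho⟩ := hKor.exists_isOrientation
  have h1 := hs.eulerChar_le hp hf ho
  have h2 := CellSurface.eulerChar_le_two hc hor
  obtain ⟨k, hk⟩ := hs.even_eulerChar_sub hp hf ho
  -- With χ(K') = χ(K) + 2k the genus is g − k. It is nonnegative by `h2`, so that `toNat` loses
  -- nothing, and `h1` gives k ≥ 0.
  refine ⟨(g - k).toNat, ⟨hc, hor, ?_⟩, ?_⟩ <;> omega

theorem genus_le_of_isSmoothing [Finite F] {n g n' g' : ℕ} (hK : K.IsSurfaceLink n g)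
    (hs : K.IsSmoothing L K') (hp : K.PassesTriplePointsOnce L) (hf : K.IsFineAlong L)
    (hK' : K'.IsSurfaceLink n' g') : (g' : ℤ) ≤ g + ((n' : ℤ) - n) := by
  obtain ⟨o, ho⟩ := CellSurface.Orientable.exists_isOrientation hK.1
  have h1 := hs.eulerChar_le hp hf ho
  have h2 := CellSurface.HasComponentsAndTotalGenus.eulerChar_eq hK
  have h3 := CellSurface.HasComponentsAndTotalGenus.eulerChar_eq hK'
  omega

end StandardComplex

/-! ### Regluing along a two-coloured line -/

/-- Both functions jump at the same places of the face, so their difference does not jump at all. -/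
theorem CellSurface.IsCut.xor_eq {F : Type*} {S : CellSurface F} {A B : Set F} {p q : F → Bool}
    {a u : F} (hp : S.IsCut A p) (hq : S.IsCut B q)
    (hAB : ∀ v, S.face v = S.face a → (v ∈ A ↔ v ∈ B)) (hu : S.face u = S.face a) :
    (p u ^^ q u) = (p a ^^ q a) := by
  refine (eq_of_face_eq (S := S) (fun u => S.face u = S.face a → (p u ^^ q u) = (p a ^^ q a))
    (fun v => ?_) (fun v => ?_) hu).mpr (fun _ => rfl) hu
  · rw [S.face_τ₀]
    refine forall_congr fun hv => ?_
    by_cases h : v ∈ A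
    · rw [hp.jump v h, hq.jump v ((hAB v hv).1 h)]; simp
    · rw [hp.off v h, hq.off v (mt (hAB v hv).2 h)]
  · rw [S.face_τ₁, hp.inv₁, hq.inv₁]

namespace StandardComplex

variable {F : Type*} {K : StandardComplex F} {o s : F → Bool} {L : Set F} {x y z l u v w : F}

theorem π_mem_arc (hx : x ∈ K.double) (hy : y ∈ K.arc x) : K.π y ∈ K.arc (K.π x) := by
  have h1 := K.π_κ x hx
  rcases hy with rfl | rfl | rfl | rfl
  · exact .inl rfl
  · rw [K.π_τ₀ _ hx]; exact .inr (.inl rfl)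
  · exact h1.elim (fun e => .inr (.inr (.inl e))) (fun e => .inr (.inr (.inr e)))
  · rw [K.π_τ₀ _ (K.double_κ x hx)]
    rcases h1 with e | e <;> rw [e]
    · exact .inr (.inr (.inr rfl))
    · rw [K.inv₀]; exact .inr (.inr (.inl rfl))

open Classical in
/-- The gluing along `L` that pastes regions of different colours `s`. -/
noncomputable def recolorτ₀ (K : StandardComplex F) (L : Set F) (s : F → Bool) (x : F) : F :=
  if x ∈ L then (if s (K.π x) = s x then K.τ₀ (K.π x) else K.π x) else K.τ₀ x

variable (K) in
/-- The function `s` colours the regions into which a double line `L` of an oriented complex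
separates the surface. -/
structure IsColoring (L : Set F) (o s : F → Bool) : Prop where
  line : K.IsDoubleLine L
  once : K.PassesTriplePointsOnce L
  fine : K.IsFineAlong L
  orient : K.IsOrientation o
  cut : K.IsCut L s
  inv₂ : ∀ u, s (K.τ₂ u) = s u

namespace IsColoring

variable (h : K.IsColoring L o s)

theorem recolor_off (_ : K.IsColoring L o s) (hx : x ∉ L) : K.recolorτ₀ L s x = K.τ₀ x := if_neg hx

theorem recolor_on (_ : K.IsColoring L o s) (hx : x ∈ L) :
    K.recolorτ₀ L s x = K.π x ∨ K.recolorτ₀ L s x = K.τ₀ (K.π x) := by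
  rw [recolorτ₀, if_pos hx]; split_ifs
  · exact .inr rfl
  · exact .inl rfl

include h

theorem color_recolor (hx : x ∈ L) : s (K.recolorτ₀ L s x) = !s x := by
  rw [recolorτ₀, if_pos hx]
  split_ifs with e
  · rw [h.cut.jump _ (h.line.π_mem hx), e]
  · revert e; cases s (K.π x) <;> cases s x <;> simp

/-- The two candidates are exchanged by `τ₀`, which changes the colour on `L`, so the colour singles
out one of them. The commutation and continuity properties of the gluing follow by comparing
colours. -/
theorem recolor_unique (hx : x ∈ L) (hy : y = K.π x ∨ y = K.τ₀ (K.π x)) (hs : s y = !s x) :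
    K.recolorτ₀ L s x = y := by
  have h1 := h.color_recolor hx
  have h2 := h.cut.jump _ (h.line.π_mem hx)
  rcases h.recolor_on hx with e | e <;> rcases hy with rfl | rfl <;> rw [e] at h1 ⊢
  · rw [h2, ← h1] at hs; simp at hs
  · rw [h2, hs] at h1; simp at h1

theorem recolor_mem (hx : x ∈ L) : K.recolorτ₀ L s x ∈ L := by
  have := h.line.π_mem hx
  rcases h.recolor_on hx with e | e <;> rw [e]
  · exact this
  · exact h.line.τ₀_mem this

theorem τ₀_mem_iff : K.τ₀ x ∈ L ↔ x ∈ L :=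
  ⟨fun hx => K.inv₀ x ▸ h.line.τ₀_mem hx, h.line.τ₀_mem⟩

theorem τ₂_mem_iff : K.τ₂ x ∈ L ↔ x ∈ L :=
  ⟨fun hx => K.inv₂ x ▸ h.line.τ₂_mem hx, h.line.τ₂_mem⟩

theorem recolor_inv : K.recolorτ₀ L s (K.recolorτ₀ L s x) = x := by
  by_cases hx : x ∈ L
  · have hd := h.line.subset hx
    refine h.recolor_unique (h.recolor_mem hx) ?_ (by rw [h.color_recolor hx, Bool.not_not])
    rcases h.recolor_on hx with e | e <;> rw [e]
    · exact .inl (K.π_π x hd).symm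
    · rw [K.π_τ₀ _ (K.double_π x hd), K.π_π x hd, K.inv₀]; exact .inr rfl
  · rw [h.recolor_off hx, h.recolor_off (mt h.τ₀_mem_iff.1 hx), K.inv₀]

theorem recolor_τ₂ : K.recolorτ₀ L s (K.τ₂ x) = K.τ₂ (K.recolorτ₀ L s x) := by
  by_cases hx : x ∈ L
  · refine h.recolor_unique (h.line.τ₂_mem hx) ?_ (by rw [h.inv₂, h.inv₂, h.color_recolor hx])
    rw [K.π_τ₂ x (h.line.subset hx)]
    rcases h.recolor_on hx with e | e <;> rw [e]
    · exact .inl rfl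
    · exact .inr (K.comm₀₂ _).symm
  · rw [h.recolor_off hx, h.recolor_off (mt h.τ₂_mem_iff.1 hx), K.comm₀₂]

theorem recolor_τ₀ (hx : x ∈ L) : K.recolorτ₀ L s (K.τ₀ x) = K.τ₀ (K.recolorτ₀ L s x) := by
  refine h.recolor_unique (h.line.τ₀_mem hx) ?_ (by
    rw [h.cut.jump _ (h.recolor_mem hx), h.cut.jump _ hx, h.color_recolor hx])
  rw [K.π_τ₀ x (h.line.subset hx), K.inv₀]
  rcases h.recolor_on hx with e | e <;> rw [e]
  · exact .inl rfl
  · exact .inr (K.inv₀ _)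

/-- The reglued surface. -/
noncomputable def surface : CellSurface F where
  τ₀ := K.recolorτ₀ L s
  τ₁ := K.τ₁
  τ₂ := K.τ₂
  inv₀ _ := h.recolor_inv
  inv₁ := K.inv₁
  inv₂ := K.inv₂
  ne₀ x e := by
    by_cases hx : x ∈ L
    · have := h.color_recolor hx
      rw [e] at this; simp at this
    · exact K.ne₀ x (by rwa [h.recolor_off hx] at e)
  ne₁ := K.ne₁
  ne₂ := K.ne₂
  comm₀₂ _ := h.recolor_τ₂
  ne₀₂ x e := by
    by_cases hx : x ∈ L
    · have := h.color_recolor (h.line.τ₂_mem hx)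
      rw [e, h.inv₂] at this; simp at this
    · exact K.ne₀₂ x (by rwa [h.recolor_off (mt h.τ₂_mem_iff.1 hx)] at e)

theorem face_surface_κ (hx : x ∈ L) : h.surface.face (K.κ x) = h.surface.face x := by
  have hside := K.κ_side x (h.line.subset hx)
  refine ((hside.eq_of_invariant
    (fun u => K.face u = K.face x → h.surface.face u = h.surface.face x) (fun u => ?_)
      (fun u hu => ?_)).mp (fun _ => rfl)) hside.face_eq.symm
  · rw [K.face_τ₁]
    exact forall_congr fun _ => congrArg (· = _) (h.surface.face_τ₁ u)
  · rw [K.face_τ₀]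
    refine forall_congr fun hux => ?_
    have : u ∉ L := fun hul => hu (mem_arc_of_face_eq h.once h.fine hx hul hux)
    rw [← h.recolor_off this]
    exact congrArg (· = _) (h.surface.face_τ₀ u)

/-- Let `f` be the indicator of a component of the reglued surface. Whether `f` jumps across `L` in
the old surface is constant along `L`. If it does not, `f` is constant, as `K` is connected. If it
does, `f ^^ s` is constant on `K`; but the gluing preserves `f` and changes `s`. -/
theorem connected_surface (hK : K.Connected) : h.surface.Connected := by
  classical
  obtain ⟨l₀, hl₀⟩ := h.line.nonempty
  rw [CellSurface.Connected, Nat.card_eq_one_iff_unique]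
  refine ⟨⟨fun c c' => ?_⟩, ⟨h.surface.component l₀⟩⟩
  have key : ∀ x, h.surface.component x = h.surface.component l₀ := by
    intro x
    let f : F → Bool := fun x => decide (h.surface.component x = h.surface.component l₀)
    have f₀ : ∀ x, f (K.recolorτ₀ L s x) = f x := fun x => by
      exact congrArg (fun c => decide (c = _)) (h.surface.component_τ₀ x)
    have f₁ : ∀ x, f (K.τ₁ x) = f x := fun x => by
      exact congrArg (fun c => decide (c = _)) (h.surface.component_τ₁ x)
    have f₂ : ∀ x, f (K.τ₂ x) = f x := fun x => by
      exact congrArg (fun c => decide (c = _)) (h.surface.component_τ₂ x)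
    suffices f x = f l₀ by simpa [f] using this
    have hL := h.line
    have hconst : ∀ x ∈ L, (f (K.τ₀ x) ^^ f x) = (f (K.τ₀ l₀) ^^ f l₀) := by
      have hrec : ∀ u ∈ L, (f (K.τ₀ (K.recolorτ₀ L s u)) ^^ f (K.recolorτ₀ L s u)) =
          (f (K.τ₀ u) ^^ f u) := fun u hu => by rw [← h.recolor_τ₀ hu, f₀, f₀]
      have hκ : ∀ u ∈ L, (f (K.τ₀ (K.κ u)) ^^ f (K.κ u)) = (f (K.τ₀ u) ^^ f u) := by
        intro u hu
        have hfκ : ∀ v ∈ L, f (K.κ v) = f v := fun v hv =>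
          CellSurface.eq_of_face_eq (S := h.surface) f f₀ f₁ (h.face_surface_κ hv)
        rw [← K.κ_τ₀ u (h.line.subset hu), hfκ _ (h.line.τ₀_mem hu), hfκ u hu]
      refine fun x hx => hL.eq_of_invariant (fun x => f (K.τ₀ x) ^^ f x) (fun u hu => ?_)
        (fun u hu => ?_) hκ (fun u hu => ?_) hx hl₀
      · simp only [K.inv₀]; rw [Bool.xor_comm]
      · simp only [K.comm₀₂, f₂]
      · rcases h.recolor_on hu with e | e
        · simp only [← e]; exact hrec u hu
        · have e' : K.π u = K.τ₀ (K.recolorτ₀ L s u) := by rw [e, K.inv₀]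
          simp only [e', K.inv₀, ← hrec u hu]; rw [Bool.xor_comm]
    have hoff : ∀ x ∉ L, f (K.τ₀ x) = f x := fun x hx => by rw [← h.recolor_off hx, f₀]
    by_cases hj : (f (K.τ₀ l₀) ^^ f l₀) = true
    · exfalso
      have key := hK.eq_of_invariant (S := K.toCellSurface) (fun x => f x ^^ s x) (fun x => ?_)
        (fun x => by simp only [f₁, h.cut.inv₁]) (fun x => by simp only [f₂, h.inv₂]) l₀
        (K.recolorτ₀ L s l₀)
      · simp [f₀, h.color_recolor hl₀] at key
      · by_cases hx : x ∈ L
        · have := (hconst x hx).trans hj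
          rw [h.cut.jump x hx]
          revert this
          cases f (K.τ₀ x) <;> cases f x <;> simp
        · simp only [hoff x hx, h.cut.off x hx]
    · refine hK.eq_of_invariant (S := K.toCellSurface) f (fun x => ?_) f₁ f₂ x l₀
      by_cases hx : x ∈ L
      · have := (hconst x hx).trans (Bool.eq_false_of_not_eq_true hj)
        revert this
        cases f (K.τ₀ x) <;> cases f x <;> simp
      · exact hoff x hx
  obtain ⟨x, rfl⟩ := CellSurface.component_surjective c
  obtain ⟨y, rfl⟩ := CellSurface.component_surjective c'
  rw [key x, key y]

theorem mem_of_mem_arc (hx : x ∈ L) (hy : y ∈ K.arc x) : y ∈ L := by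
  rcases hy with rfl | rfl | rfl | rfl
  · exact hx
  · exact h.line.τ₀_mem hx
  · exact h.line.κ_mem hx
  · exact h.line.τ₀_mem (h.line.κ_mem hx)

theorem mem_iff_mem_arc (hl : l ∈ L) (hu : K.face u = K.face l) : u ∈ L ↔ u ∈ K.arc l :=
  ⟨fun hul => mem_arc_of_face_eq h.once h.fine hl hul hu, h.mem_of_mem_arc hl⟩

variable [Finite F]

theorem chords : K.IsChordSystem o := isChordSystem h.orient

theorem color_κ (hx : x ∈ L) : s (K.κ x) = s x := by
  obtain ⟨p, hp, -⟩ := h.chords.exists_cut (h.line.subset hx)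
  have h1 := h.chords.cut_κ_eq (h.line.subset hx) hp x (.inl rfl)
  have h2 := hp.xor_eq h.cut (fun v hv => (h.mem_iff_mem_arc hx hv).symm)
    (h.chords.chord x (h.line.subset hx)).face_eq
  rw [h1] at h2
  simpa using h2

omit [Finite F] in
theorem color_const (hx : ∀ l ∈ L, K.face l ≠ K.face x) (hu : K.face u = K.face x) :
    s u = s x := by
  have : K.IsCut ∅ (fun _ => false) := ⟨fun _ => rfl, fun _ h => h.elim, fun _ _ => rfl⟩
  simpa using this.xor_eq h.cut (fun v hv => iff_of_false (Set.notMem_empty v)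
    fun hvl => hx v hvl hv) hu

omit [Finite F] in
theorem color_eq_iff {p : F → Bool} (hl : l ∈ L) (hp : K.IsCut (K.arc l) p)
    (hu : K.face u = K.face l) (hv : K.face v = K.face l) : s u = s v ↔ p u = p v := by
  have h1 := hp.xor_eq h.cut (fun v hv => (h.mem_iff_mem_arc hl hv).symm) hu
  have h2 := hp.xor_eq h.cut (fun v hv => (h.mem_iff_mem_arc hl hv).symm) hv
  have h3 := h1.trans h2.symm
  revert h3
  cases p u <;> cases p v <;> cases s u <;> cases s v <;> simp

/-- In a face met by `L`, the colouring is, up to exchange of colours, a cut function along the only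
arc of `L` there. -/
theorem crosses_iff (hl : l ∈ L) (hx : x ∈ K.double) :
    K.Crosses l x ↔ K.face l = K.face x ∧ s (K.κ x) ≠ s x := by
  obtain ⟨p, hp, -⟩ := h.chords.exists_cut (h.line.subset hl)
  rw [h.chords.crosses_iff (h.line.subset hl) hx hp]
  refine and_congr_right fun hf => ?_
  rw [Ne, Ne, h.color_eq_iff hl hp (((h.chords.chord x hx).face_eq).trans hf.symm) hf.symm,
    eq_comm]

/-- Of the two sides of the crossed arc, `l` is taken on that of `x`; its region is glued on at
`K.recolorτ₀ L s l`. -/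
theorem exists_crosses (hx : x ∈ K.double) (hs : s (K.κ x) ≠ s x) :
    ∃ l ∈ L, K.Crosses l x ∧ s l = s x := by
  by_cases hne : ∀ l ∈ L, K.face l ≠ K.face x
  · exact absurd (h.color_const hne (h.chords.chord x hx).face_eq) hs
  · push Not at hne
    obtain ⟨l, hl, hlx⟩ := hne
    by_cases e : s l = s x
    · exact ⟨l, hl, (h.crosses_iff hl hx).2 ⟨hlx, hs⟩, e⟩
    · refine ⟨K.τ₀ l, h.line.τ₀_mem hl,
        (h.crosses_iff (h.line.τ₀_mem hl) hx).2 ⟨(K.face_τ₀ l).trans hlx, hs⟩, ?_⟩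
      rw [h.cut.jump l hl]
      revert e
      cases s l <;> cases s x <;> simp

/-- The pieces of faces cut along `L` lie in faces of the reglued surface. -/
theorem face_surface_eq (hf : K.face u = K.face v) (hs : s u = s v) :
    h.surface.face u = h.surface.face v := by
  by_cases hne : ∀ l ∈ L, K.face l ≠ K.face v
  · exact (CellSurface.face_eq_iff_of_forall_ne (S := K.toCellSurface) (S' := h.surface) (L := L)
      rfl (fun _ => h.recolor_off) (fun _ => h.recolor_mem) hne u).1 hf
  · push Not at hne
    obtain ⟨l, hl, hlv⟩ := hne
    obtain ⟨p, hp, -⟩ := h.chords.exists_cut (h.line.subset hl)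
    have hside := (hp.samePiece_iff h.orient (h.chords.chord l (h.line.subset hl))
      (hf.trans hlv.symm) hlv.symm).2 ((h.color_eq_iff hl hp (hf.trans hlv.symm) hlv.symm).1 hs)
    refine ((hside.eq_of_invariant
      (fun w => K.face w = K.face l → h.surface.face u = h.surface.face w) (fun w => ?_)
        (fun w hw => ?_)).mp (fun _ => rfl)) hlv.symm
    · rw [K.face_τ₁]
      exact forall_congr fun _ => congrArg (_ = ·) (h.surface.face_τ₁ w)
    · rw [K.face_τ₀]
      refine forall_congr fun hwl => ?_
      rw [← h.recolor_off (mt (h.mem_iff_mem_arc hl hwl).1 hw)]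
      exact congrArg (_ = ·) (h.surface.face_τ₀ w)

theorem recolor_κ (hx : x ∈ L) : K.recolorτ₀ L s (K.κ x) = K.κ (K.recolorτ₀ L s x) := by
  have hd := h.line.subset hx
  refine h.recolor_unique (h.line.κ_mem hx) ?_
    (by rw [h.color_κ (h.recolor_mem hx), h.color_κ hx, h.color_recolor hx])
  rcases K.π_κ x hd with e | e <;> rcases h.recolor_on hx with e' | e' <;> rw [e, e']
  · exact .inl rfl
  · exact .inr (K.κ_τ₀ _ (K.double_π x hd))
  · rw [K.inv₀]; exact .inr rfl
  · exact .inl (K.κ_τ₀ _ (K.double_π x hd))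

/-- The reglued surface is oriented by an orientation that differs from the old one at most by its
change in the regions of one colour. -/
theorem exists_orientation : ∃ o', h.surface.IsOrientation o' ∧
    ∀ u v, s u = s v → (o' u ^^ o' v) = (o u ^^ o v) := by
  obtain ⟨l₀, hl₀⟩ := h.line.nonempty
  have hL := h.line
  let r := K.recolorτ₀ L s
  have hr : ∀ x ∈ L, (o (r x) ^^ o x) = (o (r l₀) ^^ o l₀) := by
    refine fun x hx => hL.eq_of_invariant (fun x => (o (r x) ^^ o x)) (fun u hu => ?_)
      (fun u hu => ?_) (fun u hu => ?_) (fun u hu => ?_) hx hl₀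
    · simp only [r, h.recolor_τ₀ hu, h.orient.flip₀]; simp
    · simp only [r, h.recolor_τ₂, h.orient.flip₂]; simp
    · simp only [r, h.recolor_κ hu, (h.chords.chord _ (hL.subset hu)).flip,
        (h.chords.chord _ (hL.subset (h.recolor_mem hu))).flip]
      simp
    · rcases h.recolor_on hu with e | e
      · simp only [r, ← e, h.recolor_inv]; rw [Bool.xor_comm]
      · have e' : K.π u = K.τ₀ (r u) := by simp only [r]; rw [e, K.inv₀]
        simp only [e', r, h.recolor_τ₀ (h.recolor_mem hu), h.recolor_inv, h.orient.flip₀]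
        rw [Bool.xor_comm]; simp
  have hoff : ∀ x ∉ L, r x = K.τ₀ x := fun x => h.recolor_off
  have hs : ∀ x ∈ L, s (r x) = !s x := fun x => h.color_recolor
  have h0 := h.orient.flip₀
  have h1 := h.orient.flip₁
  have h2 := h.orient.flip₂
  -- If the gluing reverses `o` along `L`, then `o` still orients. Otherwise it has to be reversed
  -- on the regions of one colour, which works because the gluing joins different colours.
  by_cases hb : (o (r l₀) ^^ o l₀) = true
  · refine ⟨o, ⟨fun x => ?_, h1, h2⟩, fun _ _ _ => rfl⟩
    change o (r x) = _
    by_cases hx : x ∈ L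
    · have := (hr x hx).trans hb
      revert this
      cases o (r x) <;> cases o x <;> simp
    · rw [hoff x hx, h0]
  · refine ⟨fun x => o x ^^ s x, ⟨fun x => ?_, fun x => ?_, fun x => ?_⟩, fun u v e => ?_⟩
    · change (o (r x) ^^ s (r x)) = _
      by_cases hx : x ∈ L
      · have := (hr x hx).trans (Bool.eq_false_of_not_eq_true hb)
        rw [hs x hx]
        revert this
        cases o (r x) <;> cases o x <;> simp
      · rw [hoff x hx, h0, h.cut.off x hx]; simp
    · change (o (K.τ₁ x) ^^ s (K.τ₁ x)) = _
      rw [h1, h.cut.inv₁]; simp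
    · change (o (K.τ₂ x) ^^ s (K.τ₂ x)) = _
      rw [h2, h.inv₂]; simp
    · simp only [e]; cases o u <;> cases o v <;> cases s v <;> rfl

end IsColoring

end StandardComplex

/-! ### Reconnecting arcs at the triple points on the line -/

namespace CellSurface.IsCut

variable {F : Type*} {S : CellSurface F} {p q : F → Bool} {a b c d : F}

/-- Two crossing chords divide a face into four pieces, and one of these is cut off by the chord
that joins the first ends of the two. -/
theorem quadrant (hp : S.IsCut (S.chord a b) p) (hq : S.IsCut (S.chord c d) q)
    (hdisj : ∀ u ∈ S.chord a b, u ∉ S.chord c d) (hpcd : p d ≠ p c) (hqab : q b ≠ q a) :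
    S.IsCut (S.chord a c) fun u => (p u == p c) && (q u == q a) := by
  have ma : a ∈ S.chord a b := .inl rfl
  have mb : b ∈ S.chord a b := .inr (.inr (.inl rfl))
  have mc : c ∈ S.chord c d := .inl rfl
  have md : d ∈ S.chord c d := .inr (.inr (.inl rfl))
  have hdisj' : ∀ u ∈ S.chord c d, u ∉ S.chord a b := fun u hu hu' => hdisj u hu' hu
  have qa := hq.off a (hdisj a ma)
  have qb := hq.off b (hdisj b mb)
  have pc := hp.off c (hdisj' c mc)
  have pd := hp.off d (hdisj' d md)
  have hpj := hp.jump
  have hqj := hq.jump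
  have hab : ∀ u ∈ S.chord a b, u ∉ S.chord a c → q u ≠ q a := by
    rintro u (rfl | rfl | rfl | rfl) hu
    · exact absurd (.inl rfl) hu
    · exact absurd (.inr (.inl rfl)) hu
    · exact hqab
    · rw [qb]; exact hqab
  have hcd : ∀ u ∈ S.chord c d, u ∉ S.chord a c → p u ≠ p c := by
    rintro u (rfl | rfl | rfl | rfl) hu
    · exact absurd (.inr (.inr (.inl rfl))) hu
    · exact absurd (.inr (.inr (.inr rfl))) hu
    · exact hpcd
    · rw [pd]; exact hpcd
  refine ⟨fun u => by simp [hp.inv₁, hq.inv₁], fun u hu => ?_, fun u hu => ?_⟩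
  · rcases hu with rfl | rfl | rfl | rfl <;> simp only [S.inv₀, qa, pc, hpj _ ma, hqj _ mc]
    · cases p u <;> cases p c <;> cases q u <;> rfl
    · cases p a <;> cases p c <;> cases q a <;> rfl
    · cases q u <;> cases q a <;> cases p u <;> rfl
    · cases q c <;> cases q a <;> cases p c <;> rfl
  · have hu' : S.τ₀ u ∉ S.chord a c := mt τ₀_mem_chord.1 hu
    by_cases h1 : u ∈ S.chord a b
    · have e1 := hab u h1 hu
      have e2 := hab _ (τ₀_mem_chord.2 h1) hu'
      simp only [beq_eq_false_iff_ne.2 e1, beq_eq_false_iff_ne.2 e2, Bool.and_false]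
    · by_cases h2 : u ∈ S.chord c d
      · have e1 := hcd u h2 hu
        have e2 := hcd _ (τ₀_mem_chord.2 h2) hu'
        simp only [beq_eq_false_iff_ne.2 e1, beq_eq_false_iff_ne.2 e2, Bool.false_and]
      · simp [hp.off u h1, hq.off u h2]

end CellSurface.IsCut

namespace PairedArcs.IsChordSystem

variable {F : Type*} [Finite F] {D : PairedArcs F} {o : F → Bool} {x y z u : F}

/-- Two crossing arcs lie on the same side of an arc that does not cross them. -/
theorem cut_eq_of_crosses (h : D.IsChordSystem o) {p : F → Bool} (hx : x ∈ D.double)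
    (hp : D.IsCut (D.arc x) p) (hyx : y ∉ D.arc x) (hf : D.face x = D.face y)
    (hxy : ¬ D.Crosses x y) (hxz : ¬ D.Crosses x z) (hyz : D.Crosses y z) : p y = p z := by
  obtain ⟨hy, hz, hfyz, -, -⟩ := id hyz
  obtain ⟨q, hq, -⟩ := h.exists_cut hy
  have hxy' : x ∉ D.arc y := fun e => hyx (h.arc_comm hy e)
  have hκx : D.κ x ∉ D.arc y := fun e => hxy' (by
    simpa only [h.κ_κ x hx] using h.κ_mem_arc hy e)
  have hκy : D.κ y ∉ D.arc x := fun e => hyx (by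
    simpa only [h.κ_κ y hy] using h.κ_mem_arc hx e)
  have hqκ : q (D.κ x) = q x := by
    by_contra hne
    exact hxy (h.crosses_symm ((h.crosses_iff hy hx hq).2 ⟨hf.symm, Ne.symm hne⟩))
  have hqx := hq.off x hxy'
  have hqκx := hq.off _ hκx
  have hq' : ∃ q', D.IsCut (D.arc y) q' ∧ q' x = false ∧ q' (D.τ₀ x) = false ∧
      q' (D.κ x) = false ∧ q' (D.τ₀ (D.κ x)) = false := by
    cases e : q x
    · exact ⟨q, hq, e, by rw [hqx, e], by rw [hqκ, e], by rw [hqκx, hqκ, e]⟩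
    · exact ⟨_, hq.not, by simp [e], by simp [hqx, e], by simp [hqκ, e], by simp [hqκx, hqκ, e]⟩
  obtain ⟨q', hq', e1, e2, e3, e4⟩ := hq'
  refine hp.eq_of_crossing (c := z) (d := D.κ z) hq' ?_ hyx hκy ?_ ?_ ?_
  · rintro u (rfl | rfl | rfl | rfl) <;> assumption
  · by_contra hne
    exact hxy ((h.crosses_iff hx hy hp).2 ⟨hf, hne⟩)
  · by_contra hne
    exact hxz ((h.crosses_iff hx hz hp).2 ⟨hf.trans hfyz, hne⟩)
  · exact fun r hr => ((h.crosses_iff hy hz hr).1 hyz).2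

end PairedArcs.IsChordSystem

namespace StandardComplex

variable {F : Type*} {K : StandardComplex F} {o o' s : F → Bool} {L : Set F} {x y z l u v w : F}

variable (K) in
/-- An oriented complex with a double line, the regions cut out by this line coloured by `s`, and
an orientation `o'` of the reglued surface. -/
structure IsRegluing (L : Set F) (o s o' : F → Bool) : Prop extends K.IsColoring L o s where
  orient' : toIsColoring.surface.IsOrientation o'
  orient_eq : ∀ u v, s u = s v → (o' u ^^ o' v) = (o u ^^ o v)

variable (K) in
/-- The arc of `x` crosses the double line `L` in a sheet. -/
def Bent (L : Set F) (x : F) : Prop := ∃ l ∈ L, K.Crosses l x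

variable (K) in
/-- The arc of `x` passes through a triple point on `L`. -/
def Affected (L : Set F) (x : F) : Prop := K.Bent L x ∨ K.Bent L (K.π x)

/-- The half of an arc that leads from `x` to a crossing with the line `L` is continued, after the
regluing, by the half that leads from the pasted crossing to `w`. -/
def Continues (K : StandardComplex F) (L : Set F) (s o' : F → Bool) (x w : F) : Prop :=
  ∃ l ∈ L, K.Crosses l x ∧ K.Crosses (K.π l) w ∧ s w = !s x ∧ o' w = !o' x

/-- The ends of an arc after the reconnection at a triple point on `L`. -/
def Mate (K : StandardComplex F) (L : Set F) (s o' : F → Bool) (x w : F) : Prop :=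
  K.Continues L s o' x w ∨ (x ∈ K.double ∧ w ∈ K.double ∧ o' w = (!o' x) ∧
    (K.Continues L s o' (K.π x) (K.π w) ∨ K.Continues L s o' (K.π x) (K.τ₀ (K.π w))))

namespace IsRegluing

variable [Finite F] (h : K.IsRegluing L o s o')
include h

omit [Finite F] in
theorem notMem_of_crosses (hl : l ∈ L) (hc : K.Crosses l x) : x ∉ L := fun hx => h.once l hl x hx hc

omit [Finite F] in
theorem flip_off (hx : x ∉ L) : o' (K.τ₀ x) = !o' x := by
  rw [← h.recolor_off hx]; exact h.orient'.flip₀ x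

theorem bent_iff (hx : x ∈ K.double) : K.Bent L x ↔ s (K.κ x) ≠ s x :=
  ⟨fun ⟨_, hl, hc⟩ => ((h.crosses_iff hl hx).1 hc).2, fun hs =>
    let ⟨l, hl, hc, _⟩ := h.exists_crosses hx hs
    ⟨l, hl, hc⟩⟩

theorem bent_of_mem_arc (hy : y ∈ K.arc x) (hx : K.Bent L x) : K.Bent L y :=
  let ⟨l, hl, hc⟩ := hx
  ⟨l, hl, h.chords.crosses_right hy hc⟩

theorem affected_of_mem_arc (hxd : x ∈ K.double) (hy : y ∈ K.arc x) (hx : K.Affected L x) :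
    K.Affected L y :=
  hx.imp (h.bent_of_mem_arc hy) (h.bent_of_mem_arc (π_mem_arc hxd hy))

omit [Finite F] h in
theorem affected_π (hx : x ∈ K.double) : K.Affected L (K.π x) ↔ K.Affected L x := by
  rw [Affected, Affected, K.π_π x hx, or_comm]

omit [Finite F] in
theorem bent_notMem (hx : K.Bent L x) : x ∉ L :=
  let ⟨_, hl, hc⟩ := hx
  h.notMem_of_crosses hl hc

omit [Finite F] h in
theorem bent_double (hx : K.Bent L x) : x ∈ K.double :=
  let ⟨_, _, hc⟩ := hx
  hc.2.1

/-- A triple point is passed by the double line in one direction only. -/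
theorem not_bent_π (hx : K.Bent L x) : ¬ K.Bent L (K.π x) := by
  rintro ⟨l', hl', hc'⟩
  obtain ⟨l, hl, hc⟩ := hx
  obtain ⟨z, hz, hz'⟩ := K.triple l x hc
  have : K.π z ∈ K.arc l' := K.crosses_unique _ _ _ (h.chords.crosses_symm hc')
    (h.chords.crosses_symm hz')
  have hπz := h.mem_of_mem_arc hl' this
  have : z ∈ L := K.π_π z hz.2.1 ▸ h.line.π_mem hπz
  exact h.once _ (h.line.π_mem hl) _ this hz

/-- `triple` supplies an arc `z` that crosses the pasted arc of `L`. Its four end flags realize all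
combinations of colour and orientation, so one of them has the required pair. -/
theorem exists_continues (hx : K.Bent L x) : ∃ w, K.Continues L s o' x w := by
  obtain ⟨l, hl, hc⟩ := hx
  obtain ⟨z, hz, -⟩ := K.triple l x hc
  have hπl := h.line.π_mem hl
  have hzd := hz.2.1
  have h1 : ∃ z₁ ∈ K.arc z, s z₁ = !s x := by
    have hne := ((h.crosses_iff hπl hzd).1 hz).2
    by_cases e : s z = s x
    · exact ⟨K.κ z, .inr (.inr (.inl rfl)), by
        rw [e] at hne; revert hne; cases s (K.κ z) <;> cases s x <;> simp⟩
    · exact ⟨z, .inl rfl, by revert e; cases s z <;> cases s x <;> simp⟩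
  obtain ⟨z₁, hz₁, hs₁⟩ := h1
  have hc₁ := h.chords.crosses_right hz₁ hz
  have hzL := h.notMem_of_crosses hπl hc₁
  by_cases e : o' z₁ = !o' x
  · exact ⟨z₁, l, hl, hc, hc₁, hs₁, e⟩
  · refine ⟨K.τ₀ z₁, l, hl, hc, h.chords.crosses_right (.inr (.inl rfl)) hc₁, ?_, ?_⟩
    · rw [h.cut.off _ hzL, hs₁]
    · rw [h.flip_off hzL]
      revert e; cases o' z₁ <;> cases o' x <;> simp

omit [Finite F] h in
theorem bent_of_continues (hw : K.Continues L s o' x w) : K.Bent L x :=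
  let ⟨l, hl, hc, _⟩ := hw
  ⟨l, hl, hc⟩

omit [Finite F] in
theorem continues_symm (hw : K.Continues L s o' x w) : K.Continues L s o' w x := by
  obtain ⟨l, hl, h1, h2, h3, h4⟩ := hw
  exact ⟨K.π l, h.line.π_mem hl, h2, by rwa [K.π_π l h1.1], by rw [h3, Bool.not_not],
    by rw [h4, Bool.not_not]⟩

omit [Finite F] in
theorem bent_of_continues' (hw : K.Continues L s o' x w) : K.Bent L w :=
  bent_of_continues (h.continues_symm hw)

/-- Away from `L`, an end of an arc is determined by its colour and by the orientation. -/
theorem eq_of_mem_arc (hx : K.Bent L x) (hy : y ∈ K.arc x) (hs : s y = s x) (ho : o' y = o' x) :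
    y = x := by
  have hne := (h.bent_iff (bent_double hx)).1 hx
  rcases hy with rfl | rfl | rfl | rfl
  · rfl
  · rw [h.flip_off (h.bent_notMem hx)] at ho; simp at ho
  · exact absurd hs hne
  · rw [h.cut.off _ (h.bent_notMem (h.bent_of_mem_arc (.inr (.inr (.inl rfl))) hx))] at hs
    exact absurd hs hne

/-- An arc crosses at most one other, so the particular `l` in the definition of `Continues` does
not matter. -/
theorem crosses_π_of_continues (hw : K.Continues L s o' x w) (hc : K.Crosses l x) :
    K.Crosses (K.π l) w := by
  obtain ⟨l', hl', h1, h2, -⟩ := hw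
  have : l ∈ K.arc l' := K.crosses_unique _ _ _ (h.chords.crosses_symm h1) (h.chords.crosses_symm hc)
  exact h.chords.crosses_left (π_mem_arc (h.line.subset hl') this) h2

theorem continues_unique (hw : K.Continues L s o' x w) (hv : K.Continues L s o' x v) : v = w := by
  obtain ⟨_, hl, h1, h2, h3, h4⟩ := id hv
  have h2' := h.crosses_π_of_continues hw h1
  obtain ⟨-, -, -, -, h3', h4'⟩ := id hw
  exact h.eq_of_mem_arc (h.bent_of_continues' hw) (K.crosses_unique _ _ _ h2' h2)
    (h3.trans h3'.symm) (h4.trans h4'.symm)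

theorem continues_τ₀ (hw : K.Continues L s o' x w) :
    K.Continues L s o' (K.τ₀ x) (K.τ₀ w) := by
  have hx := h.bent_notMem (bent_of_continues hw)
  have hw' := h.bent_notMem (h.bent_of_continues' hw)
  obtain ⟨l, hl, h1, h2, h3, h4⟩ := hw
  exact ⟨l, hl, h.chords.crosses_right (.inr (.inl rfl)) h1,
    h.chords.crosses_right (.inr (.inl rfl)) h2, by rw [h.cut.off _ hx, h.cut.off _ hw', h3],
    by rw [h.flip_off hx, h.flip_off hw', h4]⟩

omit [Finite F] h in
theorem affected_of_mate (hw : K.Mate L s o' x w) : K.Affected L x := by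
  rcases hw with hw | ⟨-, -, -, hw | hw⟩
  · exact .inl (bent_of_continues hw)
  · exact .inr (bent_of_continues hw)
  · exact .inr (bent_of_continues hw)

omit [Finite F] in
theorem notMem_of_affected (ha : K.Affected L x) : x ∉ L := by
  rcases ha with ha | ha
  · exact h.bent_notMem ha
  · exact fun e => h.bent_notMem ha (h.line.π_mem e)

theorem exists_mate (hx : x ∈ K.double) (ha : K.Affected L x) : ∃ w, K.Mate L s o' x w := by
  rcases ha with ha | ha
  · exact (h.exists_continues ha).imp fun w hw => .inl hw
  · obtain ⟨v, hv⟩ := h.exists_continues ha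
    have hv' := h.bent_of_continues' hv
    have hvd := bent_double hv'
    have hπv : K.π v ∉ L := fun e => h.bent_notMem hv' (K.π_π v hvd ▸ h.line.π_mem e)
    by_cases e : o' (K.π v) = !o' x
    · exact ⟨K.π v, .inr ⟨hx, K.double_π v hvd, e, .inl (by rwa [K.π_π v hvd])⟩⟩
    · refine ⟨K.τ₀ (K.π v), .inr ⟨hx, K.double_τ₀ _ (K.double_π v hvd), ?_, .inr ?_⟩⟩
      · rw [h.flip_off hπv]; revert e; cases o' (K.π v) <;> cases o' x <;> simp
      · rwa [K.π_τ₀ _ (K.double_π v hvd), K.inv₀, K.π_π v hvd]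

theorem mate_symm (hw : K.Mate L s o' x w) : K.Mate L s o' w x := by
  rcases hw with hw | ⟨h1, h2, h3, h4⟩
  · exact .inl (h.continues_symm hw)
  · refine .inr ⟨h2, h1, by rw [h3, Bool.not_not], h4.imp h.continues_symm fun h4 => ?_⟩
    simpa only [K.inv₀] using h.continues_τ₀ (h.continues_symm h4)

omit [Finite F] in
theorem mate_double (hw : K.Mate L s o' x w) : x ∈ K.double ∧ w ∈ K.double := by
  rcases hw with hw | ⟨h1, h2, -⟩
  · exact ⟨bent_double (bent_of_continues hw), bent_double (h.bent_of_continues' hw)⟩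
  · exact ⟨h1, h2⟩

omit [Finite F] h in
theorem mate_flip (hw : K.Mate L s o' x w) : o' w = !o' x := by
  rcases hw with ⟨_, _, _, _, _, hw⟩ | ⟨-, -, hw, -⟩ <;> exact hw

theorem mate_τ₀ (hw : K.Mate L s o' x w) : K.Mate L s o' (K.τ₀ x) (K.τ₀ w) := by
  have ha := affected_of_mate hw
  have ha' := affected_of_mate (h.mate_symm hw)
  obtain ⟨hx, hwd⟩ := h.mate_double hw
  have hxL := h.notMem_of_affected ha
  have hwL := h.notMem_of_affected ha'
  rcases hw with hw | ⟨h1, h2, h3, h4⟩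
  · exact .inl (h.continues_τ₀ hw)
  · refine .inr ⟨K.double_τ₀ _ h1, K.double_τ₀ _ h2, by
      rw [h.flip_off hxL, h.flip_off hwL, h3], ?_⟩
    rw [K.π_τ₀ x hx, K.π_τ₀ w hwd]
    exact h4.imp h.continues_τ₀ h.continues_τ₀

/-- The two clauses of `Mate` exclude each other by `not_bent_π`. In the second, the pasting fixes
the mate up to `τ₀`, and the orientation `o'` decides. -/
theorem mate_unique (hw : K.Mate L s o' x w) (hv : K.Mate L s o' x v) : v = w := by
  have hwL := h.notMem_of_affected (affected_of_mate (h.mate_symm hw))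
  have hfw := h.flip_off hwL
  rcases hw with hw | ⟨h1, h2, h3, h4⟩ <;> rcases hv with hv | ⟨g1, g2, g3, g4⟩
  · exact h.continues_unique hw hv
  · exact absurd (g4.elim bent_of_continues bent_of_continues)
      (h.not_bent_π (bent_of_continues hw))
  · exact absurd (h4.elim bent_of_continues bent_of_continues)
      (h.not_bent_π (bent_of_continues hv))
  · have key : K.π v = K.π w ∨ K.π v = K.τ₀ (K.π w) := by
      rcases h4 with h4 | h4 <;> rcases g4 with g4 | g4 <;> have e := h.continues_unique h4 g4
      · exact .inl e
      · exact .inr (by rw [← e, K.inv₀])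
      · exact .inr e
      · exact .inl (by rw [← K.inv₀ (K.π v), e, K.inv₀])
    rcases key with e | e
    · rw [← K.π_π v g2, e, K.π_π w h2]
    · have : v = K.τ₀ w := by rw [← K.π_π v g2, e, K.π_τ₀ _ (K.double_π w h2), K.π_π w h2]
      rw [this, hfw, h3] at g3
      simp at g3

/-- In the third sheet of a triple point on `L`, reconnected arcs cross each other. -/
theorem crosses_of_mate (hw : K.Mate L s o' x w) (hx : K.Bent L (K.π x)) : K.Crosses x w := by
  obtain ⟨hxd, hwd⟩ := h.mate_double hw
  rcases hw with hw | ⟨-, -, -, h4⟩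
  · exact absurd hx (h.not_bent_π (bent_of_continues hw))
  obtain ⟨l, hl, hc⟩ := hx
  obtain ⟨z, hz, hz'⟩ := K.triple l _ hc
  rw [K.π_π x hxd] at hz'
  have key : ∀ v, K.Continues L s o' (K.π x) v → K.Crosses x (K.π v) := fun v hv => by
    have : v ∈ K.arc z := K.crosses_unique _ _ _ hz (h.crosses_π_of_continues hv hc)
    exact h.chords.crosses_right (π_mem_arc hz.2.1 this) (h.chords.crosses_symm hz')
  rcases h4 with h4 | h4
  · exact K.π_π w hwd ▸ key _ h4
  · have := h.chords.crosses_right (.inr (.inl rfl)) (key _ h4)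
    rwa [K.π_τ₀ _ (K.double_π w hwd), K.inv₀, K.π_π w hwd] at this

/-- The only arc that `w` crosses is that of `x`. If `w` crossed `L`, then `x` would lie on `L`. -/
theorem bent_π_of_mate (hw : K.Mate L s o' x w) (hx : K.Bent L (K.π x)) : K.Bent L (K.π w) := by
  rcases affected_of_mate (h.mate_symm hw) with hb | hb
  · have hxw := h.crosses_of_mate hw hx
    obtain ⟨l, hl, hc⟩ := hb
    have : l ∈ K.arc x := K.crosses_unique _ _ _ (h.chords.crosses_symm hxw)
      (h.chords.crosses_symm hc)
    have hxL := h.mem_of_mem_arc hl (h.chords.arc_comm hxw.1 this)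
    exact absurd (h.line.π_mem hxL) (h.bent_notMem hx)
  · exact hb

theorem continues_of_mate (hw : K.Mate L s o' x w) (hx : K.Bent L x) :
    K.Continues L s o' x w := by
  rcases hw with hw | ⟨-, -, -, h4⟩
  · exact hw
  · exact absurd (h4.elim bent_of_continues bent_of_continues) (h.not_bent_π hx)

end IsRegluing

end StandardComplex

/-! ### Cuts and crossings on the reglued surface -/

namespace CellSurface

variable {F : Type*} {S : CellSurface F}

/-- A cut function can be chosen to vanish on a set that meets the face on one side of the cut
only. -/
theorem IsCut.exists_normalized {A B : Set F} {q : F → Bool} {a : F} (hq : S.IsCut A q)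
    (hA : ∀ u ∈ A, S.face u = S.face a)
    (hB : ∀ u ∈ B, ∀ v ∈ B, S.face u = S.face a → S.face v = S.face a → q u = q v) :
    ∃ q', S.IsCut A q' ∧ (∀ u ∈ B, q' u = false) ∧ (∀ u, q' u = true → S.face u = S.face a) ∧
      ∀ u v, S.face u = S.face a → S.face v = S.face a → (q' u = q' v ↔ q u = q v) := by
  classical
  obtain ⟨c, hc⟩ : ∃ c, ∀ u ∈ B, S.face u = S.face a → q u = c := by
    by_cases hne : ∃ u ∈ B, S.face u = S.face a
    · obtain ⟨u, hu, hua⟩ := hne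
      exact ⟨q u, fun v hv hva => hB v hv u hu hva hua⟩
    · exact ⟨false, fun u hu hua => absurd ⟨u, hu, hua⟩ hne⟩
  refine ⟨fun u => decide (S.face u = S.face a) && (q u ^^ c),
    ⟨fun u => ?_, fun u hu => ?_, fun u hu => ?_⟩, fun u hu => ?_, fun u hu => ?_, fun u v hu hv => ?_⟩
  · simp only [S.face_τ₁, hq.inv₁]
  · simp only [S.face_τ₀, hq.jump u hu, hA u hu]; simp
  · simp only [S.face_τ₀, hq.off u hu]
  · by_cases hua : S.face u = S.face a
    · simp [hc u hu hua]
    · simp [hua]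
  · exact of_decide_eq_true (Bool.and_eq_true_iff.1 hu).1
  · simp [hu, hv]

end CellSurface

namespace StandardComplex

variable {F : Type*} {K : StandardComplex F} {o o' s : F → Bool} {L : Set F} {x y z l u v w : F}

open Classical in
/-- The continuation of arcs inside faces after the reconnection at the triple points on `L`. -/
noncomputable def reconnectκ (K : StandardComplex F) (L : Set F) (s o' : F → Bool) (x : F) : F :=
  if hx : ∃ w, K.Mate L s o' x w then hx.choose else K.κ x

namespace IsRegluing

variable (h : K.IsRegluing L o s o')

/-- The reglued surface with the remaining double lines. -/
noncomputable def arcs : PairedArcs F where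
  toCellSurface := h.surface
  double := K.double \ L
  κ := K.reconnectκ L s o'
  π := K.π

variable [Finite F]
include h

theorem reconnect_eq (hw : K.Mate L s o' x w) : K.reconnectκ L s o' x = w := by
  have hex : ∃ w, K.Mate L s o' x w := ⟨w, hw⟩
  rw [reconnectκ, dif_pos hex]
  exact h.mate_unique hw hex.choose_spec

theorem mate_reconnect (hx : x ∈ K.double) (ha : K.Affected L x) :
    K.Mate L s o' x (K.reconnectκ L s o' x) := by
  obtain ⟨w, hw⟩ := h.exists_mate hx ha
  rwa [h.reconnect_eq hw]

omit [Finite F] h in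
theorem reconnect_of_not_affected (ha : ¬ K.Affected L x) : K.reconnectκ L s o' x = K.κ x :=
  dif_neg fun ⟨_, hw⟩ => ha (affected_of_mate hw)

theorem affected_κ (hx : x ∈ K.double) : K.Affected L (K.κ x) ↔ K.Affected L x := by
  refine ⟨fun ha => ?_, h.affected_of_mem_arc hx (.inr (.inr (.inl rfl)))⟩
  have := h.affected_of_mem_arc (K.double_κ x hx) (.inr (.inr (.inl rfl))) ha
  rwa [K.κ_κ x hx] at this

omit [Finite F] in
theorem κ_mem_iff (hx : x ∈ K.double) : K.κ x ∈ L ↔ x ∈ L :=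
  ⟨fun e => K.κ_κ x hx ▸ h.line.κ_mem e, h.line.κ_mem⟩

omit [Finite F] in
theorem π_mem_iff (hx : x ∈ K.double) : K.π x ∈ L ↔ x ∈ L :=
  ⟨fun e => K.π_π x hx ▸ h.line.π_mem e, h.line.π_mem⟩

theorem not_bent (hx : x ∈ K.double) (hb : ¬ K.Bent L x) : s (K.κ x) = s x := by
  by_contra hne
  exact hb ((h.bent_iff hx).2 hne)

/-- Crossing arcs that do not cross `L` lie in the same region. -/
theorem color_eq_of_crosses (hc : K.Crosses x y) (hx : ¬ K.Bent L x) (hy : ¬ K.Bent L y)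
    (hxL : x ∉ L) : s x = s y := by
  by_cases hne : ∀ l ∈ L, K.face l ≠ K.face x
  · exact (h.color_const hne hc.2.2.1.symm).symm
  · push Not at hne
    obtain ⟨l, hl, hlx⟩ := hne
    have hld := h.line.subset hl
    obtain ⟨p, hp, -⟩ := h.chords.exists_cut hld
    rw [h.color_eq_iff hl hp hlx.symm (hc.2.2.1.symm.trans hlx.symm)]
    exact h.chords.cut_eq_of_crosses hld hp (fun e => hxL (h.mem_of_mem_arc hl e)) hlx
      (fun e => hx ⟨l, hl, e⟩) (fun e => hy ⟨l, hl, e⟩) hc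

/-- The surviving arcs are chords of the faces of the reglued surface. -/
theorem chord_arcs (hx : x ∈ K.double) (hxL : x ∉ L) :
    h.surface.IsChord o' x (K.reconnectκ L s o' x) := by
  by_cases ha : K.Affected L x
  · have hw := h.mate_reconnect hx ha
    set w := K.reconnectκ L s o' x
    have hflip := mate_flip hw
    have hwL := h.notMem_of_affected (affected_of_mate (h.mate_symm hw))
    rcases ha with ha | ha
    · obtain ⟨l, hl, h1, h2, h3, -⟩ := h.continues_of_mate hw ha
      have hsx := h.cut.off x hxL
      -- Here the half-arc of `x` crosses over to the other sheet. The halves of faces containing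
      -- `x` and `w` are glued at `l₀`, hence lie in the same new face.
      obtain ⟨l₀, hl₀, hc, hs₀⟩ := h.exists_crosses hx ((h.bent_iff hx).1 ha)
      have hc' := h.crosses_π_of_continues (h.continues_of_mate hw ha) hc
      have hm : K.recolorτ₀ L s l₀ ∈ K.arc (K.π l₀) := by
        rcases h.recolor_on hl₀ with e | e
        · exact .inl e
        · exact .inr (.inl e)
      have hm' := h.chords.crosses_left hm hc'
      have e1 := h.face_surface_eq hc.2.2.1 hs₀
      have e2 := h.face_surface_eq hm'.2.2.1 (by rw [h.color_recolor hl₀, hs₀, h3])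
      refine ⟨?_, hflip, fun e => ?_⟩
      · rw [← e1, ← e2]; exact h.surface.face_τ₀ l₀
      · change w = K.recolorτ₀ L s x at e
        rw [h.recolor_off hxL] at e
        rw [e, hsx] at h3
        simp at h3
    -- In the third sheet `x` and `w` belong to crossing arcs, neither of which crosses `L`, so they
    -- lie in one region of one old face.
    · have hc := h.crosses_of_mate hw ha
      have hb : ¬ K.Bent L x := fun e => h.not_bent_π e ha
      have hb' : ¬ K.Bent L w := fun e => h.not_bent_π e (h.bent_π_of_mate hw ha)
      refine ⟨(h.face_surface_eq hc.2.2.1 (h.color_eq_of_crosses hc hb hb' hxL)).symm, hflip,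
        fun e => hc.2.2.2.1 ?_⟩
      change w = K.recolorτ₀ L s x at e
      rw [h.recolor_off hxL] at e
      exact .inr (.inl e)
  · rw [reconnect_of_not_affected ha]
    have hch := h.chords.chord x hx
    have hs : s (K.κ x) = s x := h.not_bent hx fun e => ha (.inl e)
    refine ⟨h.face_surface_eq hch.face_eq hs, ?_, fun e => ?_⟩
    · have := h.orient_eq _ _ hs
      rw [hch.flip] at this
      revert this
      cases o' (K.κ x) <;> cases o' x <;> simp
    · change K.κ x = K.recolorτ₀ L s x at e
      rw [h.recolor_off hxL] at e
      exact hch.ne e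

theorem chords_arcs : h.arcs.IsChordSystem o' where
  orient := h.orient'
  double_τ₀ := by
    rintro x ⟨hx, hxL⟩
    change K.recolorτ₀ L s x ∈ K.double \ L
    rw [h.recolor_off hxL]
    exact ⟨K.double_τ₀ x hx, mt h.τ₀_mem_iff.1 hxL⟩
  double_κ := by
    rintro x ⟨hx, hxL⟩
    change K.reconnectκ L s o' x ∈ K.double \ L
    by_cases ha : K.Affected L x
    · have hw := h.mate_symm (h.mate_reconnect hx ha)
      exact ⟨(h.mate_double hw).1, h.notMem_of_affected (affected_of_mate hw)⟩
    · rw [reconnect_of_not_affected ha]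
      exact ⟨K.double_κ x hx, mt (h.κ_mem_iff hx).1 hxL⟩
  κ_κ := by
    rintro x ⟨hx, hxL⟩
    change K.reconnectκ L s o' (K.reconnectκ L s o' x) = x
    by_cases ha : K.Affected L x
    · exact h.reconnect_eq (h.mate_symm (h.mate_reconnect hx ha))
    · rw [reconnect_of_not_affected ha, reconnect_of_not_affected (mt (h.affected_κ hx).1 ha),
        K.κ_κ x hx]
  κ_τ₀ := by
    rintro x ⟨hx, hxL⟩
    change K.reconnectκ L s o' (K.recolorτ₀ L s x) = K.recolorτ₀ L s (K.reconnectκ L s o' x)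
    rw [h.recolor_off hxL]
    by_cases ha : K.Affected L x
    · have hw := h.mate_reconnect hx ha
      rw [h.reconnect_eq (h.mate_τ₀ hw),
        h.recolor_off (h.notMem_of_affected (affected_of_mate (h.mate_symm hw)))]
    · have ha' : ¬ K.Affected L (K.τ₀ x) := fun e => ha (by
        have := h.affected_of_mem_arc (K.double_τ₀ x hx) (.inr (.inl rfl)) e
        rwa [K.inv₀] at this)
      rw [reconnect_of_not_affected ha, reconnect_of_not_affected ha', K.κ_τ₀ x hx,
        h.recolor_off (mt (h.κ_mem_iff hx).1 hxL)]
  chord _ hx := h.chord_arcs hx.1 hx.2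

theorem mem_arc_arcs (hx : x ∈ K.double) (hxL : x ∉ L) : u ∈ h.arcs.arc x ↔
    u ∈ K.chord x (K.reconnectκ L s o' x) := by
  have hκ : K.reconnectκ L s o' x ∉ L := (h.chords_arcs.double_κ x ⟨hx, hxL⟩).2
  change (u = x ∨ u = K.recolorτ₀ L s x ∨ u = K.reconnectκ L s o' x ∨
    u = K.recolorτ₀ L s (K.reconnectκ L s o' x)) ↔ _
  rw [h.recolor_off hxL, h.recolor_off hκ]
  rfl

omit [Finite F] in
/-- A cut along curves that do not meet `L` is a cut of the reglued surface if it has `L` on one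
side. -/
theorem isCut_surface {A : Set F} {q : F → Bool} (hq : K.IsCut A q) (hA : ∀ u ∈ A, u ∉ L)
    (hL : ∀ u ∈ L, q u = false) : h.surface.IsCut A q := by
  refine ⟨hq.inv₁, fun u hu => ?_, fun u hu => ?_⟩
  · change q (K.recolorτ₀ L s u) = _
    rw [h.recolor_off (hA u hu), hq.jump u hu]
  · change q (K.recolorτ₀ L s u) = _
    by_cases hul : u ∈ L
    · rw [hL _ (h.recolor_mem hul), hL u hul]
    · rw [h.recolor_off hul, hq.off u hu]

/-- The line `L` lies on one side of every arc that it does not cross. -/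
theorem cut_eq_on_line {p : F → Bool} (hx : x ∈ K.double) (hxL : x ∉ L) (hb : ¬ K.Bent L x)
    (hp : K.IsCut (K.arc x) p) (hu : u ∈ L) (hv : v ∈ L) (hux : K.face u = K.face x)
    (hvx : K.face v = K.face x) : p u = p v := by
  have harc : ∀ w ∈ L, w ∉ K.arc x := fun w hw e =>
    hxL (h.mem_of_mem_arc hw (h.chords.arc_comm hx e))
  have hud := h.line.subset hu
  have hκ : p (K.κ u) = p u := by
    by_contra hne
    exact hb ⟨u, hu, h.chords.crosses_symm
      ((h.chords.crosses_iff hx hud hp).2 ⟨hux.symm, Ne.symm hne⟩)⟩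
  have h0 := hp.off u (harc u hu)
  have h1 := hp.off _ (harc _ (h.line.κ_mem hu))
  rcases (h.mem_iff_mem_arc hu (hvx.trans hux.symm)).1 hv with rfl | rfl | rfl | rfl
  · rfl
  · exact h0.symm
  · exact hκ.symm
  · rw [h1, hκ]

omit [Finite F] in
theorem arc_notMem (hx : x ∈ K.double) (hxL : x ∉ L) : ∀ u ∈ K.arc x, u ∉ L := by
  rintro u (rfl | rfl | rfl | rfl)
  · exact hxL
  · exact mt h.τ₀_mem_iff.1 hxL
  · exact mt (h.κ_mem_iff hx).1 hxL
  · exact mt h.τ₀_mem_iff.1 (mt (h.κ_mem_iff hx).1 hxL)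

theorem arc_arcs_of_not_affected (hx : x ∈ K.double) (hxL : x ∉ L) (ha : ¬ K.Affected L x) :
    h.arcs.arc x = K.arc x := by
  ext u; rw [h.mem_arc_arcs hx hxL, reconnect_of_not_affected ha]; rfl

/-- Away from the triple points on `L`, the crossings remain the same. -/
theorem crosses_arcs_iff (hx : x ∈ K.double) (hxL : x ∉ L) (hax : ¬ K.Affected L x)
    (hy : y ∈ K.double) (hyL : y ∉ L) (hay : ¬ K.Affected L y) :
    h.arcs.Crosses x y ↔ K.Crosses x y := by
  have hb : ¬ K.Bent L x := fun e => hax (.inl e)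
  obtain ⟨p₀, hp₀, -⟩ := h.chords.exists_cut hx
  obtain ⟨p, hp, hpL, hpx, -⟩ := hp₀.exists_normalized (a := x)
    (fun u hu => h.chords.face_eq_of_mem_arc hx hu)
    (fun u hu v hv hux hvx => h.cut_eq_on_line hx hxL hb hp₀ hu hv hux hvx)
  have hp' : h.arcs.IsCut (h.arcs.arc x) p := by
    rw [h.arc_arcs_of_not_affected hx hxL hax]
    exact h.isCut_surface hp (h.arc_notMem hx hxL) hpL
  -- The side where `p` is true is free of `L`, so the regluing keeps it within a single face.
  have hpx' : ∀ u, p u = true → h.surface.face u = h.surface.face x := by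
    obtain ⟨a, ha, hax', hpa⟩ : ∃ a, K.face a = K.face x ∧
        h.surface.face a = h.surface.face x ∧ p a = true := by
      cases e : p x
      · refine ⟨K.τ₀ x, K.face_τ₀ x, ?_, by rw [hp.jump x (.inl rfl), e]; rfl⟩
        rw [← h.recolor_off hxL]; exact h.surface.face_τ₀ x
      · exact ⟨x, rfl, rfl, e⟩
    intro u hu
    have hs := (hp.samePiece_iff h.orient (h.chords.chord x hx) (hpx u hu) ha).2
      (hu.trans hpa.symm)
    rw [← hax']
    refine (hs.eq_of_invariant (fun w => p w = true → h.surface.face w = h.surface.face a)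
      (fun w => ?_) (fun w hw => ?_)).mpr (fun _ => rfl) hu
    · rw [hp.inv₁]
      exact forall_congr fun _ => congrArg (· = _) (h.surface.face_τ₁ w)
    · rw [hp.off w hw]
      refine forall_congr fun hpw => ?_
      have : w ∉ L := fun e => by rw [hpL w e] at hpw; cases hpw
      rw [← h.recolor_off this]
      exact congrArg (· = _) (h.surface.face_τ₀ w)
  have key : p y ≠ p (K.κ y) → K.face x = K.face y ∧ h.surface.face x = h.surface.face y := by
    intro hne
    cases e : p y
    · have e' : p (K.κ y) = true := by rw [e] at hne; simpa using hne.symm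
      have h1 := (h.chord_arcs hy hyL).face_eq
      rw [reconnect_of_not_affected hay] at h1
      exact ⟨(hpx _ e').symm.trans (h.chords.chord y hy).face_eq, (hpx' _ e').symm.trans h1⟩
    · exact ⟨(hpx _ e).symm, (hpx' _ e).symm⟩
  rw [h.chords_arcs.crosses_iff ⟨hx, hxL⟩ ⟨hy, hyL⟩ hp', h.chords.crosses_iff hx hy hp]
  have hκ : h.arcs.κ y = K.κ y := reconnect_of_not_affected hay
  rw [hκ]
  exact ⟨fun e => ⟨(key e.2).1, e.2⟩, fun e => ⟨(key e.2).2, e.2⟩⟩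

end IsRegluing

end StandardComplex

namespace StandardComplex

variable {F : Type*} {K : StandardComplex F} {o o' s : F → Bool} {L : Set F} {x y z l u v w : F}

namespace IsRegluing

variable [Finite F] (h : K.IsRegluing L o s o')
include h

theorem color_κ_eq_of_not_bent (hy : y ∈ K.double) (hb : ¬ K.Bent L y) (a : F) :
    (K.face (K.κ y) = K.face a ∧ s (K.κ y) = s a) ↔ (K.face y = K.face a ∧ s y = s a) := by
  rw [(h.chords.chord y hy).face_eq, h.not_bent hy hb]

/-- The arcs that pass from one sheet to the other after the regluing cross no other arcs. -/
theorem not_crosses_of_bent (hb : K.Bent L x) (y : F) : ¬ h.arcs.Crosses x y := by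
  classical
  intro hcr
  have hx := bent_double hb
  have hxL := h.bent_notMem hb
  have hC := h.chords
  have hw := h.continues_of_mate (h.mate_reconnect hx (.inl hb)) hb
  set w := K.reconnectκ L s o' x with hwdef
  have hbw := h.bent_of_continues' hw
  have hwd := bent_double hbw
  have hwL := h.bent_notMem hbw
  obtain ⟨l, hl, hlx, hsl⟩ := h.exists_crosses hx ((h.bent_iff hx).1 hb)
  have hld := h.line.subset hl
  let m := K.recolorτ₀ L s l
  have hm : m ∈ L := h.recolor_mem hl
  have hmd := h.line.subset hm
  have hmπ : m ∈ K.arc (K.π l) := by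
    rcases h.recolor_on hl with e | e
    · exact .inl e
    · exact .inr (.inl e)
  have hmw : K.Crosses m w := hC.crosses_left hmπ (h.crosses_π_of_continues hw hlx)
  have hsm : s m = s w := by
    obtain ⟨-, -, -, -, h3, -⟩ := hw
    rw [h3, ← hsl]; exact h.color_recolor hl
  -- Otherwise `m` would lie on the arc of `l`, which would then be pasted to itself; but a crossing
  -- arc carries no cusp.
  have hml : K.face m ≠ K.face l := fun e => by
    have h1 := mem_arc_of_face_eq h.once h.fine hl hm e
    refine K.crosses_not_cusp l x hlx ?_
    rw [← hC.arc_eq hld h1]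
    exact hC.arc_comm (K.double_π l hld) hmπ
  have hrm : K.recolorτ₀ L s m = l := h.recolor_inv
  have hrκl : K.recolorτ₀ L s (K.κ l) = K.κ m := h.recolor_κ hl
  have hrκm : K.recolorτ₀ L s (K.κ m) = K.κ l := by rw [h.recolor_κ hm, hrm]
  -- regions
  let I : F → F → Prop := fun a u => K.face u = K.face a ∧ s u = s a
  have I₁ : ∀ a u, I a (K.τ₁ u) ↔ I a u := fun a u => by
    simp only [I, K.face_τ₁, h.cut.inv₁]
  have I₀ : ∀ a u, u ∉ L → (I a (K.τ₀ u) ↔ I a u) := fun a u hu => by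
    simp only [I, K.face_τ₀, h.cut.off u hu]
  have Iself : ∀ a, I a a := fun a => ⟨rfl, rfl⟩
  have Iκ : ∀ a ∈ L, I a (K.κ a) := fun a ha =>
    ⟨(hC.chord a (h.line.subset ha)).face_eq, h.color_κ ha⟩
  have Iexcl : ∀ u, I m u → ¬ I l u := fun u hu hu' => hml (hu.1.symm.trans hu'.1)
  have Iend : ∀ a ∈ L, ∀ u ∈ L, I a u → u = a ∨ u = K.κ a := by
    intro a ha u hu hI
    rcases mem_arc_of_face_eq h.once h.fine ha hu hI.1 with rfl | rfl | rfl | rfl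
    · exact .inl rfl
    · have := hI.2; rw [h.cut.jump a ha] at this; simp at this
    · exact .inr rfl
    · have := hI.2
      rw [h.cut.jump _ (h.line.κ_mem ha), h.color_κ ha] at this; simp at this
  have Ilx : I l x := ⟨hlx.2.2.1.symm, hsl.symm⟩
  have Imw : I m w := ⟨hmw.2.2.1.symm, hsm.symm⟩
  have hA : ∀ u, u ∈ h.arcs.arc x ↔ u = x ∨ u = K.τ₀ x ∨ u = w ∨ u = K.τ₀ w := fun u =>
    h.mem_arc_arcs hx hxL
  have hbκ : ∀ {a}, K.Bent L a → s (K.κ a) ≠ s a ∧ s (K.τ₀ (K.κ a)) ≠ s a := fun {a} ha => by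
    have h1 := (h.bent_iff (bent_double ha)).1 ha
    have h2 := h.bent_notMem (h.bent_of_mem_arc (.inr (.inr (.inl rfl))) ha)
    rw [h.cut.off _ h2]
    exact ⟨h1, h1⟩
  have hAl : ∀ u, I l u → (u ∈ h.arcs.arc x ↔ u ∈ K.arc x) := by
    intro u hu
    rw [hA]
    constructor
    · rintro (e | e | rfl | rfl)
      · exact .inl e
      · exact .inr (.inl e)
      · exact absurd hu (Iexcl _ Imw)
      · exact absurd hu (Iexcl _ ((I₀ m w hwL).2 Imw))
    · rintro (e | e | rfl | rfl)
      · exact .inl e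
      · exact .inr (.inl e)
      · exact absurd (hu.2.trans hsl) (hbκ hb).1
      · exact absurd (hu.2.trans hsl) (hbκ hb).2
  have hAm : ∀ u, I m u → (u ∈ h.arcs.arc x ↔ u ∈ K.arc w) := by
    intro u hu
    rw [hA]
    constructor
    · rintro (rfl | rfl | e | e)
      · exact absurd Ilx (Iexcl _ hu)
      · exact absurd ((I₀ l x hxL).2 Ilx) (Iexcl _ hu)
      · exact .inl e
      · exact .inr (.inl e)
    · rintro (e | e | rfl | rfl)
      · exact .inr (.inr (.inl e))
      · exact .inr (.inr (.inr e))
      · exact absurd (hu.2.trans hsm) (hbκ hbw).1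
      · exact absurd (hu.2.trans hsm) (hbκ hbw).2
  have hAL : ∀ u ∈ h.arcs.arc x, u ∉ L := by
    intro u hu
    rcases (hA u).1 hu with rfl | rfl | rfl | rfl
    · exact hxL
    · exact mt h.τ₀_mem_iff.1 hxL
    · exact hwL
    · exact mt h.τ₀_mem_iff.1 hwL
  -- cut functions
  obtain ⟨p, hp, -⟩ := hC.exists_cut hx
  -- The cuts along the arcs of `x` and `w` are adjusted to agree at one end of the seam. They then
  -- agree at the other end, since each of the two arcs crosses `L`.
  obtain ⟨q, hq, hqm⟩ : ∃ q, K.IsCut (K.arc w) q ∧ q m = p l := by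
    obtain ⟨q, hq, -⟩ := hC.exists_cut hwd
    by_cases e : q m = p l
    · exact ⟨q, hq, e⟩
    · exact ⟨_, hq.not, by revert e; cases q m <;> cases p l <;> simp⟩
  have hpκ := ((hC.crosses_iff hx hld hp).1 (hC.crosses_symm hlx)).2
  have hqκ := ((hC.crosses_iff hwd hmd hq).1 (hC.crosses_symm hmw)).2
  have hκκ : q (K.κ m) = p (K.κ l) := by
    revert hpκ hqκ hqm
    cases q m <;> cases p l <;> cases q (K.κ m) <;> cases p (K.κ l) <;> simp
  -- The two cuts combine to a cut of the new face along the arc from `x` to `w`. It remains to see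
  -- that `r` agrees at the ends of every other arc.
  let r : F → Bool := fun u => if I l u then p u else if I m u then q u else false
  have rl : ∀ u, I l u → r u = p u := fun u hu => if_pos hu
  have rm : ∀ u, I m u → r u = q u := fun u hu => by
    simp only [r, if_neg (Iexcl u hu), if_pos hu]
  have rf : ∀ u, ¬ I l u → ¬ I m u → r u = false := fun u hu hu' => by
    simp only [r, if_neg hu, if_neg hu']
  have hr : h.surface.IsCut (h.arcs.arc x) r := by
    refine ⟨fun u => ?_, fun u hu => ?_, fun u hu => ?_⟩
    · change r (K.τ₁ u) = r u
      simp only [r, I₁, hp.inv₁, hq.inv₁]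
    · have huL := hAL u hu
      change r (K.recolorτ₀ L s u) = _
      rw [h.recolor_off huL]
      by_cases h1 : I l u
      · rw [rl _ ((I₀ l u huL).2 h1), rl u h1, hp.jump u ((hAl u h1).1 hu)]
      · by_cases h2 : I m u
        · rw [rm _ ((I₀ m u huL).2 h2), rm u h2, hq.jump u ((hAm u h2).1 hu)]
        · exfalso
          rcases (hA u).1 hu with rfl | rfl | rfl | rfl
          · exact h1 Ilx
          · exact h1 ((I₀ l x hxL).2 Ilx)
          · exact h2 Imw
          · exact h2 ((I₀ m _ hwL).2 Imw)
    · change r (K.recolorτ₀ L s u) = _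
      by_cases huL : u ∈ L
      · by_cases h1 : I l u
        · rcases Iend l hl u huL h1 with rfl | rfl
          · rw [rm _ (Iself m), rl _ h1, hqm]
          · rw [hrκl, rm _ (Iκ m hm), rl _ h1, hκκ]
        · by_cases h2 : I m u
          · rcases Iend m hm u huL h2 with rfl | rfl
            · rw [hrm, rl _ (Iself l), rm _ h2, hqm]
            · rw [hrκm, rl _ (Iκ l hl), rm _ h2, hκκ]
          · rw [rf u h1 h2]
            have hinv : K.recolorτ₀ L s (K.recolorτ₀ L s u) = u := h.recolor_inv
            refine rf _ (fun h3 => h2 ?_) fun h3 => h1 ?_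
            · rcases Iend l hl _ (h.recolor_mem huL) h3 with e | e <;> rw [e] at hinv
              · rw [← hinv]; exact Iself m
              · rw [← hinv, hrκl]; exact Iκ m hm
            · rcases Iend m hm _ (h.recolor_mem huL) h3 with e | e <;> rw [e] at hinv
              · rw [← hinv, hrm]; exact Iself l
              · rw [← hinv, hrκm]; exact Iκ l hl
      · rw [h.recolor_off huL]
        by_cases h1 : I l u
        · rw [rl _ ((I₀ l u huL).2 h1), rl u h1, hp.off u (mt (hAl u h1).2 hu)]
        · by_cases h2 : I m u
          · rw [rm _ ((I₀ m u huL).2 h2), rm u h2, hq.off u (mt (hAm u h2).2 hu)]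
          · rw [rf u h1 h2, rf _ (mt (I₀ l u huL).1 h1) (mt (I₀ m u huL).1 h2)]
  have hxD : x ∈ h.arcs.double := ⟨hx, hxL⟩
  have hκr := h.chords_arcs.cut_κ_eq hxD hr
  obtain ⟨hyd, hyL⟩ : y ∈ K.double ∧ y ∉ L := hcr.2.1
  have hyarc : y ∉ h.arcs.arc x := hcr.2.2.2.1
  refine ((h.chords_arcs.crosses_iff hxD hcr.2.1 hr).1 hcr).2 ?_
  change r y = r (K.reconnectκ L s o' y)
  -- The arcs of `l` and `m` are crossed by no arcs other than those of `x` and `w`, so any other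
  -- arc that crosses `L` avoids both half-faces.
  have hBent : ∀ v, K.Bent L v → v ∉ h.arcs.arc x → r v = false := by
    intro v hv hva
    have key : ∀ a ∈ L, I a v → K.Crosses a v := by
      intro a ha hI
      obtain ⟨l₂, hl₂, hc₂⟩ := hv
      have := mem_arc_of_face_eq h.once h.fine ha hl₂ (hc₂.2.2.1.trans hI.1)
      exact hC.crosses_left (hC.arc_comm (h.line.subset ha) this) hc₂
    refine rf v (fun h1 => hva ((hAl v h1).2 ?_)) fun h2 => hva ((hAm v h2).2 ?_)
    · exact K.crosses_unique _ _ _ hlx (key l hl h1)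
    · exact K.crosses_unique _ _ _ hmw (key m hm h2)
  by_cases hay : K.Affected L y
  · have hv := h.mate_reconnect hyd hay
    have hvκ : K.reconnectκ L s o' (K.reconnectκ L s o' y) = y := h.reconnect_eq (h.mate_symm hv)
    have hvarc : K.reconnectκ L s o' y ∉ h.arcs.arc x := fun e => by
      have := h.chords_arcs.κ_mem_arc hxD e
      change K.reconnectκ L s o' _ ∈ _ at this
      rw [hvκ] at this
      exact hyarc this
    rcases id hay with hby | hby
    · have := h.bent_of_continues' (h.continues_of_mate hv hby)
      rw [hBent y hby hyarc, hBent _ this hvarc]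
    · have hc := h.crosses_of_mate hv hby
      have hby' : ¬ K.Bent L y := fun e => h.not_bent_π e hby
      have hbv' : ¬ K.Bent L (K.reconnectκ L s o' y) := fun e =>
        h.not_bent_π e (h.bent_π_of_mate hv hby)
      have hs := h.color_eq_of_crosses hc hby' hbv' hyL
      have hI : ∀ a, I a (K.reconnectκ L s o' y) ↔ I a y := fun a => by
        simp only [I, hs, hc.2.2.1]
      have huniq : ∀ {a b}, b ∈ L → K.Crosses b a → K.Bent L a → K.face b = K.face y →
          ∀ p, K.IsCut (K.arc a) p → p y = p (K.reconnectκ L s o' y) := by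
        intro a b hb hba ha hf p hp
        have hnot : ∀ v, v ∉ L → ¬ K.Crosses a v := fun v hvL hcv =>
          hvL (h.mem_of_mem_arc hb (K.crosses_unique _ _ _ (hC.crosses_symm hba) hcv))
        exact hC.cut_eq_of_crosses (bent_double ha) hp (fun e => hby' (h.bent_of_mem_arc e ha))
          (hba.2.2.1.symm.trans hf) (hnot y hyL)
          (hnot _ (h.notMem_of_affected (affected_of_mate (h.mate_symm hv)))) hc
      by_cases h1 : I l y
      · rw [rl y h1, rl _ ((hI l).2 h1)]
        exact huniq hl hlx hb h1.1.symm p hp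
      · by_cases h2 : I m y
        · rw [rm y h2, rm _ ((hI m).2 h2)]
          exact huniq hm hmw hbw h2.1.symm q hq
        · rw [rf y h1 h2, rf _ (mt (hI l).1 h1) (mt (hI m).1 h2)]
  · rw [reconnect_of_not_affected hay]
    have hby' : ¬ K.Bent L y := fun e => hay (.inl e)
    have hI : ∀ a, I a (K.κ y) ↔ I a y := h.color_κ_eq_of_not_bent hyd hby'
    have huniq : ∀ {a b}, b ∈ L → K.Crosses b a → K.Bent L a → K.face b = K.face y →
        ∀ p, K.IsCut (K.arc a) p → p y = p (K.κ y) := by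
      intro a b hb hba ha hf p hp
      by_contra hne
      exact hyL (h.mem_of_mem_arc hb (K.crosses_unique _ _ _ (hC.crosses_symm hba)
        ((hC.crosses_iff (bent_double ha) hyd hp).2 ⟨hba.2.2.1.symm.trans hf, hne⟩)))
    by_cases h1 : I l y
    · rw [rl y h1, rl _ ((hI l).2 h1)]
      exact huniq hl hlx hb h1.1.symm p hp
    · by_cases h2 : I m y
      · rw [rm y h2, rm _ ((hI m).2 h2)]
        exact huniq hm hmw hbw h2.1.symm q hq
      · rw [rf y h1 h2, rf _ (mt (hI l).1 h1) (mt (hI m).1 h2)]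

end IsRegluing

end StandardComplex

/-! ### The third sheet, and the smoothed complex -/

namespace StandardComplex

variable {F : Type*} {K : StandardComplex F} {o o' s : F → Bool} {L : Set F} {x y z l u v w : F}

namespace IsRegluing

variable [Finite F] (h : K.IsRegluing L o s o')
include h

/-- In the third sheet of a triple point on `L`, the reconnected arcs cross no other arcs. -/
theorem not_crosses_of_bent_π (hx : x ∈ K.double) (hb : K.Bent L (K.π x)) (y : F) :
    ¬ h.arcs.Crosses x y := by
  intro hcr
  have hC := h.chords
  have hC' := h.chords_arcs
  have hax : K.Affected L x := .inr hb
  have hxL := h.notMem_of_affected hax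
  have hz := h.mate_reconnect hx hax
  set z := K.reconnectκ L s o' x with hzdef
  have hxz := h.crosses_of_mate hz hb
  have hzx := hC.crosses_symm hxz
  have hzd := hxz.2.1
  have haz := affected_of_mate (h.mate_symm hz)
  have hzL := h.notMem_of_affected haz
  have hbx : ¬ K.Bent L x := fun e => h.not_bent_π e hb
  have hbz : ¬ K.Bent L z := fun e => h.not_bent_π e (h.bent_π_of_mate hz hb)
  have hfz : K.face z = K.face x := hxz.2.2.1.symm
  obtain ⟨p, hp, -⟩ := hC.exists_cut hx
  obtain ⟨q, hq, -⟩ := hC.exists_cut hzd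
  have hpz := ((hC.crosses_iff hx hzd hp).1 hxz).2
  have hqx := ((hC.crosses_iff hzd hx hq).1 hzx).2
  have hdisj : ∀ u ∈ K.arc x, u ∉ K.arc z := fun u hu hu' => hxz.2.2.2.1 (by
    have := hC.arc_comm hzd hu'
    rwa [hC.arc_eq hx hu] at this)
  have hpτ : p (K.τ₀ (K.κ z)) = p (K.κ z) :=
    hp.off _ fun e => hdisj _ e (.inr (.inr (.inl rfl)))
  have hqτ : q (K.τ₀ (K.κ x)) = q (K.κ x) := hq.off _ (hdisj _ (.inr (.inr (.inl rfl))))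
  -- The new arc joins a half of the arc of `x` to a half of the arc of `z`, and so cuts a quadrant
  -- off the face. `L` meets none of the two arcs, so the quadrant cut can be normalized to vanish
  -- on `L`.
  have hQ := CellSurface.IsCut.quadrant hp hq hdisj (Ne.symm hpz) (Ne.symm hqx)
  have hchord : ∀ u ∈ K.chord x z, K.face u = K.face x := by
    rintro u (rfl | rfl | rfl | rfl)
    · rfl
    · exact K.face_τ₀ _
    · exact hfz
    · exact (K.face_τ₀ _).trans hfz
  obtain ⟨r, hr, hrL, hrx, hrQ⟩ := hQ.exists_normalized (B := L) (a := x) hchord (by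
    intro u hu v hv hux hvx
    have e1 := h.cut_eq_on_line hx hxL hbx hp hu hv hux hvx
    have e2 := h.cut_eq_on_line hzd hzL hbz hq hu hv (hux.trans hfz.symm) (hvx.trans hfz.symm)
    simp only [e1, e2])
  have hA : ∀ u, u ∈ h.arcs.arc x ↔ u ∈ K.chord x z := fun u => h.mem_arc_arcs hx hxL
  have hr' : h.surface.IsCut (h.arcs.arc x) r := by
    rw [Set.ext hA]
    refine h.isCut_surface hr ?_ hrL
    rintro u (rfl | rfl | rfl | rfl)
    · exact hxL
    · exact mt h.τ₀_mem_iff.1 hxL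
    · exact hzL
    · exact mt h.τ₀_mem_iff.1 hzL
  have hxD : x ∈ h.arcs.double := ⟨hx, hxL⟩
  obtain ⟨hyd, hyL⟩ : y ∈ K.double ∧ y ∉ L := hcr.2.1
  have hyarc : y ∉ h.arcs.arc x := hcr.2.2.2.1
  refine ((hC'.crosses_iff hxD hcr.2.1 hr').1 hcr).2 ?_
  change r y = r (K.reconnectκ L s o' y)
  have hby : ¬ K.Bent L y := fun e => h.not_crosses_of_bent e x (hC'.crosses_symm hcr)
  -- away from the face of `x` there is nothing to show
  have hred : ∀ v, K.face v = K.face y → (K.face y = K.face x → p y = p v ∧ q y = q v) →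
      r y = r v := by
    intro v hv himp
    by_cases hyx : K.face y = K.face x
    · obtain ⟨e1, e2⟩ := himp hyx
      exact (hrQ y v hyx (hv.trans hyx)).2 (by simp only [e1, e2])
    · have h1 : r y = false := Bool.eq_false_of_not_eq_true fun e => hyx (hrx y e)
      have h2 : r v = false := Bool.eq_false_of_not_eq_true fun e => hyx (hv.symm.trans (hrx v e))
      rw [h1, h2]
  -- The ends of the complementary halves, which form the other reconnected arc, lie outside the
  -- quadrant.
  have hout : ∀ v, v ∉ h.arcs.arc x → (v ∈ K.arc x ∨ v ∈ K.arc z) →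
      ((p v == p z) && (q v == q x)) = false := by
    intro v hv hvxz
    rw [hA] at hv
    rcases hvxz with (rfl | rfl | rfl | rfl) | (rfl | rfl | rfl | rfl)
    · exact absurd (.inl rfl) hv
    · exact absurd (.inr (.inl rfl)) hv
    · rw [beq_eq_false_iff_ne.2 (Ne.symm hqx), Bool.and_false]
    · rw [hqτ, beq_eq_false_iff_ne.2 (Ne.symm hqx), Bool.and_false]
    · exact absurd (.inr (.inr (.inl rfl))) hv
    · exact absurd (.inr (.inr (.inr rfl))) hv
    · rw [beq_eq_false_iff_ne.2 (Ne.symm hpz), Bool.false_and]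
    · rw [hpτ, beq_eq_false_iff_ne.2 (Ne.symm hpz), Bool.false_and]
  have hnx : ∀ v, v ∉ K.arc z → ¬ K.Crosses x v := fun v hv hc =>
    hv (K.crosses_unique _ _ _ hxz hc)
  have hnz : ∀ v, v ∉ K.arc x → ¬ K.Crosses z v := fun v hv hc =>
    hv (K.crosses_unique _ _ _ hzx hc)
  by_cases hay : K.Affected L y
  · have hv := h.mate_reconnect hyd hay
    have hvκ : K.reconnectκ L s o' (K.reconnectκ L s o' y) = y := h.reconnect_eq (h.mate_symm hv)
    set v := K.reconnectκ L s o' y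
    have hvarc : v ∉ h.arcs.arc x := fun e => by
      have := hC'.κ_mem_arc hxD e
      change K.reconnectκ L s o' _ ∈ _ at this
      rw [hvκ] at this
      exact hyarc this
    have hyv := h.crosses_of_mate hv (hay.resolve_left hby)
    have hfv : K.face v = K.face y := hyv.2.2.1.symm
    by_cases hyxz : y ∈ K.arc x ∨ y ∈ K.arc z
    · have hvxz : v ∈ K.arc x ∨ v ∈ K.arc z := by
        rcases hyxz with e | e
        · exact .inr (K.crosses_unique _ _ _ hxz (hC.crosses_left (hC.arc_comm hx e) hyv))
        · exact .inl (K.crosses_unique _ _ _ hzx (hC.crosses_left (hC.arc_comm hzd e) hyv))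
      have hfy : K.face y = K.face x := by
        rcases hyxz with e | e
        · exact hC.face_eq_of_mem_arc hx e
        · exact (hC.face_eq_of_mem_arc hzd e).trans hfz
      refine (hrQ y v hfy (hfv.trans hfy)).2 ?_
      rw [hout y hyarc hyxz, hout v hvarc hvxz]
    · push Not at hyxz
      have hvx : v ∉ K.arc x := fun e => hyxz.2 (K.crosses_unique _ _ _ hxz
        (hC.crosses_left (hC.arc_comm hx e) (hC.crosses_symm hyv)))
      have hvz : v ∉ K.arc z := fun e => hyxz.1 (K.crosses_unique _ _ _ hzx
        (hC.crosses_left (hC.arc_comm hzd e) (hC.crosses_symm hyv)))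
      exact hred v hfv fun hyx =>
        ⟨hC.cut_eq_of_crosses hx hp hyxz.1 hyx.symm (hnx y hyxz.2) (hnx v hvz) hyv,
          hC.cut_eq_of_crosses hzd hq hyxz.2 (hfz.trans hyx.symm) (hnz y hyxz.1) (hnz v hvx) hyv⟩
  · rw [reconnect_of_not_affected hay]
    have hyx : y ∉ K.arc x := fun e => hay (h.affected_of_mem_arc hx e hax)
    have hyz : y ∉ K.arc z := fun e => hay (h.affected_of_mem_arc hzd e haz)
    refine hred _ (hC.chord y hyd).face_eq fun hf => ⟨?_, ?_⟩
    · by_contra hne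
      exact hnx y hyz ((hC.crosses_iff hx hyd hp).2 ⟨hf.symm, hne⟩)
    · by_contra hne
      exact hnz y hyx ((hC.crosses_iff hzd hyd hq).2 ⟨hfz.trans hf.symm, hne⟩)

/-- The triple points on `L` disappear: in the sheets crossed by `L`, and in the third sheet as
well, the reconnected arcs cross nothing. -/
theorem not_affected_of_crosses (hc : h.arcs.Crosses x y) :
    ¬ K.Affected L x ∧ ¬ K.Affected L y := by
  have key : ∀ {x y}, h.arcs.Crosses x y → ¬ K.Affected L x := by
    rintro x y hc (hb | hb)
    · exact h.not_crosses_of_bent hb y hc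
    · exact h.not_crosses_of_bent_π hc.1.1 hb y hc
  exact ⟨key hc, key (h.chords_arcs.crosses_symm hc)⟩

theorem crosses_of_crosses_arcs (hc : h.arcs.Crosses x y) : K.Crosses x y :=
  (h.crosses_arcs_iff hc.1.1 hc.1.2 (h.not_affected_of_crosses hc).1 hc.2.1.1 hc.2.1.2
    (h.not_affected_of_crosses hc).2).1 hc

/-- The arcs at a crossing belong to one triple point, so if `y` were on `L` or affected by it,
uniqueness of crossings and `triple` would force the same for `x`. Hence triple points off `L`
survive in all three sheets. -/
theorem notMem_and_not_affected_of_crosses (hc : K.Crosses x y) (hx : x ∉ L)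
    (ha : ¬ K.Affected L x) : y ∉ L ∧ ¬ K.Affected L y := by
  have hC := h.chords
  refine ⟨fun hy => ha (.inl ⟨y, hy, hC.crosses_symm hc⟩), ?_⟩
  rintro (⟨l, hl, hly⟩ | ⟨l, hl, hly⟩)
  · have := K.crosses_unique _ _ _ (hC.crosses_symm hly) (hC.crosses_symm hc)
    exact hx (h.mem_of_mem_arc hl this)
  · obtain ⟨z, hz, hz'⟩ := K.triple l _ hly
    rw [K.π_π y hc.2.1] at hz'
    have h1 := K.crosses_unique _ _ _ (hC.crosses_symm hz') (hC.crosses_symm hc)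
    have h2 := π_mem_arc (K.double_π z hz.2.1) h1
    rw [K.π_π z hz.2.1] at h2
    exact ha (.inr ⟨K.π l, h.line.π_mem hl, hC.crosses_right h2 hz⟩)

/-- The second clause of `Mate` is the image of the first under the pasting, up to `τ₀`, so
reconnected arcs are again pasted to reconnected arcs. -/
theorem π_reconnect (hx : x ∈ K.double) (hxL : x ∉ L) :
    K.π (K.reconnectκ L s o' x) = K.reconnectκ L s o' (K.π x) ∨
      K.π (K.reconnectκ L s o' x) = K.recolorτ₀ L s (K.reconnectκ L s o' (K.π x)) := by
  have hπd := K.double_π x hx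
  have hπL := mt (h.π_mem_iff hx).1 hxL
  have hκL : K.reconnectκ L s o' (K.π x) ∉ L := (h.chords_arcs.double_κ _ ⟨hπd, hπL⟩).2
  rw [h.recolor_off hκL]
  by_cases ha : K.Affected L x
  · have hw := h.mate_reconnect hx ha
    have ha' := (affected_π hx).2 ha
    have hv := h.mate_reconnect hπd ha'
    set w := K.reconnectκ L s o' x
    set v := K.reconnectκ L s o' (K.π x)
    have hwd := (h.mate_double hw).2
    have hvd := (h.mate_double hv).2
    rcases ha with hb | hb
    · have hxw := h.continues_of_mate hw hb
      rcases hv with hv | ⟨-, -, -, hv⟩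
      · exact absurd (bent_of_continues hv) (h.not_bent_π hb)
      rw [K.π_π x hx] at hv
      rcases hv with hv | hv
      · left; rw [← h.continues_unique hxw hv, K.π_π v hvd]
      · right
        rw [← h.continues_unique hxw hv, K.π_τ₀ _ (K.double_π v hvd), K.π_π v hvd]
    · have hxv := h.continues_of_mate hv hb
      rcases hw with hw | ⟨-, -, -, hw⟩
      · exact absurd hb (h.not_bent_π (bent_of_continues hw))
      rcases hw with hw | hw
      · exact .inl (h.continues_unique hxv hw)
      · right; rw [← h.continues_unique hxv hw, K.inv₀]
  · rw [reconnect_of_not_affected ha, reconnect_of_not_affected (mt (affected_π hx).1 ha)]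
    exact K.π_κ x hx

/-- The standard complex obtained by smoothing. -/
noncomputable def complex : StandardComplex F where
  toPairedArcs := h.arcs
  double_τ₀ := h.chords_arcs.double_τ₀
  double_τ₂ x hx := ⟨K.double_τ₂ x hx.1, mt h.τ₂_mem_iff.1 hx.2⟩
  double_κ := h.chords_arcs.double_κ
  double_π x hx := ⟨K.double_π x hx.1, mt (h.π_mem_iff hx.1).1 hx.2⟩
  κ_κ := h.chords_arcs.κ_κ
  κ_τ₀ := h.chords_arcs.κ_τ₀
  κ_ne x hx := ⟨(h.chords_arcs.chord x hx).ne', (h.chords_arcs.chord x hx).ne⟩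
  κ_side x hx := (h.chords_arcs.chord x hx).samePiece h.orient'
  π_π x hx := K.π_π x hx.1
  π_τ₀ x hx := by
    change K.π (K.recolorτ₀ L s x) = K.recolorτ₀ L s (K.π x)
    rw [h.recolor_off hx.2, h.recolor_off (mt (h.π_mem_iff hx.1).1 hx.2), K.π_τ₀ x hx.1]
  π_τ₂ x hx := K.π_τ₂ x hx.1
  π_ne x hx := by
    change K.π x ∉ ({x, K.recolorτ₀ L s x, K.τ₂ x, K.recolorτ₀ L s (K.τ₂ x)} : Set F)
    rw [h.recolor_off hx.2, h.recolor_off (mt h.τ₂_mem_iff.1 hx.2)]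
    exact K.π_ne x hx.1
  π_κ x hx := h.π_reconnect hx.1 hx.2
  crosses_unique x y y' hc hc' := by
    rw [h.arc_arcs_of_not_affected hc.2.1.1 hc.2.1.2 (h.not_affected_of_crosses hc).2]
    exact K.crosses_unique x y y' (h.crosses_of_crosses_arcs hc) (h.crosses_of_crosses_arcs hc')
  crosses_not_cusp x y hc := by
    rw [h.arc_arcs_of_not_affected hc.1.1 hc.1.2 (h.not_affected_of_crosses hc).1]
    exact K.crosses_not_cusp x y (h.crosses_of_crosses_arcs hc)
  crosses_not_paired x hc := K.crosses_not_paired x (h.crosses_of_crosses_arcs hc)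
  triple x y hc := by
    obtain ⟨hax, hay⟩ := h.not_affected_of_crosses hc
    obtain ⟨⟨hx, hxL⟩, ⟨hy, hyL⟩, -⟩ := id hc
    obtain ⟨z, hz, hz'⟩ := K.triple x y (h.crosses_of_crosses_arcs hc)
    have hπxL := mt (h.π_mem_iff hx).1 hxL
    have hπyL := mt (h.π_mem_iff hy).1 hyL
    have haπx := mt (affected_π hx).1 hax
    obtain ⟨hzL, haz⟩ := h.notMem_and_not_affected_of_crosses hz hπxL haπx
    have hzd := hz.2.1
    exact ⟨z, (h.crosses_arcs_iff hz.1 hπxL haπx hzd hzL haz).2 hz,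
      (h.crosses_arcs_iff hz'.1 (mt (h.π_mem_iff hzd).1 hzL) (mt (affected_π hzd).1 haz)
        hz'.2.1 hπyL (mt (affected_π hy).1 hay)).2 hz'⟩

theorem isSmoothing : K.IsSmoothing L h.complex where
  isDoubleLine := h.line
  τ₁_eq := rfl
  τ₂_eq := rfl
  τ₀_off _ := h.recolor_off
  τ₀_on _ := h.recolor_on
  τ₀_continuous _ := h.recolor_κ
  double_eq := rfl
  π_eq _ _ := rfl
  κ_eq x hx hl := reconnect_of_not_affected (by
    rintro (⟨l, hl', hc⟩ | ⟨l, hl', hc⟩)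
    · exact (hl l hl').1 hc
    · exact (hl l hl').2 hc)
  κ_reconnect x hx l hl hc :=
    have hb : K.Bent L x := ⟨l, hl, hc⟩
    h.crosses_π_of_continues (h.continues_of_mate (h.mate_reconnect hx.1 (.inl hb)) hb) hc

end IsRegluing

/-- The F-lemma for 2-knots. -/
theorem exists_isSmoothing_isTwoKnot [Finite F] (hK : K.IsTwoKnot) (hL : K.IsDoubleLine L)
    (hp : K.PassesTriplePointsOnce L) (hf : K.IsFineAlong L) :
    ∃ K' : StandardComplex F, K.IsSmoothing L K' ∧ K'.IsTwoKnot := by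
  obtain ⟨hc, hor, hχ⟩ := hK
  obtain ⟨o, ho⟩ := hor.exists_isOrientation
  obtain ⟨s, hs, hs₂⟩ := CellSurface.exists_cut_of_chords hc (by simpa using hχ) ho L K.κ
    (fun _ => hL.τ₀_mem) (fun _ => hL.τ₂_mem) (fun _ => hL.κ_mem)
    (fun x hx => K.κ_κ x (hL.subset hx)) (fun x hx => K.κ_τ₀ x (hL.subset hx))
    (fun x hx => (isChordSystem ho).chord x (hL.subset hx))
  have hcol : K.IsColoring L o s := ⟨hL, hp, hf, ho, hs, hs₂⟩
  obtain ⟨o', ho', hoo'⟩ := hcol.exists_orientation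
  have h : K.IsRegluing L o s o' := ⟨hcol, ho', hoo'⟩
  have hsm := h.isSmoothing
  have hc' : h.complex.Connected := hcol.connected_surface hc
  have hor' : h.complex.Orientable := ⟨o', fun x => ⟨ho'.flip₀ x, ho'.flip₁ x, ho'.flip₂ x⟩⟩
  refine ⟨h.complex, hsm, hc', hor', ?_⟩
  -- The Euler characteristic starts at 2, does not decrease, and cannot exceed 2.
  have h1 := hsm.eulerChar_le hp hf ho
  have h2 := CellSurface.eulerChar_le_two hc' hor'
  push_cast at hχ ⊢
  omega

end StandardComplex

theorem mainTheorem4 :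
    (∀ (F : Type*) [Finite F] (K K' : StandardComplex F) (L : Set F) (g : ℕ),
      K.IsSurfaceKnot g → K.IsSmoothing L K' →
      K.PassesTriplePointsOnce L → K.IsFineAlong L →
      K'.Connected → K'.Orientable →
      ∃ g' : ℕ, K'.IsSurfaceKnot g' ∧ g' ≤ g) ∧
    (∀ (F : Type*) [Finite F] (K : StandardComplex F) (L : Set F),
      K.IsTwoKnot → K.IsDoubleLine L →
      K.PassesTriplePointsOnce L → K.IsFineAlong L →
      ∃ K' : StandardComplex F, K.IsSmoothing L K' ∧ K'.IsTwoKnot) ∧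
    (∀ (F : Type*) [Finite F] (K K' : StandardComplex F) (L : Set F) (n g n' g' : ℕ),
      K.IsSurfaceLink n g → K.IsSmoothing L K' →
      K.PassesTriplePointsOnce L → K.IsFineAlong L →
      K'.IsSurfaceLink n' g' →
      (g' : ℤ) ≤ g + ((n' : ℤ) - n)) :=
  ⟨fun _ _ _ _ _ _ hK hs hp hf hc hor =>
      StandardComplex.exists_isSurfaceKnot_of_isSmoothing hK hs hp hf hc hor,
    fun _ _ _ _ hK hL hp hf => StandardComplex.exists_isSmoothing_isTwoKnot hK hL hp hf,
    fun _ _ _ _ _ _ _ _ _ hK hs hp hf hK' =>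
      StandardComplex.genus_le_of_isSmoothing hK hs hp hf hK'⟩
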